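/- Conventions. Let $\Gamma$ be a finite simple graph and $\mathcal G=\{G_u\mid u\in V(\Gamma)\}$ a collection of non-trivial finitely generated groups. The graph product $\Gamma\mathcal G$ is the quotient of the free product of the groups $G_u$ by the relations $[g,h]=1$ for all $g\in G_u$, $h\in G_v$ with $\{u,v\}\in E(\Gamma)$. We write $\langle\mathrm{link}(u)\rangle$ for the subgroup of $\Gamma\mathcal G$ generated by the $G_v$ with $v$ adjacent to $u$. For every $u$ fix a finite generating set $S_u$ of $G_u$, and endow $\Gamma\mathcal G$ with the word metric $d$ associated with $\bigcup_u S_u$. For a weight $\nu:V(\Gamma)\to\mathbb N_{\ge 2}$, let $\Gamma(\nu)$ be the graph product over $\Gamma$ of the cyclic groups $\mathbb Z/\nu(u)\mathbb Z$, endowed with the word metric given by the standard generators of these cyclic groups. For $A>0$ and $B\ge 0$, a map $f:X\to Y$ between metric spaces is an $(A,B)$-quasi-isometric embedding if $\frac1A d(x,x')-B\le d(f(x),f(x'))\le A\,d(x,x')+B$ for all $x,x'\in X$. An $(A,B)$-quasigeodesic in $\Gamma\mathcal G$ is an $(A,B)$-quasi-isometric embedding of an integer interval $\{0,\dots,n\}$.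 A bi-infinite geodesic is an isometric embedding $\gamma:\mathbb Z\to\Gamma\mathcal G$. A Morse gauge is a map $M:[0,+\infty)\times[0,+\infty)\to[0,+\infty)$. The geodesic $\gamma$ is $M$-Morse if, for all $A>0$ and $B\ge0$, every $(A,B)$-quasigeodesic connecting two points of $\gamma$ lies in the $M(A,B)$-neighbourhood of $\gamma$. Theorem. For every Morse gauge $M$ and every integer $k_0\ge 0$ there exist constants $A>0$ and $B\ge 0$, depending only on $M$ and $k_0$, such that the following holds. Let $\Gamma$ be a finite simple graph, let $\mathcal G$ be a collection of non-trivial finitely generated groups indexed by $V(\Gamma)$, and let $S_u$ be a finite generating set of $G_u$ for every $u\in V(\Gamma)$. Assume that, for every $u\in V(\Gamma)$, * if $G_u$ is infinite, then $\langle\mathrm{link}(u)\rangle$ is infinite; * $G_u$ has cardinality at least $k_0$. Then, for every bi-infinite $M$-Morse geodesic $\gamma$ in $\Gamma\mathcal G$, there exist a weight $\nu:V(\Gamma)\to\mathbb N_{\ge2}$ with $\nu(u)\ge k_0$ for every $u$ and an $(A,B)$-quasi-isometric embedding $\Gamma(\nu)\to\Gamma\mathcal G$ whose image contains $\gamma$.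 -/

import Mathlib

open scoped NNReal

universe u v

/-! ### Coarse geometry of graphs

A graph is regarded as a metric space through its vertex set with the path metric `SimpleGraph.dist`.
-/

namespace SimpleGraph

/-- `f` is an `(A, B)`-quasi-isometric embedding of (the vertex set of) `X` in `Y`. -/
def IsQIEmbedding {V : Type u} {W : Type v} (X : SimpleGraph V) (Y : SimpleGraph W)
    (A B : ℝ) (f : V → W) : Prop :=
  ∀ x y : V, (1 / A) * (X.dist x y : ℝ) - B ≤ (Y.dist (f x) (f y) : ℝ) ∧
    (Y.dist (f x) (f y) : ℝ) ≤ A * (X.dist x y : ℝ) + B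

/-- The points `c 0, c 1, …, c n` form an `(A, B)`-quasigeodesic: `c` is an `(A, B)`-quasi-isometric
embedding of the integer interval `{0, …, n}`. -/
def IsQuasigeodesic {V : Type u} (X : SimpleGraph V) (A B : ℝ) (n : ℕ) (c : ℕ → V) : Prop :=
  ∀ i j : ℕ, i ≤ n → j ≤ n →
    (1 / A) * |(i : ℝ) - (j : ℝ)| - B ≤ (X.dist (c i) (c j) : ℝ) ∧
      (X.dist (c i) (c j) : ℝ) ≤ A * |(i : ℝ) - (j : ℝ)| + B

/-- `Y` is Morse with Morse gauge `M`: every `(A, B)`-quasigeodesic with both endpoints in `Y` stays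
in the `M A B`-neighbourhood of `Y`. -/
def IsMorse {V : Type u} (X : SimpleGraph V) (M : ℝ≥0 → ℝ≥0 → ℝ≥0) (Y : Set V) : Prop :=
  ∀ A B : ℝ≥0, 0 < A → ∀ (n : ℕ) (c : ℕ → V), X.IsQuasigeodesic A B n c →
    c 0 ∈ Y → c n ∈ Y → ∀ i ≤ n, ∃ y ∈ Y, (X.dist (c i) y : ℝ) ≤ M A B

/-- `γ` is a bi-infinite geodesic: an isometric embedding of `ℤ`. -/
def IsBiinfiniteGeodesic {V : Type u} (X : SimpleGraph V) (γ : ℤ → V) : Prop :=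
  ∀ i j : ℤ, (X.dist (γ i) (γ j) : ℤ) = |i - j|

end SimpleGraph

/-! ### Graph products of groups -/

/-- The relators `[g, h]`, with `g ∈ G a`, `h ∈ G b`, where `a` and `b` are adjacent in `Γ`. -/
def graphProductRelators {V : Type u} (Γ : SimpleGraph V) (G : V → Type v)
    [∀ a, Group (G a)] : Set (Monoid.CoprodI G) :=
  {x | ∃ a b : V, Γ.Adj a b ∧ ∃ (g : G a) (h : G b),
    x = Monoid.CoprodI.of g * Monoid.CoprodI.of h * (Monoid.CoprodI.of g)⁻¹ * (Monoid.CoprodI.of h)⁻¹}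

/-- The graph product `ΓG = ⟨ G a (a ∈ V) ∣ [G a, G b] = 1 (a, b adjacent) ⟩`: the quotient of the free
product of the vertex groups by the normal closure of the relators. -/
def GraphProduct {V : Type u} (Γ : SimpleGraph V) (G : V → Type v) [∀ a, Group (G a)] :
    Type (max u v) :=
  Monoid.CoprodI G ⧸ Subgroup.normalClosure (graphProductRelators Γ G)

namespace GraphProduct

instance {V : Type u} (Γ : SimpleGraph V) (G : V → Type v) [∀ a, Group (G a)] :
    Group (GraphProduct Γ G) :=
  inferInstanceAs
    (Group (Monoid.CoprodI G ⧸ Subgroup.normalClosure (graphProductRelators Γ G)))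

/-- The canonical homomorphism from a vertex group to the graph product. -/
def of {V : Type u} (Γ : SimpleGraph V) (G : V → Type v) [∀ a, Group (G a)] (a : V) :
    G a →* GraphProduct Γ G :=
  (QuotientGroup.mk' (Subgroup.normalClosure (graphProductRelators Γ G))).comp
    (Monoid.CoprodI.of (M := G) (i := a))

/-- The subgroup `⟨link(a)⟩` of the graph product: it is generated by the vertex groups of the
neighbours of `a`. -/
def linkSubgroup {V : Type u} (Γ : SimpleGraph V) (G : V → Type v) [∀ a, Group (G a)] (a : V) :
    Subgroup (GraphProduct Γ G) :=
  ⨆ b ∈ Γ.neighborSet a, (of Γ G b).range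

/-- The Cayley graph of the graph product with respect to the union of the sets `S a ⊆ G a`. -/
def cayleyGraph {V : Type u} (Γ : SimpleGraph V) (G : V → Type v) [∀ a, Group (G a)]
    (S : ∀ a, Set (G a)) : SimpleGraph (GraphProduct Γ G) :=
  SimpleGraph.mulCayley (⋃ a, of Γ G a '' S a)

end GraphProduct

/-- `Γ(ν)`: the graph product over `Γ` of the cyclic groups `ℤ / ν(a)`. -/
abbrev CyclicGraphProduct {V : Type u} (Γ : SimpleGraph V) (ν : V → ℕ) : Type u :=
  GraphProduct Γ (fun a => Multiplicative (ZMod (ν a)))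

/-- The Cayley graph of `Γ(ν)` with respect to the standard generators of its cyclic vertex groups. -/
def cyclicCayleyGraph {V : Type u} (Γ : SimpleGraph V) (ν : V → ℕ) :
    SimpleGraph (CyclicGraphProduct Γ ν) :=
  GraphProduct.cayleyGraph Γ (fun a => Multiplicative (ZMod (ν a)))
    (fun _ => {Multiplicative.ofAdd 1})

/-!
Every group occurring below is treated through right multiplication: a path in a Cayley graph is
changed letter by letter, and the two maps which are needed, the map `f` from `Γ(ν)` and its left
inverse `g`, are built as an orbit map of a right action (`GraphProduct.exists_action`) and as the
integral of a cocycle (`GraphProduct.exists_of_cocycle`). Both only have to be checked on the vertex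
groups and on pairs of adjacent vertices, so that no normal form theorem is needed. Since `g ∘ f =
id` and both maps are Lipschitz with constants depending on `M` and `k₀` only, `f` is a
quasi-isometric embedding.

Coordinates. For a vertex `a` and a coset `H` of `⟨star(a)⟩`, `coord y a H ∈ G a` is the product of
the letters of `G a` which are read inside `H` on the way from `1` to `y`. Along a geodesic line
through `1` these coordinates trace out a geodesic of `G a` (`GeodesicLine.norm_coord`), and the
line stays inside `H` between two letters of `G a` read inside `H`
(`GeodesicLine.cls_of_height_between`).

Morse property. If some coordinate at `a` is longer than a bound `D` which depends on `M` only, then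
the line contains a long segment in the direction of `G a` inside a coset of the product `G a ×
⟨link(a)⟩`. A detour around it through a far copy of `G a` would be a quasigeodesic, whence
`⟨link(a)⟩` has at most radius `D` (`link_bounded_of_morse`). Let `R` be the set of these vertices.
They are pairwise non-adjacent; by the hypothesis on infinite vertex groups, `G a` and `⟨link(a)⟩`
are finite for `a ∈ R`, and there is a vertex `wit a` outside the star of `a`.

Vertices outside `R`. All coordinates of the line at `H` belong to a set of at most `2D + 1`
elements, and this set is enlarged to the image of a section `ℤ/ν(a) → G a` into a bounded ball.
Moving inside the images of the sections (`Sections.std`) defines `Sections.emb`, whose image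
contains every line with coordinates in these images (`Sections.emb_back_line`).

Vertices in `R`. Here `G a` is finite, but of unbounded size, while `ν(a)` has to be bounded. The
coordinates of the line at `H` form a chain in `G a` which is unrolled instead of being embedded in
one coset: the points at each step of the chain beyond the image of the section are exchanged with
points of a new coset, which is reached from the preceding step of the chain through a letter of
`wit a` (`Shear.jump`, `Shear.swap`). Conjugating the action by these involutions yields
`Shear.shear`, and `Shear.unroll` is its left inverse. That the link of `a` is bounded makes the
exchange a bounded perturbation, and as the link part is carried along, the conjugated action still
commutes with the actions of the neighbours of `a`. The line never visits the new cosets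
(`Shear.not_sheared_line`), for it would otherwise leave `H` between two steps of the chain and come
back; this is why it lies in the image of the shear (`Shear.line_mem_range`).
-/

universe w

/-! ### The word norm of a group with a generating set -/

section WordNorm

variable {M : Type*} [Group M]

/-- The word norm of `y` with respect to `A`: the distance from `1` to `y` in the Cayley graph. -/
noncomputable def wordNorm (A : Set M) (y : M) : ℕ := (SimpleGraph.mulCayley A).dist 1 y

theorem mulCayley_dist_mul_left (A : Set M) (d x y : M) :
    (SimpleGraph.mulCayley A).dist (d * x) (d * y) = (SimpleGraph.mulCayley A).dist x y := by
  have key : ∀ (d x y : M), (SimpleGraph.mulCayley A).edist (d * x) (d * y) ≤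
      (SimpleGraph.mulCayley A).edist x y := by
    intro d x y
    by_cases h : (SimpleGraph.mulCayley A).edist x y = ⊤
    · rw [h]; exact le_top
    · obtain ⟨p, hp⟩ := SimpleGraph.exists_walk_of_edist_ne_top h
      let φ : SimpleGraph.mulCayley A →g SimpleGraph.mulCayley A :=
        ⟨fun z => d * z, fun h => SimpleGraph.mulCayley_adj_mul_iff_right.2 h⟩
      rw [← hp, ← SimpleGraph.Walk.length_map φ p]
      exact SimpleGraph.edist_le (p.map φ)
  have : (SimpleGraph.mulCayley A).edist (d * x) (d * y) =
      (SimpleGraph.mulCayley A).edist x y := by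
    refine le_antisymm (key d x y) ?_
    simpa using key d⁻¹ (d * x) (d * y)
  simp only [SimpleGraph.dist, this]

theorem dist_eq_wordNorm (A : Set M) (x y : M) :
    (SimpleGraph.mulCayley A).dist x y = wordNorm A (x⁻¹ * y) := by
  rw [wordNorm, ← mulCayley_dist_mul_left A x⁻¹ x y, inv_mul_cancel]

@[simp] theorem wordNorm_one (A : Set M) : wordNorm A (1 : M) = 0 := by simp [wordNorm]

theorem wordNorm_inv (A : Set M) (y : M) : wordNorm A y⁻¹ = wordNorm A y := by
  have h := dist_eq_wordNorm A y 1
  rw [mul_one] at h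
  rw [← h, SimpleGraph.dist_comm, wordNorm]

theorem wordNorm_le_one {A : Set M} {a : M} (ha : a ∈ A ∨ a⁻¹ ∈ A) : wordNorm A a ≤ 1 := by
  by_cases h : a = 1
  · simp [h]
  · refine le_of_eq (SimpleGraph.dist_eq_one_iff_adj.2 ?_)
    rw [SimpleGraph.mulCayley_adj]
    refine ⟨fun h' => h h'.symm, ?_⟩
    simpa using ha

theorem mulCayley_connected {A : Set M} (hA : Subgroup.closure A = ⊤) :
    (SimpleGraph.mulCayley A).Connected := by
  have key : ∀ y : M, (SimpleGraph.mulCayley A).Reachable 1 y := by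
    intro y
    have hy : y ∈ Subgroup.closure A := by rw [hA]; trivial
    have step : ∀ x a : M, (a ∈ A ∨ a⁻¹ ∈ A) → (SimpleGraph.mulCayley A).Reachable x (x * a) := by
      intro x a ha
      by_cases h : a = 1
      · simp [h]
      · refine SimpleGraph.Adj.reachable ?_
        rw [SimpleGraph.mulCayley_adj]
        refine ⟨fun h' => h (by simpa using h'), ?_⟩
        simpa using ha
    induction hy using Subgroup.closure_induction_right with
    | one => exact SimpleGraph.Reachable.refl _
    | mul_right x hx a ha ih => exact ih.trans (step x a (Or.inl ha))
    | mul_inv_cancel x hx a ha ih => exact ih.trans (step x a⁻¹ (Or.inr (by simpa using ha)))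
  have : Nonempty M := ⟨1⟩
  exact ⟨fun x y => (key x).symm.trans (key y)⟩

theorem wordNorm_mul_le {A : Set M} (hA : Subgroup.closure A = ⊤) (x y : M) :
    wordNorm A (x * y) ≤ wordNorm A x + wordNorm A y := by
  have h := (mulCayley_connected hA).dist_triangle (u := 1) (v := x) (w := x * y)
  rwa [dist_eq_wordNorm A x (x * y), inv_mul_cancel_left] at h

theorem wordNorm_triangle {A : Set M} (hA : Subgroup.closure A = ⊤) (x y z : M) :
    wordNorm A (x⁻¹ * z) ≤ wordNorm A (x⁻¹ * y) + wordNorm A (y⁻¹ * z) := by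
  have h := wordNorm_mul_le hA (x⁻¹ * y) (y⁻¹ * z)
  rwa [mul_assoc, mul_inv_cancel_left] at h

theorem wordNorm_symm (A : Set M) (x y : M) : wordNorm A (x⁻¹ * y) = wordNorm A (y⁻¹ * x) := by
  rw [← wordNorm_inv, mul_inv_rev, inv_inv]

/-- A word in the generators and their inverses which realizes the word norm. -/
theorem exists_geodesic_word {A : Set M} (hA : Subgroup.closure A = ⊤) (y : M) :
    ∃ l : List M, (∀ a ∈ l, a ∈ A ∨ a⁻¹ ∈ A) ∧ l.prod = y ∧ l.length = wordNorm A y := by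
  have key : ∀ (x z : M) (p : (SimpleGraph.mulCayley A).Walk x z),
      ∃ l : List M, (∀ a ∈ l, a ∈ A ∨ a⁻¹ ∈ A) ∧ l.prod = x⁻¹ * z ∧ l.length = p.length := by
    intro x z p
    induction p with
    | nil => exact ⟨[], by simp⟩
    | @cons x' y' z' h p ih =>
      obtain ⟨l, h1, h2, h3⟩ := ih
      rw [SimpleGraph.mulCayley_adj] at h
      refine ⟨(x'⁻¹ * y') :: l, ?_, ?_, ?_⟩
      · intro a ha
        rcases List.mem_cons.1 ha with rfl | ha
        · simpa using h.2
        · exact h1 a ha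
      · simp [h2, mul_assoc]
      · simp [h3]
  obtain ⟨p, hp⟩ := (mulCayley_connected hA).exists_walk_length_eq_dist 1 y
  obtain ⟨l, h1, h2, h3⟩ := key 1 y p
  exact ⟨l, h1, by simpa using h2, by rw [h3, hp, wordNorm]⟩

theorem wordNorm_prod_le {A : Set M} (hA : Subgroup.closure A = ⊤) (l : List M)
    (hl : ∀ a ∈ l, a ∈ A ∨ a⁻¹ ∈ A) : wordNorm A l.prod ≤ l.length := by
  induction l with
  | nil => simp
  | cons a l ih =>
    have h1 := wordNorm_mul_le hA a l.prod
    have h2 := wordNorm_le_one (hl a (by simp))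
    have h3 := ih fun b hb => hl b (by simp [hb])
    simp only [List.prod_cons, List.length_cons]
    omega

/-- A map between groups which moves the two ends of every edge by at most `C` is
`C`-Lipschitz. -/
theorem wordNorm_lipschitz {N : Type*} [Group N] {A : Set M} {B : Set N}
    (hA : Subgroup.closure A = ⊤) (hB : Subgroup.closure B = ⊤) (F : M → N) (C : ℕ)
    (h : ∀ x : M, ∀ a ∈ A, wordNorm B ((F x)⁻¹ * F (x * a)) ≤ C) (x y : M) :
    wordNorm B ((F x)⁻¹ * F y) ≤ C * wordNorm A (x⁻¹ * y) := by
  obtain ⟨l, hl, hp, hn⟩ := exists_geodesic_word hA (x⁻¹ * y)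
  rw [← hn]
  obtain rfl : y = x * l.prod := by rw [hp]; group
  clear hp hn
  induction l generalizing x with
  | nil => simp
  | cons a l ih =>
    have h1 : wordNorm B ((F x)⁻¹ * F (x * a)) ≤ C := by
      rcases hl a (by simp) with ha | ha
      · exact h x a ha
      · have := h (x * a) a⁻¹ ha
        rw [← wordNorm_inv] at this
        simpa using this
    have h2 := ih (x * a) fun b hb => hl b (by simp [hb])
    have h3 := wordNorm_mul_le hB ((F x)⁻¹ * F (x * a)) ((F (x * a))⁻¹ * F (x * a * l.prod))
    rw [List.prod_cons, List.length_cons, ← mul_assoc x a]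
    rw [mul_assoc, mul_inv_cancel_left] at h3
    calc _ ≤ _ := h3
      _ ≤ C + C * l.length := add_le_add h1 h2
      _ = _ := by ring

end WordNorm

/-! ### Universal property and subgroups of graph products -/

namespace GraphProduct

variable {V : Type u} {Γ : SimpleGraph V} {G : V → Type v} [∀ a, Group (G a)]

theorem of_commute {a b : V} (h : Γ.Adj a b) (x : G a) (y : G b) :
    of Γ G a x * of Γ G b y = of Γ G b y * of Γ G a x := by
  have h1 : Monoid.CoprodI.of x * Monoid.CoprodI.of y * (Monoid.CoprodI.of x)⁻¹ *
      (Monoid.CoprodI.of y)⁻¹ ∈ Subgroup.normalClosure (graphProductRelators Γ G) :=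
    Subgroup.subset_normalClosure ⟨a, b, h, x, y, rfl⟩
  have h2 := (QuotientGroup.eq_one_iff _).2 h1
  have h3 : of Γ G a x * of Γ G b y * (of Γ G a x)⁻¹ * (of Γ G b y)⁻¹ = 1 := h2
  rw [mul_inv_eq_one, mul_inv_eq_iff_eq_mul] at h3
  exact h3

/-- The universal property of the graph product. -/
noncomputable def lift {N : Type*} [Group N] (φ : ∀ a, G a →* N)
    (hφ : ∀ a b, Γ.Adj a b → ∀ x y, φ a x * φ b y = φ b y * φ a x) : GraphProduct Γ G →* N :=
  QuotientGroup.lift _ (Monoid.CoprodI.lift φ) (by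
    intro x hx
    have : Subgroup.normalClosure (graphProductRelators Γ G) ≤ (Monoid.CoprodI.lift φ).ker := by
      refine Subgroup.normalClosure_le_normal ?_
      rintro _ ⟨a, b, hab, g, h, rfl⟩
      simp only [SetLike.mem_coe, MonoidHom.mem_ker, map_mul, map_inv, Monoid.CoprodI.lift_of]
      rw [hφ a b hab]; group
    exact this hx)

@[simp] theorem lift_of {N : Type*} [Group N] (φ : ∀ a, G a →* N)
    (hφ : ∀ a b, Γ.Adj a b → ∀ x y, φ a x * φ b y = φ b y * φ a x) (a : V) (x : G a) :
    lift (Γ := Γ) φ hφ (of Γ G a x) = φ a x :=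
  Monoid.CoprodI.lift_of φ x

variable (Γ G) in
/-- The subgroup generated by the vertex groups of the vertices with property `P`. -/
def genBy (P : V → Prop) : Subgroup (GraphProduct Γ G) :=
  Subgroup.closure {y | ∃ b, P b ∧ ∃ x : G b, y = of Γ G b x}

theorem of_mem_genBy {P : V → Prop} {b : V} (hb : P b) (x : G b) : of Γ G b x ∈ genBy Γ G P :=
  Subgroup.subset_closure ⟨b, hb, x, rfl⟩

theorem linkSubgroup_eq_genBy (a : V) : linkSubgroup Γ G a = genBy Γ G (Γ.Adj a) := by
  apply le_antisymm
  · refine iSup₂_le fun b hb => ?_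
    rintro _ ⟨x, rfl⟩
    exact of_mem_genBy hb x
  · refine (Subgroup.closure_le _).2 ?_
    rintro _ ⟨b, hb, x, rfl⟩
    exact (le_iSup₂ (f := fun b (_ : b ∈ Γ.neighborSet a) => (of Γ G b).range) b hb) ⟨x, rfl⟩

theorem genBy_induction {P : V → Prop} {p : GraphProduct Γ G → Prop} (one : p 1)
    (mul : ∀ y b (x : G b), P b → p y → p (y * of Γ G b x)) {y : GraphProduct Γ G}
    (hy : y ∈ genBy Γ G P) : p y := by
  induction hy using Subgroup.closure_induction_right with
  | one => exact one
  | mul_right x hx a ha ih =>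
    obtain ⟨b, hb, g, rfl⟩ := ha
    exact mul x b g hb ih
  | mul_inv_cancel x hx a ha ih =>
    obtain ⟨b, hb, g, rfl⟩ := ha
    rw [← map_inv]
    exact mul x b g⁻¹ hb ih

theorem genBy_true : genBy Γ G (fun _ => True) = ⊤ := by
  rw [eq_top_iff]
  rintro y -
  obtain ⟨x, rfl⟩ := QuotientGroup.mk'_surjective _ y
  induction x using Monoid.CoprodI.induction_on with
  | one => exact Subgroup.one_mem _
  | of i m => exact of_mem_genBy (Γ := Γ) trivial m
  | mul x y hx hy => rw [map_mul]; exact Subgroup.mul_mem _ hx hy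

theorem induction_right {p : GraphProduct Γ G → Prop} (one : p 1)
    (mul : ∀ y b (x : G b), p y → p (y * of Γ G b x)) (y : GraphProduct Γ G) : p y :=
  genBy_induction (P := fun _ => True) one (fun y b x _ h => mul y b x h)
    (by rw [genBy_true]; trivial)

open Classical in
variable (Γ G) in
/-- The retraction of the graph product onto `genBy Γ G P` which kills the other vertex groups. -/
noncomputable def retract (P : V → Prop) : GraphProduct Γ G →* GraphProduct Γ G :=
  lift (fun a => if P a then of Γ G a else 1) (by
    intro a b hab x y
    split_ifs <;> simp [of_commute hab])

open Classical in
theorem retract_of (P : V → Prop) (a : V) (x : G a) :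
    retract Γ G P (of Γ G a x) = if P a then of Γ G a x else 1 := by
  rw [retract, lift_of]; split_ifs <;> rfl

theorem retract_of_pos {P : V → Prop} {a : V} (h : P a) (x : G a) :
    retract Γ G P (of Γ G a x) = of Γ G a x := by rw [retract_of, if_pos h]

theorem retract_of_neg {P : V → Prop} {a : V} (h : ¬ P a) (x : G a) :
    retract Γ G P (of Γ G a x) = 1 := by rw [retract_of, if_neg h]

theorem retract_eq_self {P : V → Prop} {y : GraphProduct Γ G} (hy : y ∈ genBy Γ G P) :
    retract Γ G P y = y := by
  refine genBy_induction (p := fun y => retract Γ G P y = y) (map_one _) ?_ hy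
  intro y b x hb ih
  rw [map_mul, ih, retract_of_pos hb]

theorem retract_eq_one {P Q : V → Prop} (hPQ : ∀ a, Q a → ¬ P a) {y : GraphProduct Γ G}
    (hy : y ∈ genBy Γ G Q) : retract Γ G P y = 1 := by
  refine genBy_induction (p := fun y => retract Γ G P y = 1) (map_one _) ?_ hy
  intro y b x hb ih
  rw [map_mul, ih, retract_of_neg (hPQ b hb), mul_one]

theorem retract_mem (P : V → Prop) (y : GraphProduct Γ G) : retract Γ G P y ∈ genBy Γ G P := by
  refine induction_right (p := fun y => retract Γ G P y ∈ genBy Γ G P) ?_ ?_ y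
  · rw [map_one]; exact Subgroup.one_mem _
  · intro y b x ih
    rw [map_mul, retract_of]
    split_ifs with h
    · exact Subgroup.mul_mem _ ih (of_mem_genBy h x)
    · rwa [mul_one]

open Classical in
variable (Γ G) in
/-- The projection of the graph product onto a vertex group. -/
noncomputable def proj (a : V) : GraphProduct Γ G →* G a :=
  lift (fun b => if h : b = a then h ▸ MonoidHom.id _ else 1) (by
    intro b c hbc x y
    by_cases hb : b = a
    · have hc : c ≠ a := fun hc => hbc.ne (hb.trans hc.symm)
      simp [hc]
    · simp [hb])

@[simp] theorem proj_of_self (a : V) (x : G a) : proj Γ G a (of Γ G a x) = x := by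
  simp [proj]

theorem proj_of_ne {a b : V} (h : b ≠ a) (x : G b) : proj Γ G a (of Γ G b x) = 1 := by
  simp [proj, h]

theorem of_injective (a : V) : Function.Injective (of Γ G a) :=
  Function.LeftInverse.injective (proj_of_self (Γ := Γ) a)

theorem commute_of_mem_link {a : V} (x : G a) {y : GraphProduct Γ G}
    (hy : y ∈ genBy Γ G (Γ.Adj a)) : of Γ G a x * y = y * of Γ G a x := by
  refine genBy_induction (p := fun y => of Γ G a x * y = y * of Γ G a x) (by simp) ?_ hy
  intro y b z hb ih
  rw [← mul_assoc, ih, mul_assoc, of_commute hb, mul_assoc]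

/-! ### Right actions and cocycles -/

/-- Right actions of the vertex groups on a set such that adjacent vertex groups act by commuting
maps give a right action of the graph product. -/
theorem exists_action {Ω : Type*} (op : ∀ a, G a → Ω → Ω) (h1 : ∀ a ω, op a 1 ω = ω)
    (hmul : ∀ a x y ω, op a (x * y) ω = op a y (op a x ω))
    (hcomm : ∀ a b, Γ.Adj a b → ∀ x y ω, op a x (op b y ω) = op b y (op a x ω)) :
    ∃ F : GraphProduct Γ G → Ω → Ω, (∀ ω, F 1 ω = ω) ∧
      ∀ y a x ω, F (y * of Γ G a x) ω = op a x (F y ω) := by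
  let φ : ∀ a, G a →* Equiv.Perm Ω := fun a =>
    { toFun := fun x => ⟨op a x⁻¹, op a x, fun ω => by rw [← hmul, inv_mul_cancel, h1],
        fun ω => by rw [← hmul, mul_inv_cancel, h1]⟩
      map_one' := by ext ω; simp [h1]
      map_mul' := by intro x y; ext ω; simp [hmul] }
  have hφ : ∀ a b, Γ.Adj a b → ∀ x y, φ a x * φ b y = φ b y * φ a x := by
    intro a b hab x y; ext ω; exact hcomm a b hab _ _ _
  refine ⟨fun y ω => lift (Γ := Γ) φ hφ y⁻¹ ω, fun ω => by simp, fun y a x ω => ?_⟩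
  beta_reduce
  rw [mul_inv_rev, ← map_inv, map_mul, lift_of, Equiv.Perm.mul_apply]
  change op a x⁻¹⁻¹ _ = _
  rw [inv_inv]

/-- A cocycle on the vertex groups integrates to a map on the graph product. -/
theorem exists_of_cocycle {Z : Type*} [Group Z] (c : ∀ a, GraphProduct Γ G → G a → Z)
    (hmul : ∀ a y x x', c a y (x * x') = c a y x * c a (y * of Γ G a x) x')
    (hcomm : ∀ a b, Γ.Adj a b → ∀ y x x',
      c a y x * c b (y * of Γ G a x) x' = c b y x' * c a (y * of Γ G b x') x) :
    ∃ F : GraphProduct Γ G → Z, F 1 = 1 ∧ ∀ y a x, F (y * of Γ G a x) = F y * c a y x := by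
  have hone : ∀ a y, c a y 1 = 1 := by
    intro a y
    have := hmul a y 1 1
    simpa using this
  obtain ⟨F, hF1, hF⟩ := exists_action (Γ := Γ) (G := G) (Ω := GraphProduct Γ G × Z)
    (fun a x p => (p.1 * of Γ G a x, p.2 * c a p.1 x)) (by simp [hone])
    (by simp [hmul, mul_assoc]) (by
      intro a b hab x y ω
      simp only [Prod.mk.injEq]
      constructor
      · rw [mul_assoc, mul_assoc, of_commute hab]
      · rw [mul_assoc, mul_assoc, hcomm a b hab])
  have h1 : ∀ y, (F y (1, 1)).1 = y := by
    intro y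
    refine induction_right (p := fun y => (F y (1, 1)).1 = y) ?_ ?_ y
    · rw [hF1]
    · intro y b x ih; rw [hF]; simp [ih]
  refine ⟨fun y => (F y (1, 1)).2, by simp [hF1], fun y a x => ?_⟩
  simp [hF, h1]

end GraphProduct

namespace GraphProduct

variable {V : Type u} {Γ : SimpleGraph V} {G : V → Type v} [∀ a, Group (G a)]

/-! ### Star classes and coordinates -/

variable (Γ) in
/-- `b` belongs to the star of `a`. -/
def InStar (a b : V) : Prop := b = a ∨ Γ.Adj a b

variable (Γ G) in
/-- The left cosets of `⟨star(a)⟩`. -/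
abbrev StarClass (a : V) : Type (max u v) := GraphProduct Γ G ⧸ genBy Γ G (InStar Γ a)

/-- The coset `y⟨star(a)⟩`. -/
def cls (a : V) (y : GraphProduct Γ G) : StarClass Γ G a := QuotientGroup.mk y

theorem cls_eq_iff {a : V} {x y : GraphProduct Γ G} :
    cls a x = cls a y ↔ x⁻¹ * y ∈ genBy Γ G (InStar Γ a) := QuotientGroup.eq

theorem cls_mul_of_mem {a : V} (x : GraphProduct Γ G) {y : GraphProduct Γ G}
    (hy : y ∈ genBy Γ G (InStar Γ a)) : cls a (x * y) = cls a x := by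
  rw [eq_comm, cls_eq_iff]; simpa using hy

theorem cls_mul_of {a b : V} (h : InStar Γ a b) (y : GraphProduct Γ G) (x : G b) :
    cls a (y * of Γ G b x) = cls a y := cls_mul_of_mem y (of_mem_genBy h x)

theorem cls_mul_of_self {a : V} (y : GraphProduct Γ G) (x : G a) :
    cls a (y * of Γ G a x) = cls a y := cls_mul_of (Or.inl rfl) y x

theorem genBy_mono {P Q : V → Prop} (h : ∀ a, P a → Q a) : genBy Γ G P ≤ genBy Γ G Q := by
  refine Subgroup.closure_mono ?_
  rintro _ ⟨b, hb, x, rfl⟩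
  exact ⟨b, h b hb, x, rfl⟩

theorem cls_mul_link {a : V} (x : GraphProduct Γ G) {y : GraphProduct Γ G}
    (hy : y ∈ genBy Γ G (Γ.Adj a)) : cls a (x * y) = cls a x :=
  cls_mul_of_mem x (genBy_mono (fun _ h => Or.inr h) hy)

open Classical in
theorem exists_coord : ∃ F : GraphProduct Γ G → ∀ i : (Σ a, StarClass Γ G a), G i.1,
    F 1 = 1 ∧ ∀ y a x, F (y * of Γ G a x) =
      F y * Pi.mulSingle (M := fun i : (Σ a, StarClass Γ G a) => G i.1) ⟨a, cls a y⟩ x := by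
  refine exists_of_cocycle
    (fun a y x => Pi.mulSingle (M := fun i : (Σ a, StarClass Γ G a) => G i.1) ⟨a, cls a y⟩ x) ?_ ?_
  · intro a y x x'
    rw [cls_mul_of_self, ← Pi.mulSingle_mul]
  · intro a b hab y x x'
    rw [cls_mul_of (Or.inr hab.symm), cls_mul_of (Or.inr hab)]
    have hne : (⟨a, cls a y⟩ : Σ a, StarClass Γ G a) ≠ ⟨b, cls b y⟩ :=
      fun h => hab.ne (congrArg Sigma.fst h)
    exact Pi.mulSingle_commute (f := fun i : (Σ a, StarClass Γ G a) => G i.1) hne x x'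

/-- The coordinate of `y` at the star class `H` of `a`. It is trivial for `y = 1`, and right
multiplication of `y` by an element of a vertex group `G b` changes only the coordinate at the class
`y⟨star(b)⟩`, which gets multiplied by this element. -/
noncomputable def coord (y : GraphProduct Γ G) (a : V) (H : StarClass Γ G a) : G a :=
  Classical.choose (exists_coord (Γ := Γ) (G := G)) y ⟨a, H⟩

@[simp] theorem coord_one (a : V) (H : StarClass Γ G a) : coord (1 : GraphProduct Γ G) a H = 1 := by
  rw [coord, (Classical.choose_spec (exists_coord (Γ := Γ) (G := G))).1]; rfl

theorem coord_mul_of_self (y : GraphProduct Γ G) (a : V) (x : G a) :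
    coord (y * of Γ G a x) a (cls a y) = coord y a (cls a y) * x := by
  rw [coord, (Classical.choose_spec (exists_coord (Γ := Γ) (G := G))).2]
  simp [coord]

theorem coord_mul_of_ne_cls (y : GraphProduct Γ G) {a : V} (x : G a) {H : StarClass Γ G a}
    (h : cls a y ≠ H) : coord (y * of Γ G a x) a H = coord y a H := by
  classical
  rw [coord, (Classical.choose_spec (exists_coord (Γ := Γ) (G := G))).2, Pi.mul_apply,
    Pi.mulSingle_eq_of_ne, mul_one, coord]
  intro h'
  simp only [Sigma.mk.injEq, heq_eq_eq, true_and] at h'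
  exact h h'.symm

theorem coord_mul_of_ne (y : GraphProduct Γ G) {a b : V} (hab : b ≠ a) (x : G b)
    (H : StarClass Γ G a) : coord (y * of Γ G b x) a H = coord y a H := by
  classical
  rw [coord, (Classical.choose_spec (exists_coord (Γ := Γ) (G := G))).2, Pi.mul_apply,
    Pi.mulSingle_eq_of_ne, mul_one, coord]
  intro h'
  exact hab (congrArg Sigma.fst h').symm

theorem coord_mul_of_mem (y : GraphProduct Γ G) {a : V} {P : V → Prop} (hP : ¬ P a)
    {z : GraphProduct Γ G} (hz : z ∈ genBy Γ G P) (H : StarClass Γ G a) :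
    coord (y * z) a H = coord y a H := by
  refine genBy_induction (p := fun z => coord (y * z) a H = coord y a H) (by simp) ?_ hz
  intro z b x hb ih
  rw [← mul_assoc, coord_mul_of_ne _ (by rintro rfl; exact hP hb), ih]

/-- The coordinate of `y` at its own star class of `a`. -/
noncomputable def tail (a : V) (y : GraphProduct Γ G) : G a := coord y a (cls a y)

theorem tail_mul_of_self (a : V) (y : GraphProduct Γ G) (x : G a) :
    tail a (y * of Γ G a x) = tail a y * x := by
  rw [tail, cls_mul_of_self, coord_mul_of_self, tail]

theorem tail_mul_link {a : V} (y : GraphProduct Γ G) {z : GraphProduct Γ G}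
    (hz : z ∈ genBy Γ G (Γ.Adj a)) : tail a (y * z) = tail a y := by
  rw [tail, cls_mul_link y hz, coord_mul_of_mem y (fun h => h.ne rfl) hz, tail]

theorem tail_mul_of_adj {a b : V} (h : Γ.Adj a b) (y : GraphProduct Γ G) (x : G b) :
    tail a (y * of Γ G b x) = tail a y := tail_mul_link y (of_mem_genBy h x)

theorem star_decomp {a : V} {z : GraphProduct Γ G} (hz : z ∈ genBy Γ G (InStar Γ a)) :
    ∃ (g : G a) (l : GraphProduct Γ G), l ∈ genBy Γ G (Γ.Adj a) ∧ z = of Γ G a g * l := by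
  refine genBy_induction (p := fun z => ∃ (g : G a) (l : GraphProduct Γ G),
    l ∈ genBy Γ G (Γ.Adj a) ∧ z = of Γ G a g * l) ⟨1, 1, Subgroup.one_mem _, by simp⟩ ?_ hz
  rintro _ b x hb ⟨g, l, hl, rfl⟩
  rcases hb with rfl | hb
  · exact ⟨g * x, l, hl, by rw [mul_assoc, ← commute_of_mem_link x hl, map_mul, mul_assoc]⟩
  · exact ⟨g, l * of Γ G b x, Subgroup.mul_mem _ hl (of_mem_genBy hb x), by rw [mul_assoc]⟩

theorem tail_mul_star {a : V} (y : GraphProduct Γ G) (g : G a) {l : GraphProduct Γ G}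
    (hl : l ∈ genBy Γ G (Γ.Adj a)) : tail a (y * (of Γ G a g * l)) = tail a y * g := by
  rw [← mul_assoc, tail_mul_link _ hl, tail_mul_of_self]

/-- Two elements in the same star class of `a` differ by the difference of their tails and an
element of `⟨link(a)⟩`. -/
theorem exists_link_of_cls_eq {a : V} {x y : GraphProduct Γ G} (h : cls a x = cls a y) :
    ∃ l ∈ genBy Γ G (Γ.Adj a), x⁻¹ * y = of Γ G a ((tail a x)⁻¹ * tail a y) * l := by
  obtain ⟨g, l, hl, e⟩ := star_decomp (cls_eq_iff.1 h)
  refine ⟨l, hl, ?_⟩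
  have : y = x * (of Γ G a g * l) := by rw [← e]; group
  rw [this, tail_mul_star x g hl]; simp

theorem of_eq_one_of_mem {P : V → Prop} {b : V} (hb : ¬ P b) {x : G b}
    (h : of Γ G b x ∈ genBy Γ G P) : x = 1 := by
  apply of_injective (Γ := Γ) b
  rw [← retract_eq_self h, retract_of_neg hb, map_one]

/-! ### Minimal syllable words and exclusion of tails -/

variable (Γ) in
/-- The element represented by a word of syllables. -/
def wprod (l : List (Σ a, G a)) : GraphProduct Γ G := (l.map fun p => of Γ G p.1 p.2).prod

@[simp] theorem wprod_nil : wprod Γ ([] : List (Σ a, G a)) = 1 := rfl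

theorem wprod_append (l l' : List (Σ a, G a)) : wprod Γ (l ++ l') = wprod Γ l * wprod Γ l' := by
  simp [wprod]

theorem wprod_cons (p : Σ a, G a) (l : List (Σ a, G a)) :
    wprod Γ (p :: l) = of Γ G p.1 p.2 * wprod Γ l := by simp [wprod]

theorem exists_wprod (y : GraphProduct Γ G) : ∃ l, wprod Γ l = y := by
  refine induction_right (p := fun y => ∃ l, wprod Γ l = y) ⟨[], rfl⟩ ?_ y
  rintro _ b x ⟨l, rfl⟩
  exact ⟨l ++ [⟨b, x⟩], by simp [wprod_append, wprod_cons]⟩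

open Classical in
theorem wprod_filter (P : V → Prop) (l : List (Σ a, G a)) :
    wprod Γ (l.filter fun p => P p.1) = retract Γ G P (wprod Γ l) := by
  induction l with
  | nil => simp
  | cons p l ih =>
    by_cases h : P p.1
    · simp [h, wprod_cons, ih, retract_of_pos]
    · simp [h, wprod_cons, ih, retract_of_neg]

theorem exists_crossing {a : V} {H : StarClass Γ G a} (l : List (Σ a, G a))
    (h : coord (wprod Γ l) a H ≠ 1) :
    ∃ l₁ x l₂, l = l₁ ++ ⟨a, x⟩ :: l₂ ∧ cls a (wprod Γ l₁) = H := by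
  induction l using List.reverseRecOn with
  | nil => simp at h
  | append_singleton l p ih =>
    by_cases hp : ∃ e : p.1 = a, cls a (wprod Γ l) = H
    · obtain ⟨rfl, e⟩ := hp
      exact ⟨l, p.2, [], rfl, e⟩
    · have : coord (wprod Γ l) a H ≠ 1 := by
        intro h'
        apply h
        rw [← h', wprod_append, wprod_cons, wprod_nil, mul_one]
        by_cases hpa : p.1 = a
        · obtain ⟨b, x⟩ := p
          obtain rfl : b = a := hpa
          exact coord_mul_of_ne_cls _ _ fun e => hp ⟨rfl, e⟩
        · exact coord_mul_of_ne _ hpa _ _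
      obtain ⟨l₁, x, l₂, rfl, e⟩ := ih this
      exact ⟨l₁, x, l₂ ++ [p], by simp, e⟩

/-- In a shortest syllable word, everything after a crossing of the final star class of `a` lies in
the star of `a`: the other syllables could be deleted. -/
theorem exists_crossing_of_minimal {a : V} {l : List (Σ a, G a)}
    (hmin : ∀ l', wprod Γ l' = wprod Γ l → l.length ≤ l'.length)
    (h : tail a (wprod Γ l) ≠ 1) :
    ∃ l₁ x l₂, l = l₁ ++ ⟨a, x⟩ :: l₂ ∧ ∀ p ∈ l₂, InStar Γ a p.1 := by
  classical
  obtain ⟨l₁, x, l₂, rfl, e⟩ := exists_crossing l h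
  refine ⟨l₁, x, l₂, rfl, ?_⟩
  have hmem : wprod Γ l₂ ∈ genBy Γ G (InStar Γ a) := by
    have hx : of Γ G a x ∈ genBy Γ G (InStar Γ a) := of_mem_genBy (P := InStar Γ a) (Or.inl rfl) x
    have e' : of Γ G a x * wprod Γ l₂ ∈ genBy Γ G (InStar Γ a) := by
      rw [cls_eq_iff, wprod_append, wprod_cons, inv_mul_cancel_left] at e
      exact e
    exact (Subgroup.mul_mem_cancel_left _ hx).1 e'
  have h1 := hmin (l₁ ++ ⟨a, x⟩ :: l₂.filter fun p => InStar Γ a p.1) (by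
    rw [wprod_append, wprod_cons, wprod_filter, retract_eq_self hmem, wprod_append, wprod_cons])
  simp only [List.length_append, List.length_cons] at h1
  have h2 : (l₂.filter fun p => InStar Γ a p.1).length = l₂.length :=
    le_antisymm (List.length_filter_le _ _) (by omega)
  intro p hp
  have := List.length_filter_eq_length_iff.1 h2 p hp
  simpa using this

/-- An element of a graph product cannot end both with a syllable of `a` and with a syllable of `b`
if `a` and `b` are distinct and not adjacent. -/
theorem tail_eq_one_or {a b : V} (hab : ¬ InStar Γ a b) (y : GraphProduct Γ G) :
    tail a y = 1 ∨ tail b y = 1 := by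
  by_contra! hne
  have hex : ∃ n, ∃ l, wprod Γ l = y ∧ l.length = n := by
    obtain ⟨l, hl⟩ := exists_wprod y
    exact ⟨_, l, hl, rfl⟩
  classical
  obtain ⟨l, rfl, hn⟩ := Nat.find_spec hex
  have hmin : ∀ l', wprod Γ l' = wprod Γ l → l.length ≤ l'.length := by
    intro l' h'
    rw [hn]
    exact Nat.find_min' hex ⟨l', h', rfl⟩
  have hba : ¬ InStar Γ b a := fun h => hab (h.elim (fun e => Or.inl e.symm) fun e => Or.inr e.symm)
  obtain ⟨l₁, x, l₂, e₁, h₁⟩ := exists_crossing_of_minimal hmin hne.1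
  obtain ⟨m₁, z, m₂, e₂, h₂⟩ := exists_crossing_of_minimal hmin hne.2
  rw [e₁, List.append_eq_append_iff] at e₂
  rcases e₂ with ⟨k, hk, hk'⟩ | ⟨k, hk, hk'⟩
  · cases k with
    | nil =>
      simp only [List.nil_append, List.cons.injEq] at hk'
      exact hab (Or.inl (congrArg Sigma.fst hk'.1).symm)
    | cons p k =>
      simp only [List.cons_append, List.cons.injEq] at hk'
      exact hab (h₁ ⟨b, z⟩ (by rw [hk'.2]; simp))
  · cases k with
    | nil =>
      simp only [List.nil_append, List.cons.injEq] at hk'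
      exact hab (Or.inl (congrArg Sigma.fst hk'.1))
    | cons p k =>
      simp only [List.cons_append, List.cons.injEq] at hk'
      exact hba (h₂ ⟨a, x⟩ (by rw [hk'.2]; simp))

/-! ### The word norm of a graph product -/

variable (Γ) in
/-- The union of the generating sets of the vertex groups. -/
def gens (S : ∀ a, Set (G a)) : Set (GraphProduct Γ G) := ⋃ a, of Γ G a '' S a

theorem cayleyGraph_eq (S : ∀ a, Set (G a)) :
    cayleyGraph Γ G S = SimpleGraph.mulCayley (gens Γ S) := rfl

theorem of_mem_gens {S : ∀ a, Set (G a)} {a : V} {s : G a} (hs : s ∈ S a) :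
    of Γ G a s ∈ gens Γ S := Set.mem_iUnion.2 ⟨a, s, hs, rfl⟩

theorem closure_gens {S : ∀ a, Set (G a)} (hS : ∀ a, Subgroup.closure (S a) = ⊤) :
    Subgroup.closure (gens Γ S) = ⊤ := by
  rw [eq_top_iff, ← genBy_true]
  refine (Subgroup.closure_le _).2 ?_
  rintro _ ⟨b, -, x, rfl⟩
  have h1 : (⊤ : Subgroup (G b)).map (of Γ G b) ≤ Subgroup.closure (gens Γ S) := by
    rw [← hS b, MonoidHom.map_closure]
    refine Subgroup.closure_mono ?_
    rintro _ ⟨s, hs, rfl⟩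
    exact of_mem_gens hs
  exact h1 ⟨x, trivial, rfl⟩

/-- A letter is a generator of some vertex group or the inverse of one. -/
theorem exists_of_letter {S : ∀ a, Set (G a)} {z : GraphProduct Γ G}
    (hz : z ∈ gens Γ S ∨ z⁻¹ ∈ gens Γ S) :
    ∃ (a : V) (s : G a), (s ∈ S a ∨ s⁻¹ ∈ S a) ∧ z = of Γ G a s := by
  rcases hz with hz | hz
  · obtain ⟨a, s, hs, rfl⟩ := Set.mem_iUnion.1 hz
    exact ⟨a, s, Or.inl hs, rfl⟩
  · obtain ⟨a, s, hs, e⟩ := Set.mem_iUnion.1 hz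
    exact ⟨a, s⁻¹, Or.inr (by simpa using hs), by rw [map_inv, e, inv_inv]⟩

theorem letter_of {S : ∀ a, Set (G a)} {a : V} {s : G a} (hs : s ∈ S a ∨ s⁻¹ ∈ S a) :
    of Γ G a s ∈ gens Γ S ∨ (of Γ G a s)⁻¹ ∈ gens Γ S := by
  rcases hs with hs | hs
  · exact Or.inl (of_mem_gens hs)
  · exact Or.inr (by rw [← map_inv]; exact of_mem_gens hs)

theorem norm_retract_add_le {S : ∀ a, Set (G a)} (hS : ∀ a, Subgroup.closure (S a) = ⊤)
    {P Q : V → Prop} (hPQ : ∀ a, P a → ¬ Q a) (y : GraphProduct Γ G) :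
    wordNorm (gens Γ S) (retract Γ G P y) + wordNorm (gens Γ S) (retract Γ G Q y) ≤
      wordNorm (gens Γ S) y := by
  obtain ⟨l, hl, rfl, hn⟩ := exists_geodesic_word (closure_gens (Γ := Γ) hS) y
  rw [← hn]
  clear hn
  induction l with
  | nil => simp
  | cons z l ih =>
    have h1 := ih fun b hb => hl b (by simp [hb])
    obtain ⟨a, s, hs, rfl⟩ := exists_of_letter (hl z (by simp))
    have hz := wordNorm_le_one (letter_of (Γ := Γ) hs)
    have hP := wordNorm_mul_le (closure_gens (Γ := Γ) hS) (retract Γ G P (of Γ G a s))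
      (retract Γ G P l.prod)
    have hQ := wordNorm_mul_le (closure_gens (Γ := Γ) hS) (retract Γ G Q (of Γ G a s))
      (retract Γ G Q l.prod)
    simp only [List.prod_cons, List.length_cons, map_mul]
    by_cases ha : P a
    · rw [retract_of_pos ha] at hP ⊢
      rw [retract_of_neg (hPQ a ha), wordNorm_one] at hQ
      rw [retract_of_neg (hPQ a ha)]
      omega
    · rw [retract_of_neg ha, wordNorm_one] at hP
      rw [retract_of_neg ha]
      have : wordNorm (gens Γ S) (retract Γ G Q (of Γ G a s)) ≤ 1 := by
        rw [retract_of]; split_ifs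
        · exact hz
        · simp
      omega

theorem norm_retract_le {S : ∀ a, Set (G a)} (hS : ∀ a, Subgroup.closure (S a) = ⊤)
    (P : V → Prop) (y : GraphProduct Γ G) :
    wordNorm (gens Γ S) (retract Γ G P y) ≤ wordNorm (gens Γ S) y :=
  le_of_add_le_left (norm_retract_add_le hS (P := P) (Q := fun a => ¬ P a) (by simp) y)

/-- `G a × ⟨link(a)⟩` carries the `ℓ¹`-metric. -/
theorem norm_of_mul_link {S : ∀ a, Set (G a)} (hS : ∀ a, Subgroup.closure (S a) = ⊤) {a : V}
    (g : G a) {l : GraphProduct Γ G} (hl : l ∈ genBy Γ G (Γ.Adj a)) :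
    wordNorm (gens Γ S) (of Γ G a g * l) =
      wordNorm (gens Γ S) (of Γ G a g) + wordNorm (gens Γ S) l := by
  refine le_antisymm (wordNorm_mul_le (closure_gens hS) _ _) ?_
  have h := norm_retract_add_le hS (P := fun b => b = a) (Q := Γ.Adj a)
    (by rintro b rfl; exact fun h => h.ne rfl) (of Γ G a g * l)
  have h1 : retract Γ G (fun b => b = a) l = 1 :=
    retract_eq_one (Q := Γ.Adj a) (fun b hb e => hb.ne e.symm) hl
  have h2 : retract Γ G (Γ.Adj a) (of Γ G a g) = 1 := retract_of_neg (fun h => h.ne rfl) g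
  have h3 : retract Γ G (fun b => b = a) (of Γ G a g) = of Γ G a g :=
    retract_of_pos (P := fun b => b = a) rfl g
  rwa [map_mul, map_mul, h1, h2, retract_eq_self hl, h3, mul_one, one_mul] at h

end GraphProduct

namespace GraphProduct

variable {V : Type u} {Γ : SimpleGraph V} {G : V → Type v} [∀ a, Group (G a)]
  {S : ∀ a, Set (G a)}

/-! ### Morse geodesics and products -/

/-- An element of `genBy Γ G P` is joined to `1` by a geodesic inside `genBy Γ G P`. -/
theorem exists_geodesic_in (hS : ∀ a, Subgroup.closure (S a) = ⊤) {P : V → Prop}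
    {x : GraphProduct Γ G} (hx : x ∈ genBy Γ G P) :
    ∃ c : ℕ → GraphProduct Γ G, c 0 = 1 ∧ c (wordNorm (gens Γ S) x) = x ∧
      (∀ i, c i ∈ genBy Γ G P) ∧ ∀ i j, i ≤ j → j ≤ wordNorm (gens Γ S) x →
        wordNorm (gens Γ S) ((c i)⁻¹ * c j) = j - i := by
  have hA := closure_gens (Γ := Γ) hS
  obtain ⟨l, hl, hp, hn⟩ := exists_geodesic_word hA x
  have h1 : ∀ i j, i ≤ j → j ≤ l.length →
      wordNorm (gens Γ S) ((l.take i).prod⁻¹ * (l.take j).prod) ≤ j - i := by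
    intro i j hij hj
    have e : l.take j = l.take i ++ (l.drop i).take (j - i) := by
      rw [← List.take_add]; congr 1; omega
    rw [e, List.prod_append, inv_mul_cancel_left]
    refine (wordNorm_prod_le hA _ fun a ha => hl a ?_).trans (by simp)
    exact List.mem_of_mem_drop (List.mem_of_mem_take ha)
  have h2 : ∀ i j, i ≤ j → j ≤ l.length →
      wordNorm (gens Γ S) ((retract Γ G P (l.take i).prod)⁻¹ * retract Γ G P (l.take j).prod)
        ≤ j - i := by
    intro i j hij hj
    rw [← map_inv, ← map_mul]
    exact (norm_retract_le hS P _).trans (h1 i j hij hj)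
  refine ⟨fun i => retract Γ G P (l.take i).prod, by simp, ?_, fun i => retract_mem P _, ?_⟩
  · rw [← hn]
    beta_reduce
    rw [List.take_length, hp, retract_eq_self hx]
  · intro i j hij hj
    rw [← hn] at hj
    beta_reduce
    refine le_antisymm (h2 i j hij hj) ?_
    have a1 := h2 0 i (by omega) (by omega)
    have a2 := h2 j l.length hj le_rfl
    have e0 : retract Γ G P (l.take 0).prod = 1 := by simp
    have e1 : retract Γ G P (l.take l.length).prod = x := by
      rw [List.take_length, hp, retract_eq_self hx]
    rw [e0, inv_one, one_mul] at a1
    rw [e1] at a2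
    have a3 := wordNorm_mul_le hA (retract Γ G P (l.take i).prod)
      ((retract Γ G P (l.take i).prod)⁻¹ * retract Γ G P (l.take j).prod)
    have a4 := wordNorm_mul_le hA (retract Γ G P (l.take j).prod)
      ((retract Γ G P (l.take j).prod)⁻¹ * x)
    rw [mul_inv_cancel_left] at a3 a4
    omega

theorem mem_genBy_singleton {a : V} {x : GraphProduct Γ G} (hx : x ∈ genBy Γ G (fun b => b = a)) :
    ∃ g, x = of Γ G a g := by
  refine genBy_induction (p := fun x => ∃ g, x = of Γ G a g) ⟨1, by simp⟩ ?_ hx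
  rintro _ b z rfl ⟨g, rfl⟩
  exact ⟨g * z, by simp⟩

/-- Distances in the product `G a × ⟨link(a)⟩`. -/
theorem norm_product (hS : ∀ a, Subgroup.closure (S a) = ⊤) {a : V}
    {x x' y y' : GraphProduct Γ G} (hx : x ∈ genBy Γ G (fun b => b = a))
    (hx' : x' ∈ genBy Γ G (fun b => b = a)) (hy : y ∈ genBy Γ G (Γ.Adj a))
    (hy' : y' ∈ genBy Γ G (Γ.Adj a)) :
    wordNorm (gens Γ S) ((x * y)⁻¹ * (x' * y')) =
      wordNorm (gens Γ S) (x⁻¹ * x') + wordNorm (gens Γ S) (y⁻¹ * y') := by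
  obtain ⟨g, hg⟩ := mem_genBy_singleton (Subgroup.mul_mem _ (Subgroup.inv_mem _ hx) hx')
  have e : (x * y)⁻¹ * (x' * y') = (x⁻¹ * x') * (y⁻¹ * y') := by
    have h1 := commute_of_mem_link g (Subgroup.inv_mem _ hy)
    rw [← hg] at h1
    calc (x * y)⁻¹ * (x' * y') = (y⁻¹ * (x⁻¹ * x')) * y' := by group
      _ = _ := by rw [← h1]; group
  rw [e, hg, norm_of_mul_link hS g (Subgroup.mul_mem _ (Subgroup.inv_mem _ hy) hy')]

/-- The path `z`, then `g`, then `z⁻¹ * l` in the product `G a × ⟨link(a)⟩` joins two points of the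
Morse set `Y`. If it is a quasigeodesic, its two corners are close to `Y`. -/
theorem exists_near_corners (hS : ∀ a, Subgroup.closure (S a) = ⊤)
    {M : ℝ≥0 → ℝ≥0 → ℝ≥0} {Y : Set (GraphProduct Γ G)}
    (hM : (cayleyGraph Γ G S).IsMorse M Y) {a : V} (g : G a) {y l z : GraphProduct Γ G}
    (hl : l ∈ genBy Γ G (Γ.Adj a)) (hz : z ∈ genBy Γ G (Γ.Adj a)) (hy : y ∈ Y)
    (hy' : y * (of Γ G a g * l) ∈ Y) (A : ℕ) (hA1 : 1 ≤ A)
    (hA : wordNorm (gens Γ S) z = 0 ∨ wordNorm (gens Γ S) (z⁻¹ * l) = 0 ∨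
      wordNorm (gens Γ S) z + wordNorm (gens Γ S) (of Γ G a g) + wordNorm (gens Γ S) (z⁻¹ * l) ≤
        A * wordNorm (gens Γ S) (of Γ G a g)) :
    (∃ x ∈ Y, wordNorm (gens Γ S) ((y * z)⁻¹ * x) ≤ ⌈M A 0⌉₊) ∧
    ∃ x ∈ Y, wordNorm (gens Γ S) ((y * (of Γ G a g * z))⁻¹ * x) ≤ ⌈M A 0⌉₊ := by
  have hcl := closure_gens (Γ := Γ) hS
  obtain ⟨p, p0, p1, pm, pd⟩ := exists_geodesic_in hS hz
  obtain ⟨r, r0, r1, rm, rd⟩ := exists_geodesic_in hS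
    (of_mem_genBy (Γ := Γ) (P := fun b => b = a) rfl g)
  obtain ⟨w, w0, w1, wm, wd⟩ := exists_geodesic_in hS
    (Subgroup.mul_mem _ (Subgroup.inv_mem _ hz) hl)
  set R := wordNorm (gens Γ S) z
  set L := wordNorm (gens Γ S) (of Γ G a g)
  set R' := wordNorm (gens Γ S) (z⁻¹ * l)
  let c : ℕ → GraphProduct Γ G := fun i =>
    y * (r (min (i - R) L) * (p (min i R) * w (i - R - L)))
  have hdist : ∀ i j, wordNorm (gens Γ S) ((c i)⁻¹ * c j) =
      wordNorm (gens Γ S) ((r (min (i - R) L))⁻¹ * r (min (j - R) L)) +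
      wordNorm (gens Γ S) ((p (min i R) * w (i - R - L))⁻¹ * (p (min j R) * w (j - R - L))) := by
    intro i j
    rw [← norm_product hS (rm _) (rm _) (Subgroup.mul_mem _ (pm _) (wm _))
      (Subgroup.mul_mem _ (pm _) (wm _))]
    congr 1
    simp only [c]; group
  have hle : ∀ i j, i ≤ j → j ≤ R + L + R' →
      wordNorm (gens Γ S) ((c i)⁻¹ * c j) ≤ j - i ∧
        j - i ≤ A * wordNorm (gens Γ S) ((c i)⁻¹ * c j) := by
    intro i j hij hj
    have hr := rd (min (i - R) L) (min (j - R) L) (by omega) (by omega)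
    have hp := pd (min i R) (min j R) (by omega) (by omega)
    have hw := wd (i - R - L) (j - R - L) (by omega) (by omega)
    rw [hdist, hr]
    by_cases hi : R ≤ i
    · have e : min i R = min j R := by omega
      have e' : (p (min i R) * w (i - R - L))⁻¹ * (p (min j R) * w (j - R - L)) =
          (w (i - R - L))⁻¹ * w (j - R - L) := by rw [e]; group
      rw [e', hw]
      have : min (j - R) L - min (i - R) L + (j - R - L - (i - R - L)) = j - i := by omega
      rw [this]
      exact ⟨le_rfl, Nat.le_mul_of_pos_left _ hA1⟩
    · have e : i - R - L = 0 := by omega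
      by_cases hj' : j ≤ R + L
      · have e1 : j - R - L = 0 := by omega
        rw [e, e1, w0, mul_one, mul_one, hp]
        have : min (j - R) L - min (i - R) L + (min j R - min i R) = j - i := by omega
        rw [this]
        exact ⟨le_rfl, Nat.le_mul_of_pos_left _ hA1⟩
      · rw [e, w0, mul_one, ← mul_assoc]
        have hw' := wd 0 (j - R - L) (by omega) (by omega)
        rw [w0, inv_one, one_mul] at hw'
        have h1 := wordNorm_mul_le hcl ((p (min i R))⁻¹ * p (min j R)) (w (j - R - L))
        have e1 : min (j - R) L - min (i - R) L = L := by omega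
        refine ⟨by omega, ?_⟩
        rw [e1, Nat.mul_add]
        have h2 : R + L + R' ≤ A * L := by
          rcases hA with h | h | h
          · omega
          · omega
          · exact h
        omega
  have hq : (cayleyGraph Γ G S).IsQuasigeodesic (A : ℝ≥0) (0 : ℝ≥0) (R + L + R') c := by
    have hApos : (0 : ℝ) < A := by exact_mod_cast hA1
    have key : ∀ i j, i ≤ j → j ≤ R + L + R' →
        (1 / (A : ℝ)) * ((j : ℝ) - i) - 0 ≤ (wordNorm (gens Γ S) ((c i)⁻¹ * c j) : ℝ) ∧
        (wordNorm (gens Γ S) ((c i)⁻¹ * c j) : ℝ) ≤ A * ((j : ℝ) - i) + 0 := by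
      intro i j hij hj
      obtain ⟨h1, h2⟩ := hle i j hij hj
      have h1' : (wordNorm (gens Γ S) ((c i)⁻¹ * c j) : ℝ) ≤ (j : ℝ) - i := by
        rw [← Nat.cast_sub hij]; exact_mod_cast h1
      have h2' : (j : ℝ) - i ≤ A * (wordNorm (gens Γ S) ((c i)⁻¹ * c j) : ℝ) := by
        rw [← Nat.cast_sub hij]; exact_mod_cast h2
      constructor
      · rw [sub_zero, one_div, inv_mul_le_iff₀ hApos]; exact h2'
      · have h3 : (1 : ℝ) ≤ A := by exact_mod_cast hA1
        have h4 : (0 : ℝ) ≤ (j : ℝ) - i := by rw [← Nat.cast_sub hij]; positivity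
        nlinarith
    intro i j hi hj
    rw [cayleyGraph_eq, dist_eq_wordNorm]
    rcases le_total i j with h | h
    · have := key i j h hj
      rw [abs_sub_comm, abs_of_nonneg (by rw [← Nat.cast_sub h]; positivity)]
      simpa using this
    · have := key j i h hi
      rw [abs_of_nonneg (by rw [← Nat.cast_sub h]; positivity), ← wordNorm_inv, mul_inv_rev, inv_inv]
      simpa using this
  have hM' := hM A 0 (by exact_mod_cast hA1) (R + L + R') c hq (by simpa [c, p0, r0, w0] using hy)
    (by
      have e1 : min (R + L + R' - R) L = L := by omega
      have e2 : min (R + L + R') R = R := by omega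
      have e3 : R + L + R' - R - L = R' := by omega
      simp only [c, e1, e2, e3, p1, r1, w1, mul_inv_cancel_left]
      exact hy')
  constructor
  · obtain ⟨x, hx, hd⟩ := hM' R (by omega)
    refine ⟨x, hx, ?_⟩
    have e : c R = y * z := by simp [c, p1, r0, w0]
    rw [cayleyGraph_eq, dist_eq_wordNorm, e] at hd
    exact_mod_cast hd.trans (Nat.le_ceil _)
  · obtain ⟨x, hx, hd⟩ := hM' (R + L) (by omega)
    refine ⟨x, hx, ?_⟩
    have e : c (R + L) = y * (of Γ G a g * z) := by simp [c, p1, r1, w0]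
    rw [cayleyGraph_eq, dist_eq_wordNorm, e] at hd
    exact_mod_cast hd.trans (Nat.le_ceil _)

/-- The bound on the `G a`-directions of a Morse geodesic. The pairs `(1, 0)` and `(4, 0)` are the
constants of the quasigeodesics to which the Morse property is applied; the remaining constants are
not optimal. -/
noncomputable def morseBound (M : ℝ≥0 → ℝ≥0 → ℝ≥0) : ℕ :=
  20 * (⌈M (1 : ℕ) 0⌉₊ + ⌈M (4 : ℕ) 0⌉₊) + 20

/-- If a Morse geodesic moves far in the factor `G a` of a product `G a × ⟨link(a)⟩`, then the other
factor is bounded: otherwise the detour through a far copy of `G a` is a quasigeodesic which leaves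
the neighbourhood of the geodesic. -/
theorem link_bounded_of_morse (hS : ∀ a, Subgroup.closure (S a) = ⊤)
    {M : ℝ≥0 → ℝ≥0 → ℝ≥0} {γ : ℤ → GraphProduct Γ G}
    (hγ : ∀ i j : ℤ, (wordNorm (gens Γ S) ((γ i)⁻¹ * γ j) : ℤ) = |i - j|)
    (hM : (cayleyGraph Γ G S).IsMorse M (Set.range γ)) {a : V} {g : G a} {l : GraphProduct Γ G}
    (hl : l ∈ genBy Γ G (Γ.Adj a)) {n m : ℤ} (hnm : (γ n)⁻¹ * γ m = of Γ G a g * l)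
    (hg : morseBound M < wordNorm (gens Γ S) (of Γ G a g)) :
    ∀ z ∈ genBy Γ G (Γ.Adj a), wordNorm (gens Γ S) z ≤ morseBound M := by
  intro z hz
  by_contra! hlong
  have hcl := closure_gens (Γ := Γ) hS
  have hm : γ m = γ n * (of Γ G a g * l) := by rw [← hnm]; group
  -- A point `x` which is close to `γ k` has about the same distances to the line as `γ k`.
  have near : ∀ (x : GraphProduct Γ G) (k : ℤ) (μ : ℕ), wordNorm (gens Γ S) (x⁻¹ * γ k) ≤ μ →
      ∀ (j : ℤ) (d : ℕ), wordNorm (gens Γ S) ((γ j)⁻¹ * x) = d →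
        k - j ≤ d + μ ∧ j - k ≤ d + μ ∧ ((d : ℤ) ≤ k - j + μ ∨ (d : ℤ) ≤ j - k + μ) := by
    rintro x k μ hμ j d rfl
    have h1 := wordNorm_mul_le hcl ((γ j)⁻¹ * x) (x⁻¹ * γ k)
    have h2 := wordNorm_mul_le hcl ((γ j)⁻¹ * γ k) (x⁻¹ * γ k)⁻¹
    rw [wordNorm_inv] at h2
    have e1 : (γ j)⁻¹ * x * (x⁻¹ * γ k) = (γ j)⁻¹ * γ k := by group
    have e2 : (γ j)⁻¹ * γ k * (x⁻¹ * γ k)⁻¹ = (γ j)⁻¹ * x := by group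
    rw [e1] at h1; rw [e2] at h2
    have h3 := hγ j k
    rcases abs_cases (j - k) with h | h <;> omega
  have far : ∀ (x x' : GraphProduct Γ G) (k k' : ℤ) (μ : ℕ),
      wordNorm (gens Γ S) (x⁻¹ * γ k) ≤ μ → wordNorm (gens Γ S) (x'⁻¹ * γ k') ≤ μ →
      ∀ d : ℕ, wordNorm (gens Γ S) (x⁻¹ * x') = d →
      k - k' ≤ d + 2 * μ ∧ k' - k ≤ d + 2 * μ ∧
        ((d : ℤ) ≤ k - k' + 2 * μ ∨ (d : ℤ) ≤ k' - k + 2 * μ) := by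
    rintro x x' k k' μ h1 h2 d rfl
    obtain ⟨d', hd'⟩ : ∃ d', wordNorm (gens Γ S) ((γ k)⁻¹ * x') = d' := ⟨_, rfl⟩
    have h3 := near x' k' μ h2 k d' hd'
    have h4 := wordNorm_mul_le hcl (x⁻¹ * γ k) ((γ k)⁻¹ * x')
    have h5 := wordNorm_mul_le hcl (x⁻¹ * γ k)⁻¹ (x⁻¹ * x')
    rw [wordNorm_inv] at h5
    have e1 : x⁻¹ * γ k * ((γ k)⁻¹ * x') = x⁻¹ * x' := by group
    have e2 : (x⁻¹ * γ k)⁻¹ * (x⁻¹ * x') = (γ k)⁻¹ * x' := by group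
    rw [e1] at h4; rw [e2] at h5
    omega
  set ℓ := wordNorm (gens Γ S) (of Γ G a g) with hℓ
  set q := wordNorm (gens Γ S) l with hq
  have hg1 := of_mem_genBy (Γ := Γ) (P := fun b => b = a) rfl g
  have one1 : (1 : GraphProduct Γ G) ∈ genBy Γ G (fun b => b = a) := Subgroup.one_mem _
  have one2 : (1 : GraphProduct Γ G) ∈ genBy Γ G (Γ.Adj a) := Subgroup.one_mem _
  -- Distances between `γ n * (x * y)` and `γ n * (x' * y')`.
  have nd : ∀ {x x' y y' : GraphProduct Γ G}, x ∈ genBy Γ G (fun b => b = a) →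
      x' ∈ genBy Γ G (fun b => b = a) → y ∈ genBy Γ G (Γ.Adj a) → y' ∈ genBy Γ G (Γ.Adj a) →
      wordNorm (gens Γ S) ((γ n * (x * y))⁻¹ * (γ n * (x' * y'))) =
      wordNorm (gens Γ S) (x⁻¹ * x') + wordNorm (gens Γ S) (y⁻¹ * y') := by
    intro x x' y y' h1 h2 h3 h4
    rw [← norm_product hS h1 h2 h3 h4]; congr 1; group
  have hnm' : (m - n = ℓ + q ∨ n - m = ℓ + q) := by
    have h1 := hγ n m
    rw [hnm, norm_of_mul_link hS g hl] at h1
    rcases abs_cases (n - m) with h | h <;> omega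
  have inY : ∀ k, γ k ∈ Set.range γ := fun k => ⟨k, rfl⟩
  -- The other two corners of the rectangle spanned by `γ n` and `γ m` are close to the geodesic, so the
  -- rectangle is thin; as `G a` is its long direction, `l` is short.
  have hq4 : q ≤ 4 * ⌈M (1 : ℕ) 0⌉₊ := by
    obtain ⟨-, _, ⟨k₁, rfl⟩, h₁⟩ := exists_near_corners hS hM g hl one2 (inY n) (hm ▸ inY m) 1
      le_rfl (Or.inl (by simp))
    obtain ⟨⟨_, ⟨k₂, rfl⟩, h₂⟩, -⟩ := exists_near_corners hS hM g hl hl (inY n) (hm ▸ inY m) 1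
      le_rfl (Or.inr (Or.inl (by simp)))
    have a1 := near _ _ _ h₁ n ℓ (by
      simp [← hℓ])
    have a2 := near _ _ _ h₁ m q (by
      rw [hm]; simp [wordNorm_inv, ← hq])
    have a3 := near _ _ _ h₂ n q (by
      simp [← hq])
    have a4 := near _ _ _ h₂ m ℓ (by
      have := nd hg1 one1 hl hl; rw [hm]; simpa [wordNorm_inv] using this)
    have a5 := far _ _ _ _ _ h₁ h₂ (ℓ + q) (by
      have := nd hg1 one1 one2 hl; simpa [wordNorm_inv] using this)
    unfold morseBound at hg
    omega
  -- A point `z'` of `⟨link(a)⟩` at distance exactly `morseBound M`.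
  obtain ⟨z', hz', hR⟩ : ∃ z' ∈ genBy Γ G (Γ.Adj a),
      wordNorm (gens Γ S) z' = morseBound M := by
    obtain ⟨c, c0, c1, cm, cd⟩ := exists_geodesic_in hS hz
    refine ⟨c (morseBound M), cm _, ?_⟩
    have := cd 0 (morseBound M) (by omega) (by omega)
    rwa [c0, inv_one, one_mul, Nat.sub_zero] at this
  obtain ⟨R', hR'⟩ : ∃ R', wordNorm (gens Γ S) (z'⁻¹ * l) = R' := ⟨_, rfl⟩
  have b1 : R' ≤ morseBound M + q := by
    have := wordNorm_mul_le hcl z'⁻¹ l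
    rw [wordNorm_inv] at this; omega
  have b2 : morseBound M ≤ R' + q := by
    have := wordNorm_mul_le hcl l (z'⁻¹ * l)⁻¹
    rw [wordNorm_inv] at this
    have e : l * (z'⁻¹ * l)⁻¹ = z' := by group
    rw [e] at this; omega
  have hlz : wordNorm (gens Γ S) (l⁻¹ * z') = R' := by
    rw [← hR', ← wordNorm_inv, mul_inv_rev, inv_inv]
  obtain ⟨⟨_, ⟨k₃, rfl⟩, h₃⟩, ⟨_, ⟨k₄, rfl⟩, h₄⟩⟩ := exists_near_corners hS hM g hl hz' (inY n)
    (hm ▸ inY m) 4 (by omega) (Or.inr (Or.inr (by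
      rw [hR', hR, ← hℓ]; unfold morseBound at *; omega)))
  have a1 := near _ _ _ h₃ n (morseBound M) (by
    rw [← hR]; simp)
  have a2 := near _ _ _ h₃ m (ℓ + R') (by
    have := nd hg1 one1 hl hz'
    rw [hlz] at this
    rw [hm]; simpa [wordNorm_inv] using this)
  have a3 := near _ _ _ h₄ n (ℓ + morseBound M) (by
    have := nd one1 hg1 one2 hz'; rw [← hR]; simpa using this)
  have a4 := near _ _ _ h₄ m R' (by
    have := nd hg1 hg1 hl hz'
    rw [hlz] at this
    rw [hm]; simpa using this)
  have a5 := far _ _ _ _ _ h₃ h₄ ℓ (by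
    have := nd one1 hg1 hz' hz'; simpa using this)
  -- The corners of the detour are close to points of the line whose distances to `γ n` and `γ m` are
  -- incompatible with the length of the segment between `γ n` and `γ m`.
  unfold morseBound at *
  omega

end GraphProduct

/-! ### Integer-valued height functions -/

theorem exists_int_primitive (f : ℤ → ℤ) : ∃ h : ℤ → ℤ, h 0 = 0 ∧ ∀ n, h (n + 1) = h n + f n := by
  refine ⟨fun n => ∑ k ∈ Finset.Ico 0 n, f k - ∑ k ∈ Finset.Ico n 0, f k, by simp, fun n => ?_⟩
  beta_reduce
  rcases lt_or_ge n 0 with hn | hn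
  · have e : Finset.Ico n 0 = insert n (Finset.Ico (n + 1) 0) := by
      ext k; simp only [Finset.mem_Ico, Finset.mem_insert]; omega
    rw [e, Finset.sum_insert (by simp), Finset.Ico_eq_empty_of_le hn.le,
      Finset.Ico_eq_empty_of_le (by omega : n + 1 ≤ 0)]
    simp
  · have e : Finset.Ico 0 (n + 1) = insert n (Finset.Ico 0 n) := by
      ext k; simp only [Finset.mem_Ico, Finset.mem_insert]; omega
    rw [e, Finset.sum_insert (by simp), Finset.Ico_eq_empty_of_le hn,
      Finset.Ico_eq_empty_of_le (by omega : 0 ≤ n + 1)]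
    simp [add_comm]

section Height

variable {h : ℤ → ℤ} (hstep : ∀ n, h (n + 1) = h n ∨ h (n + 1) = h n + 1)
include hstep

theorem height_mono : Monotone h :=
  monotone_int_of_le_succ fun n => by rcases hstep n with e | e <;> omega

theorem exists_last_step {n m : ℤ} (hnm : n ≤ m) (hh : h n < h m) :
    ∃ k, n ≤ k ∧ k < m ∧ h k = h m - 1 ∧ h (k + 1) = h m := by
  induction m, hnm using Int.leInduction with
  | base => omega
  | succ m hm ih =>
    rcases hstep m with e | e
    · obtain ⟨k, h1, h2, h3, h4⟩ := ih (by omega)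
      exact ⟨k, h1, by omega, by omega, by omega⟩
    · exact ⟨m, hm, by omega, by omega, rfl⟩

theorem exists_first_step {n m : ℤ} (hnm : n ≤ m) (hh : h n < h m) :
    ∃ k, n ≤ k ∧ k < m ∧ h k = h n ∧ h (k + 1) = h n + 1 := by
  induction m, hnm using Int.leInduction with
  | base => omega
  | succ m hm ih =>
    by_cases e : h n < h m
    · obtain ⟨k, h1, h2, h3, h4⟩ := ih e
      exact ⟨k, h1, by omega, h3, h4⟩
    · have h1 := height_mono hstep hm
      rcases hstep m with e' | e'
      · omega
      · exact ⟨m, hm, by omega, by omega, by omega⟩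

/-- A height function takes all values between two of its values. -/
theorem exists_height_eq {n m i : ℤ} (h1 : h n ≤ i) (h2 : i ≤ h m) : ∃ k, h k = i := by
  have hmono := height_mono hstep
  have hnm : n ≤ m ∨ h n = i := by
    by_contra! h'
    have := hmono h'.1.le
    omega
  rcases hnm with hnm | e
  · induction m, hnm using Int.leInduction with
    | base => exact ⟨n, by omega⟩
    | succ m hm ih =>
      by_cases e : i ≤ h m
      · exact ih e
      · exact ⟨m + 1, by rcases hstep m with e' | e' <;> omega⟩
  · exact ⟨n, e⟩

end Height

namespace GraphProduct

variable {V : Type u} {Γ : SimpleGraph V} {G : V → Type v} [∀ a, Group (G a)]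
  {S : ∀ a, Set (G a)}

/-! ### How a geodesic line crosses the star classes -/

variable (Γ S) in
/-- A bi-infinite geodesic through `1` in the Cayley graph of a graph product, together with the
letters (generators of vertex groups or their inverses) read along it. -/
structure GeodesicLine where
  /-- The points of the line. -/
  pt : ℤ → GraphProduct Γ G
  /-- The vertex to which the letter between `pt n` and `pt (n + 1)` belongs. -/
  typ : ℤ → V
  /-- The letter between `pt n` and `pt (n + 1)`. -/
  letter : ∀ n, G (typ n)
  letter_mem : ∀ n, letter n ∈ S (typ n) ∨ (letter n)⁻¹ ∈ S (typ n)
  step : ∀ n, pt (n + 1) = pt n * of Γ G (typ n) (letter n)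
  pt_zero : pt 0 = 1
  geo : ∀ i j, (wordNorm (gens Γ S) ((pt i)⁻¹ * pt j) : ℤ) = |i - j|

namespace GeodesicLine

variable (L : GeodesicLine Γ S) (a : V) (H : StarClass Γ G a)

open Classical in
theorem exists_height : ∃ h : ℤ → ℤ, h 0 = 0 ∧ ∀ n, h (n + 1) = h n +
    if L.typ n = a ∧ cls a (L.pt n) = H then 1 else 0 := exists_int_primitive _

/-- `L.height a H n` is the signed number of letters of `G a` which are read inside the star class
`H` between the times `0` and `n`. -/
noncomputable def height : ℤ → ℤ := Classical.choose (L.exists_height a H)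

theorem height_zero : L.height a H 0 = 0 := (Classical.choose_spec (L.exists_height a H)).1

variable {a H} in
theorem height_succ_of_pos {n : ℤ} (h : L.typ n = a ∧ cls a (L.pt n) = H) :
    L.height a H (n + 1) = L.height a H n + 1 := by
  rw [height, (Classical.choose_spec (L.exists_height a H)).2, if_pos h]

variable {a H} in
theorem height_succ_of_neg {n : ℤ} (h : ¬ (L.typ n = a ∧ cls a (L.pt n) = H)) :
    L.height a H (n + 1) = L.height a H n := by
  rw [height, (Classical.choose_spec (L.exists_height a H)).2, if_neg h, add_zero]

theorem height_step (n : ℤ) : L.height a H (n + 1) = L.height a H n ∨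
    L.height a H (n + 1) = L.height a H n + 1 := by
  by_cases h : L.typ n = a ∧ cls a (L.pt n) = H
  · exact Or.inr (L.height_succ_of_pos h)
  · exact Or.inl (L.height_succ_of_neg h)

theorem cls_of_height {n : ℤ} (h : L.height a H (n + 1) ≠ L.height a H n) :
    cls a (L.pt n) = H ∧ cls a (L.pt (n + 1)) = H := by
  by_cases h' : L.typ n = a ∧ cls a (L.pt n) = H
  · refine ⟨h'.2, ?_⟩
    rw [L.step, cls_mul_of (Or.inl h'.1), h'.2]
  · exact absurd (L.height_succ_of_neg h') h

theorem coord_succ_of_neg {n : ℤ} (h : ¬ (L.typ n = a ∧ cls a (L.pt n) = H)) :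
    coord (L.pt (n + 1)) a H = coord (L.pt n) a H := by
  rw [L.step]
  generalize L.letter n = x at *
  generalize L.typ n = b at *
  by_cases hb : b = a
  · subst hb
    exact coord_mul_of_ne_cls _ _ fun e => h ⟨rfl, e⟩
  · exact coord_mul_of_ne _ hb _ _

theorem coord_succ_of_pos {n : ℤ}
    (h : L.typ n = a ∧ cls a (L.pt n) = H) :
    wordNorm (gens Γ S) (of Γ G a ((coord (L.pt n) a H)⁻¹ * coord (L.pt (n + 1)) a H)) ≤ 1 := by
  rw [L.step]
  have hl := L.letter_mem n
  generalize L.letter n = x at *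
  generalize L.typ n = b at *
  obtain ⟨rfl, rfl⟩ := h
  rw [coord_mul_of_self, inv_mul_cancel_left]
  exact wordNorm_le_one (letter_of hl)

theorem coord_eq_of_height_eq {n m : ℤ} (h : L.height a H n = L.height a H m) :
    coord (L.pt n) a H = coord (L.pt m) a H := by
  wlog hnm : n ≤ m generalizing n m
  · exact (this h.symm (by omega)).symm
  induction m, hnm using Int.leInduction with
  | base => rfl
  | succ m hm ih =>
    have h1 := height_mono (L.height_step a H) hm
    have h2 := L.height_step a H m
    have h3 : ¬ (L.typ m = a ∧ cls a (L.pt m) = H) := by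
      intro h'
      have := L.height_succ_of_pos h'
      omega
    rw [L.coord_succ_of_neg a H h3]
    exact ih (by have := L.height_succ_of_neg h3; omega)

/-- The part of the line between two times of different height can be shortened to one which starts
and ends in the star class. -/
theorem exists_crossings {n m : ℤ} (hnm : n ≤ m) (h : L.height a H n < L.height a H m) :
    ∃ k k', n ≤ k ∧ k ≤ k' ∧ k' ≤ m ∧ L.height a H k = L.height a H n ∧
      L.height a H k' = L.height a H m ∧ cls a (L.pt k) = H ∧ cls a (L.pt k') = H := by
  obtain ⟨k, h1, h2, h3, h4⟩ := exists_first_step (L.height_step a H) hnm h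
  obtain ⟨k', h1', h2', h3', h4'⟩ := exists_last_step (L.height_step a H) hnm h
  refine ⟨k, k' + 1, h1, ?_, by omega, h3, h4', (L.cls_of_height a H (by omega)).1,
    (L.cls_of_height a H (by omega)).2⟩
  by_contra! hlt
  have := height_mono (L.height_step a H) hlt.le
  omega

theorem norm_retract_link_le (hS : ∀ a, Subgroup.closure (S a) = ⊤) {n m : ℤ} (hnm : n ≤ m) :
    (wordNorm (gens Γ S) (retract Γ G (Γ.Adj a) ((L.pt n)⁻¹ * L.pt m)) : ℤ) ≤
      (m - n) - (L.height a H m - L.height a H n) := by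
  induction m, hnm using Int.leInduction with
  | base => simp
  | succ m hm ih =>
    rw [L.step, ← mul_assoc, map_mul]
    have h1 := wordNorm_mul_le (closure_gens (Γ := Γ) hS)
      (retract Γ G (Γ.Adj a) ((L.pt n)⁻¹ * L.pt m))
      (retract Γ G (Γ.Adj a) (of Γ G (L.typ m) (L.letter m)))
    by_cases h' : L.typ m = a ∧ cls a (L.pt m) = H
    · have h2 := L.height_succ_of_pos h'
      rw [retract_of_neg (by rw [h'.1]; exact fun h => h.ne rfl)] at h1 ⊢
      rw [wordNorm_one] at h1
      omega
    · have h2 := L.height_succ_of_neg h'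
      have h3 := (norm_retract_le hS (Γ.Adj a) _).trans
        (wordNorm_le_one (letter_of (Γ := Γ) (L.letter_mem m)))
      omega

/-- The coordinates of a geodesic line at a star class of `a` trace out a geodesic of `G a`. -/
theorem norm_coord (hS : ∀ a, Subgroup.closure (S a) = ⊤) {n m : ℤ} (hnm : n ≤ m) :
    (wordNorm (gens Γ S) (of Γ G a ((coord (L.pt n) a H)⁻¹ * coord (L.pt m) a H)) : ℤ) =
      L.height a H m - L.height a H n := by
  have hcl := closure_gens (Γ := Γ) hS
  apply le_antisymm
  · induction m, hnm using Int.leInduction with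
    | base => simp
    | succ m hm ih =>
      by_cases h' : L.typ m = a ∧ cls a (L.pt m) = H
      · have h1 := L.height_succ_of_pos h'
        have h2 := L.coord_succ_of_pos a H h'
        have h3 := wordNorm_mul_le hcl
          (of Γ G a ((coord (L.pt n) a H)⁻¹ * coord (L.pt m) a H))
          (of Γ G a ((coord (L.pt m) a H)⁻¹ * coord (L.pt (m + 1)) a H))
        rw [← map_mul, mul_assoc, mul_inv_cancel_left] at h3
        omega
      · rw [L.coord_succ_of_neg a H h', L.height_succ_of_neg h']
        exact ih
  · rcases (height_mono (L.height_step a H) hnm).eq_or_lt with h | h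
    · rw [h, L.coord_eq_of_height_eq a H h]; simp
    · obtain ⟨k, k', h1, h2, h3, h4, h5, h6, h7⟩ := L.exists_crossings a H hnm h
      rw [← h4, ← h5, ← L.coord_eq_of_height_eq a H h4, ← L.coord_eq_of_height_eq a H h5]
      obtain ⟨l, hl, e⟩ := exists_link_of_cls_eq (h6.trans h7.symm)
      have h8 := L.norm_retract_link_le a H hS h2
      have h9 := L.geo k k'
      rw [e, norm_of_mul_link hS _ hl] at h9
      rw [e, map_mul, retract_of_neg (fun h => h.ne rfl), one_mul, retract_eq_self hl] at h8
      have e1 : tail a (L.pt k) = coord (L.pt k) a H := by rw [tail, h6]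
      have e2 : tail a (L.pt k') = coord (L.pt k') a H := by rw [tail, h7]
      rw [e1, e2] at h9
      rw [abs_sub_comm, abs_of_nonneg (by omega)] at h9
      push_cast at h9
      omega

theorem mem_genBy_of_norm_retract (hS : ∀ a, Subgroup.closure (S a) = ⊤) (P : V → Prop) {n m : ℤ}
    (hnm : n ≤ m)
    (h : (wordNorm (gens Γ S) (retract Γ G P ((L.pt n)⁻¹ * L.pt m)) : ℤ) = m - n) :
    (L.pt n)⁻¹ * L.pt m ∈ genBy Γ G P := by
  have hcl := closure_gens (Γ := Γ) hS
  induction m, hnm using Int.leInduction with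
  | base => rw [inv_mul_cancel]; exact Subgroup.one_mem _
  | succ m hm ih =>
    have h0 := norm_retract_le hS P ((L.pt n)⁻¹ * L.pt m)
    have h0' := L.geo n m
    rw [abs_sub_comm, abs_of_nonneg (by omega)] at h0'
    rw [L.step, ← mul_assoc, map_mul] at h
    rw [L.step, ← mul_assoc]
    have h1 := wordNorm_mul_le hcl (retract Γ G P ((L.pt n)⁻¹ * L.pt m))
      (retract Γ G P (of Γ G (L.typ m) (L.letter m)))
    by_cases hP : P (L.typ m)
    · have h2 := wordNorm_le_one (letter_of (Γ := Γ) (L.letter_mem m))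
      rw [retract_of_pos hP] at h1 h
      exact Subgroup.mul_mem _ (ih (by omega)) (of_mem_genBy hP _)
    · rw [retract_of_neg hP, mul_one] at h
      omega

/-- Between two letters of `G a` which are read inside `H`, the line stays inside `H`. -/
theorem cls_of_height_between (hS : ∀ a, Subgroup.closure (S a) = ⊤) {n m n' : ℤ}
    (h : L.height a H n < L.height a H m) (h' : L.height a H m < L.height a H n') :
    cls a (L.pt m) = H := by
  have hcl := closure_gens (Γ := Γ) hS
  have hmono := height_mono (L.height_step a H)
  have hnm : n ≤ m := by
    by_contra! hlt
    have := hmono hlt.le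
    omega
  have hmn : m ≤ n' := by
    by_contra! hlt
    have := hmono hlt.le
    omega
  obtain ⟨-, k, -, -, h3, -, h5, -, h7⟩ := L.exists_crossings a H hnm h
  obtain ⟨k', -, g1, -, -, g4, -, g6, -⟩ := L.exists_crossings a H hmn h'
  obtain ⟨l, hl, e⟩ := exists_link_of_cls_eq (h7.trans g6.symm)
  have e1 : tail a (L.pt k) = tail a (L.pt k') := by
    rw [tail, tail, h7, g6]; exact L.coord_eq_of_height_eq a H (h5.trans g4.symm)
  rw [e1, inv_mul_cancel, map_one, one_mul] at e
  have a1 := L.geo k k'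
  have a2 := L.geo k m
  have a3 := L.geo m k'
  rw [abs_sub_comm, abs_of_nonneg (by omega)] at a1 a2 a3
  have a4 := wordNorm_mul_le hcl (retract Γ G (Γ.Adj a) ((L.pt k)⁻¹ * L.pt m))
    (retract Γ G (Γ.Adj a) ((L.pt m)⁻¹ * L.pt k'))
  have e2 : (L.pt k)⁻¹ * L.pt m * ((L.pt m)⁻¹ * L.pt k') = (L.pt k)⁻¹ * L.pt k' := by group
  have a5 := norm_retract_le hS (Γ.Adj a) ((L.pt k)⁻¹ * L.pt m)
  have a6 := norm_retract_le hS (Γ.Adj a) ((L.pt m)⁻¹ * L.pt k')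
  rw [← map_mul, e2] at a4
  rw [e] at a1 a4
  rw [retract_eq_self hl] at a4
  have hmem := L.mem_genBy_of_norm_retract hS (Γ.Adj a) h3 (by omega)
  have := cls_mul_link (L.pt k) hmem
  rw [mul_inv_cancel_left, h7] at this
  exact this

theorem norm_coord_le (hS : ∀ a, Subgroup.closure (S a) = ⊤) (n : ℤ) :
    (wordNorm (gens Γ S) (of Γ G a (coord (L.pt n) a H)) : ℤ) = |L.height a H n| := by
  have hmono := height_mono (L.height_step a H)
  have h0 := L.height_zero a H
  rcases le_total 0 n with h | h
  · have h1 := L.norm_coord a H hS h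
    have h2 := hmono h
    rw [L.pt_zero, coord_one, inv_one, one_mul] at h1
    rw [h1, abs_of_nonneg (by omega)]; omega
  · have h1 := L.norm_coord a H hS h
    have h2 := hmono h
    rw [L.pt_zero, coord_one, mul_one, map_inv, wordNorm_inv] at h1
    rw [h1, abs_of_nonpos (by omega)]; omega

/-- A star class at which some coordinate of the line is long has a bounded link. -/
theorem link_bounded (hS : ∀ a, Subgroup.closure (S a) = ⊤) {M : ℝ≥0 → ℝ≥0 → ℝ≥0}
    (hM : (cayleyGraph Γ G S).IsMorse M (Set.range L.pt)) {n : ℤ}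
    (hn : (morseBound M : ℤ) < |L.height a H n|) :
    ∀ z ∈ genBy Γ G (Γ.Adj a), wordNorm (gens Γ S) z ≤ morseBound M := by
  have key : ∀ n m, n ≤ m → (morseBound M : ℤ) < L.height a H m - L.height a H n →
      ∀ z ∈ genBy Γ G (Γ.Adj a), wordNorm (gens Γ S) z ≤ morseBound M := by
    intro n m hnm hd
    obtain ⟨k, k', h1, h2, h3, h4, h5, h6, h7⟩ := L.exists_crossings a H hnm (by omega)
    obtain ⟨l, hl, e⟩ := exists_link_of_cls_eq (h6.trans h7.symm)
    refine link_bounded_of_morse hS L.geo hM hl e ?_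
    have := L.norm_coord a H hS h2
    rw [tail, tail, h6, h7]
    omega
  have hmono := height_mono (L.height_step a H)
  have h0 := L.height_zero a H
  rcases le_total 0 n with h | h
  · have h2 := hmono h
    rw [abs_of_nonneg (by omega)] at hn
    exact key 0 n h (by omega)
  · have h2 := hmono h
    rw [abs_of_nonpos (by omega)] at hn
    exact key n 0 h (by omega)

theorem exists_cls_eq {n : ℤ} (h : L.height a H n ≠ 0) : ∃ m, cls a (L.pt m) = H := by
  have hmono := height_mono (L.height_step a H)
  have h0 := L.height_zero a H
  rcases le_total 0 n with hn | hn
  · have := hmono hn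
    obtain ⟨k, -, -, -, -, -, -, h6, -⟩ := L.exists_crossings a H hn (by omega)
    exact ⟨k, h6⟩
  · have := hmono hn
    obtain ⟨k, -, -, -, -, -, -, h6, -⟩ := L.exists_crossings a H hn (by omega)
    exact ⟨k, h6⟩

open Classical in
/-- The coordinate of the line at height `i`, and `1` if this height is not attained. -/
noncomputable def val (i : ℤ) : G a :=
  if h : ∃ n, L.height a H n = i then coord (L.pt h.choose) a H else 1

theorem val_height (n : ℤ) : L.val a H (L.height a H n) = coord (L.pt n) a H := by
  have h : ∃ n', L.height a H n' = L.height a H n := ⟨n, rfl⟩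
  rw [val, dif_pos h]
  exact L.coord_eq_of_height_eq a H h.choose_spec

theorem val_zero : L.val a H 0 = 1 := by
  rw [← L.height_zero a H, L.val_height, L.pt_zero, coord_one]

theorem norm_coord_abs (hS : ∀ a, Subgroup.closure (S a) = ⊤) (n m : ℤ) :
    (wordNorm (gens Γ S) (of Γ G a ((coord (L.pt n) a H)⁻¹ * coord (L.pt m) a H)) : ℤ) =
      |L.height a H m - L.height a H n| := by
  have hmono := height_mono (L.height_step a H)
  rcases le_total n m with h | h
  · rw [L.norm_coord a H hS h, abs_of_nonneg (by have := hmono h; omega)]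
  · rw [← wordNorm_inv, ← map_inv, mul_inv_rev, inv_inv, L.norm_coord a H hS h,
      abs_of_nonpos (by have := hmono h; omega)]
    omega

/-- The height of the points of the line extends to a `1`-Lipschitz function on `G a` (McShane's
extension). -/
theorem exists_lipschitz_height (hS : ∀ a, Subgroup.closure (S a) = ⊤) :
    ∃ r : G a → ℤ, (∀ n, r (coord (L.pt n) a H) = L.height a H n) ∧
      ∀ c c', |r c - r c'| ≤ wordNorm (gens Γ S) (of Γ G a (c⁻¹ * c')) := by
  have hcl := closure_gens (Γ := Γ) hS
  have tri : ∀ x y z : G a, wordNorm (gens Γ S) (of Γ G a (x⁻¹ * z)) ≤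
      wordNorm (gens Γ S) (of Γ G a (x⁻¹ * y)) + wordNorm (gens Γ S) (of Γ G a (y⁻¹ * z)) := by
    intro x y z
    simpa using wordNorm_triangle hcl (of Γ G a x) (of Γ G a y) (of Γ G a z)
  let F : G a → ℤ → ℤ := fun c n =>
    L.height a H n + wordNorm (gens Γ S) (of Γ G a ((coord (L.pt n) a H)⁻¹ * c))
  have hb : ∀ c, BddBelow (Set.range (F c)) := by
    intro c
    refine ⟨-wordNorm (gens Γ S) (of Γ G a c), ?_⟩
    rintro _ ⟨n, rfl⟩
    have h1 := L.norm_coord_abs a H hS n 0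
    have h2 := tri (coord (L.pt n) a H) c 1
    rw [L.pt_zero, coord_one, L.height_zero] at h1
    have h3 := wordNorm_inv (gens Γ S) (of Γ G a c)
    rw [← map_inv] at h3
    simp only [mul_one] at h1 h2
    simp only [F]
    have := neg_abs_le (0 - L.height a H n)
    have := le_abs_self (0 - L.height a H n)
    omega
  have hle : ∀ c c', sInf (Set.range (F c)) ≤ sInf (Set.range (F c')) +
      wordNorm (gens Γ S) (of Γ G a (c⁻¹ * c')) := by
    intro c c'
    obtain ⟨n, hn⟩ := Int.csInf_mem (Set.range_nonempty (F c')) (hb c')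
    rw [← hn]
    refine (csInf_le (hb c) ⟨n, rfl⟩).trans ?_
    have h1 := tri (coord (L.pt n) a H) c' c
    have h2 := wordNorm_inv (gens Γ S) (of Γ G a (c⁻¹ * c'))
    rw [← map_inv, mul_inv_rev, inv_inv] at h2
    simp only [F]
    omega
  refine ⟨fun c => sInf (Set.range (F c)), fun n => ?_, fun c c' => ?_⟩
  · apply le_antisymm
    · refine (csInf_le (hb _) ⟨n, rfl⟩).trans ?_
      simp [F]
    · refine le_csInf (Set.range_nonempty _) ?_
      rintro _ ⟨m, rfl⟩
      have h1 := L.norm_coord_abs a H hS m n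
      have := le_abs_self (L.height a H n - L.height a H m)
      simp only [F]
      omega
  · have h1 := hle c c'
    have h2 := hle c' c
    have h3 := wordNorm_inv (gens Γ S) (of Γ G a (c⁻¹ * c'))
    rw [← map_inv, mul_inv_rev, inv_inv] at h3
    rw [abs_le]
    constructor <;> simp only <;> omega

end GeodesicLine

theorem exists_geodesicLine (hS : ∀ a, Subgroup.closure (S a) = ⊤) {γ : ℤ → GraphProduct Γ G}
    (hγ : (cayleyGraph Γ G S).IsBiinfiniteGeodesic γ) :
    ∃ L : GeodesicLine Γ S, ∀ n, L.pt n = (γ 0)⁻¹ * γ n := by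
  have hcl := closure_gens (Γ := Γ) hS
  have hgeo : ∀ i j, (wordNorm (gens Γ S) ((γ i)⁻¹ * γ j) : ℤ) = |i - j| := by
    intro i j
    rw [← hγ i j, cayleyGraph_eq, dist_eq_wordNorm]
  have hstep : ∀ n, ∃ (b : V) (s : G b), (s ∈ S b ∨ s⁻¹ ∈ S b) ∧
      γ (n + 1) = γ n * of Γ G b s := by
    intro n
    obtain ⟨l, hl, hp, hn⟩ := exists_geodesic_word hcl ((γ n)⁻¹ * γ (n + 1))
    have h1 := hgeo n (n + 1)
    rw [← hn] at h1
    simp only [sub_add_cancel_left, abs_neg, abs_one, Nat.cast_eq_one] at h1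
    obtain ⟨z, rfl⟩ := List.length_eq_one_iff.1 h1
    obtain ⟨b, s, hs, e⟩ := exists_of_letter (hl z (by simp))
    refine ⟨b, s, hs, ?_⟩
    rw [← e]
    simp only [List.prod_singleton] at hp
    rw [hp]; group
  choose typ letter hmem hst using hstep
  refine ⟨⟨fun n => (γ 0)⁻¹ * γ n, typ, letter, hmem, fun n => ?_, by simp, fun i j => ?_⟩,
    fun n => rfl⟩
  · rw [hst, mul_assoc]
  · rw [← hgeo]; congr 2; group

theorem isMorse_translate {M : ℝ≥0 → ℝ≥0 → ℝ≥0} {γ : ℤ → GraphProduct Γ G}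
    (hM : (cayleyGraph Γ G S).IsMorse M (Set.range γ)) (d : GraphProduct Γ G) :
    (cayleyGraph Γ G S).IsMorse M (Set.range fun n => d * γ n) := by
  intro A B hA n c hc h0 hn i hi
  have hd : ∀ x y, (cayleyGraph Γ G S).dist (d * x) (d * y) = (cayleyGraph Γ G S).dist x y :=
    fun x y => mulCayley_dist_mul_left _ d x y
  have back : ∀ x, x ∈ Set.range (fun n => d * γ n) → d⁻¹ * x ∈ Set.range γ := by
    rintro _ ⟨n, rfl⟩; exact ⟨n, by simp⟩
  obtain ⟨_, ⟨m, rfl⟩, hy⟩ := hM A B hA n (fun i => d⁻¹ * c i) (by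
    intro i j hi hj
    have := hc i j hi hj
    rwa [← hd (d⁻¹ * c i), mul_inv_cancel_left, mul_inv_cancel_left]) (back _ h0) (back _ hn) i hi
  refine ⟨d * γ m, ⟨m, rfl⟩, ?_⟩
  rwa [← hd, mul_inv_cancel_left] at hy

end GraphProduct

/-! ### Norms in vertex groups -/

theorem wordNorm_map_le {M N : Type*} [Group M] [Group N] {A : Set M} {B : Set N}
    (hA : Subgroup.closure A = ⊤) (hB : Subgroup.closure B = ⊤) (φ : M →* N)
    (h : ∀ a ∈ A, wordNorm B (φ a) ≤ 1) (x : M) : wordNorm B (φ x) ≤ wordNorm A x := by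
  have := wordNorm_lipschitz hA hB φ 1 (fun x a ha => by
    rw [map_mul, inv_mul_cancel_left]; exact h a ha) 1 x
  simpa using this

theorem closure_image_equiv {M N : Type*} [Group M] [Group N] {A : Set M}
    (hA : Subgroup.closure A = ⊤) (e : M ≃* N) : Subgroup.closure (e '' A) = ⊤ := by
  have h := MonoidHom.map_closure e.toMonoidHom A
  have h' : e.toMonoidHom.range = ⊤ := MonoidHom.range_eq_top.2 e.surjective
  rw [hA, ← MonoidHom.range_eq_map, h'] at h
  exact h.symm

/-- An isomorphism preserves the norms if it matches the generating sets. -/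
theorem wordNorm_equiv {M N : Type*} [Group M] [Group N] {A : Set M}
    (hA : Subgroup.closure A = ⊤) (e : M ≃* N) (x : M) :
    wordNorm (e '' A) (e x) = wordNorm A x := by
  have hB := closure_image_equiv hA e
  apply le_antisymm
  · exact wordNorm_map_le hA hB e.toMonoidHom (fun a ha => wordNorm_le_one (Or.inl ⟨a, ha, rfl⟩)) x
  · have := wordNorm_map_le hB hA e.symm.toMonoidHom (by
      rintro _ ⟨a, ha, rfl⟩
      exact wordNorm_le_one (Or.inl (by simpa using ha))) (e x)
    simpa using this

namespace GraphProduct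

section Norm

variable {V : Type u} {Γ : SimpleGraph V} {G : V → Type v} [∀ a, Group (G a)]
  {S : ∀ a, Set (G a)}

theorem norm_of (hS : ∀ a, Subgroup.closure (S a) = ⊤) (a : V) (x : G a) :
    wordNorm (gens Γ S) (of Γ G a x) = wordNorm (S a) x := by
  apply le_antisymm
  · exact wordNorm_map_le (hS a) (closure_gens hS) (of Γ G a)
      (fun s hs => wordNorm_le_one (Or.inl (of_mem_gens hs))) x
  · have := wordNorm_map_le (closure_gens (Γ := Γ) hS) (hS a) (proj Γ G a) (by
      intro y hy
      obtain ⟨b, s, hs, rfl⟩ := Set.mem_iUnion.1 hy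
      by_cases h : b = a
      · subst h
        rw [proj_of_self]
        exact wordNorm_le_one (Or.inl hs)
      · rw [proj_of_ne h, wordNorm_one]; omega) (of Γ G a x)
    rwa [proj_of_self] at this

/-- It suffices to check the Lipschitz condition on the generators of the vertex groups. -/
theorem lipschitz_of_gens (hS : ∀ a, Subgroup.closure (S a) = ⊤) {N : Type*} [Group N] {B : Set N}
    (hB : Subgroup.closure B = ⊤) (F : GraphProduct Γ G → N) (C : ℕ)
    (h : ∀ y a, ∀ s ∈ S a, wordNorm B ((F y)⁻¹ * F (y * of Γ G a s)) ≤ C) (x y : GraphProduct Γ G) :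
    wordNorm B ((F x)⁻¹ * F y) ≤ C * wordNorm (gens Γ S) (x⁻¹ * y) := by
  refine wordNorm_lipschitz (closure_gens hS) hB F C (fun y z hz => ?_) x y
  obtain ⟨a, s, hs, rfl⟩ := Set.mem_iUnion.1 hz
  exact h y a s hs

end Norm

/-! ### Changing the vertex groups along sections -/

variable {V : Type u} {Γ : SimpleGraph V} {K : V → Type w} {G : V → Type v} [∀ a, Group (K a)]
  [∀ a, Group (G a)]

variable (Γ K G) in
/-- For every star class `H` of a vertex `a`, an embedding `sec a H` of the set `K a` in the set `G
a` with left inverse `ret a H`. -/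
structure Sections where
  /-- The embedding of `K a` in `G a`. -/
  sec : ∀ a, StarClass Γ G a → K a → G a
  /-- The left inverse. -/
  ret : ∀ a, StarClass Γ G a → G a → K a
  ret_sec : ∀ a H k, ret a H (sec a H k) = k
  sec_one : ∀ a H, sec a H 1 = 1

namespace Sections

variable (Q : Sections Γ K G)

theorem sec_injective (a : V) (H : StarClass Γ G a) : Function.Injective (Q.sec a H) :=
  Function.LeftInverse.injective (Q.ret_sec a H)

theorem ret_one (a : V) (H : StarClass Γ G a) : Q.ret a H 1 = 1 := by
  rw [← Q.sec_one a H, Q.ret_sec]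

/-- The tail of `y` at `a` lies in the image of the section at the star class of `y`. -/
def InRange (a : V) (y : GraphProduct Γ G) : Prop := tail a y ∈ Set.range (Q.sec a (cls a y))

theorem InRange.sec_ret {Q : Sections Γ K G} {a : V} {y : GraphProduct Γ G} (h : Q.InRange a y) :
    Q.sec a (cls a y) (Q.ret a (cls a y) (tail a y)) = tail a y := by
  obtain ⟨k, hk⟩ := h
  rw [← hk, Q.ret_sec]

theorem inRange_of_tail_eq_one {a : V} {y : GraphProduct Γ G} (h : tail a y = 1) :
    Q.InRange a y := ⟨1, by rw [h, Q.sec_one]⟩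

open Classical in
/-- The right action of `K a` on the graph product of the groups `G b` which moves the tail at `a`
inside the image of the section. -/
noncomputable def std (a : V) (k : K a) (y : GraphProduct Γ G) : GraphProduct Γ G :=
  if Q.InRange a y then
    y * of Γ G a ((tail a y)⁻¹ * Q.sec a (cls a y) (Q.ret a (cls a y) (tail a y) * k))
  else y

variable {Q} in
theorem std_of_inRange {a : V} {y : GraphProduct Γ G} (h : Q.InRange a y) (k : K a) : Q.std a k y =
    y * of Γ G a ((tail a y)⁻¹ * Q.sec a (cls a y) (Q.ret a (cls a y) (tail a y) * k)) := if_pos h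

variable {Q} in
theorem std_of_not_inRange {a : V} {y : GraphProduct Γ G} (h : ¬ Q.InRange a y) (k : K a) :
    Q.std a k y = y := if_neg h

theorem exists_std_eq (a : V) (k : K a) (y : GraphProduct Γ G) :
    ∃ x, Q.std a k y = y * of Γ G a x := by
  by_cases h : Q.InRange a y
  · exact ⟨_, std_of_inRange h k⟩
  · exact ⟨1, by rw [std_of_not_inRange h, map_one, mul_one]⟩

theorem cls_std (a : V) (k : K a) (y : GraphProduct Γ G) : cls a (Q.std a k y) = cls a y := by
  obtain ⟨x, hx⟩ := Q.exists_std_eq a k y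
  rw [hx, cls_mul_of_self]

variable {Q} in
theorem tail_std {a : V} {y : GraphProduct Γ G} (h : Q.InRange a y) (k : K a) :
    tail a (Q.std a k y) = Q.sec a (cls a y) (Q.ret a (cls a y) (tail a y) * k) := by
  rw [std_of_inRange h, tail_mul_of_self, mul_inv_cancel_left]

theorem inRange_std_iff (a : V) (k : K a) (y : GraphProduct Γ G) :
    Q.InRange a (Q.std a k y) ↔ Q.InRange a y := by
  by_cases h : Q.InRange a y
  · refine ⟨fun _ => h, fun _ => ?_⟩
    rw [InRange, tail_std h, cls_std]; exact ⟨_, rfl⟩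
  · rw [std_of_not_inRange h]

theorem std_one (a : V) (y : GraphProduct Γ G) : Q.std a 1 y = y := by
  by_cases h : Q.InRange a y
  · rw [std_of_inRange h, mul_one, h.sec_ret, inv_mul_cancel, map_one, mul_one]
  · exact std_of_not_inRange h 1

theorem std_mul (a : V) (k k' : K a) (y : GraphProduct Γ G) :
    Q.std a (k * k') y = Q.std a k' (Q.std a k y) := by
  by_cases h : Q.InRange a y
  · rw [std_of_inRange ((Q.inRange_std_iff a k y).2 h), tail_std h, cls_std, Q.ret_sec,
      std_of_inRange h, std_of_inRange h, mul_assoc, ← map_mul]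
    congr 2
    group
  · rw [std_of_not_inRange h, std_of_not_inRange h, std_of_not_inRange h]

theorem inRange_mul_link {a : V} (y : GraphProduct Γ G) {l : GraphProduct Γ G}
    (hl : l ∈ genBy Γ G (Γ.Adj a)) : Q.InRange a (y * l) ↔ Q.InRange a y := by
  rw [InRange, tail_mul_link y hl, cls_mul_link y hl, InRange]

theorem std_mul_link {a : V} (k : K a) (y : GraphProduct Γ G) {l : GraphProduct Γ G}
    (hl : l ∈ genBy Γ G (Γ.Adj a)) : Q.std a k (y * l) = Q.std a k y * l := by
  by_cases h : Q.InRange a y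
  · rw [std_of_inRange h, std_of_inRange ((Q.inRange_mul_link y hl).2 h), tail_mul_link y hl,
      cls_mul_link y hl, mul_assoc, ← commute_of_mem_link _ hl, mul_assoc]
  · rw [std_of_not_inRange h, std_of_not_inRange (fun h' => h ((Q.inRange_mul_link y hl).1 h'))]

theorem std_comm {a b : V} (hab : Γ.Adj a b) (k : K a) (k' : K b) (y : GraphProduct Γ G) :
    Q.std a k (Q.std b k' y) = Q.std b k' (Q.std a k y) := by
  obtain ⟨x, hx⟩ := Q.exists_std_eq a k y
  by_cases h : Q.InRange b y
  · have hl : of Γ G a x ∈ genBy Γ G (Γ.Adj b) := of_mem_genBy hab.symm x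
    rw [std_of_inRange h, Q.std_mul_link k y (of_mem_genBy hab _), hx, Q.std_mul_link k' y hl,
      std_of_inRange h, mul_assoc, mul_assoc, of_commute hab]
  · rw [std_of_not_inRange h, hx, Q.std_mul_link k' y (of_mem_genBy hab.symm x),
      std_of_not_inRange h]

theorem exists_orbitMap : ∃ F : GraphProduct Γ K → GraphProduct Γ G, F 1 = 1 ∧
    ∀ x a k, F (x * of Γ K a k) = Q.std a k (F x) := by
  obtain ⟨F, h1, h2⟩ := exists_action (Γ := Γ) (fun a k y => Q.std a k y) Q.std_one Q.std_mul
    (fun a b hab k k' y => Q.std_comm hab k k' y)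
  exact ⟨fun x => F x 1, h1 1, fun x a k => h2 x a k 1⟩

/-- The orbit map `x ↦ 1 · x` of the right action. -/
noncomputable def emb : GraphProduct Γ K → GraphProduct Γ G := Classical.choose Q.exists_orbitMap

@[simp] theorem emb_one : Q.emb 1 = 1 := (Classical.choose_spec Q.exists_orbitMap).1

theorem emb_mul_of (x : GraphProduct Γ K) (a : V) (k : K a) :
    Q.emb (x * of Γ K a k) = Q.std a k (Q.emb x) := (Classical.choose_spec Q.exists_orbitMap).2 x a k

theorem exists_cocycleMap : ∃ g : GraphProduct Γ G → GraphProduct Γ K, g 1 = 1 ∧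
    ∀ y a x, g (y * of Γ G a x) =
      g y * of Γ K a ((Q.ret a (cls a y) (tail a y))⁻¹ * Q.ret a (cls a y) (tail a y * x)) := by
  refine exists_of_cocycle (fun a y x =>
    of Γ K a ((Q.ret a (cls a y) (tail a y))⁻¹ * Q.ret a (cls a y) (tail a y * x))) ?_ ?_
  · intro a y x x'
    rw [cls_mul_of_self, tail_mul_of_self, ← map_mul]
    congr 1
    rw [mul_assoc (tail a y)]; group
  · intro a b hab y x x'
    rw [cls_mul_of (Or.inr hab.symm), cls_mul_of (Or.inr hab), tail_mul_of_adj hab,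
      tail_mul_of_adj hab.symm, of_commute hab]

/-- The map in the other direction, which moves along `K a` as the retraction of the tail at `a`
does. -/
noncomputable def back : GraphProduct Γ G → GraphProduct Γ K := Classical.choose Q.exists_cocycleMap

@[simp] theorem back_one : Q.back 1 = 1 := (Classical.choose_spec Q.exists_cocycleMap).1

theorem back_mul_of (y : GraphProduct Γ G) (a : V) (x : G a) : Q.back (y * of Γ G a x) =
    Q.back y * of Γ K a ((Q.ret a (cls a y) (tail a y))⁻¹ * Q.ret a (cls a y) (tail a y * x)) :=
  (Classical.choose_spec Q.exists_cocycleMap).2 y a x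

theorem back_std {a : V} {y : GraphProduct Γ G} (h : Q.InRange a y) (k : K a) :
    Q.back (Q.std a k y) = Q.back y * of Γ K a k := by
  rw [std_of_inRange h, back_mul_of, mul_inv_cancel_left, Q.ret_sec, inv_mul_cancel_left]

theorem exists_emb_mul (x : GraphProduct Γ K) {P : V → Prop} {z : GraphProduct Γ K}
    (hz : z ∈ genBy Γ K P) : ∃ z' ∈ genBy Γ G P, Q.emb (x * z) = Q.emb x * z' := by
  refine genBy_induction (p := fun z => ∃ z' ∈ genBy Γ G P, Q.emb (x * z) = Q.emb x * z')
    ⟨1, Subgroup.one_mem _, by simp⟩ ?_ hz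
  rintro z b k hb ⟨z', hz', e⟩
  obtain ⟨g, hg⟩ := Q.exists_std_eq b k (Q.emb (x * z))
  exact ⟨z' * of Γ G b g, Subgroup.mul_mem _ hz' (of_mem_genBy hb g), by
    rw [← mul_assoc, emb_mul_of, hg, e, mul_assoc]⟩

theorem exists_back_mul (y : GraphProduct Γ G) {P : V → Prop} {z : GraphProduct Γ G}
    (hz : z ∈ genBy Γ G P) : ∃ z' ∈ genBy Γ K P, Q.back (y * z) = Q.back y * z' := by
  refine genBy_induction (p := fun z => ∃ z' ∈ genBy Γ K P, Q.back (y * z) = Q.back y * z')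
    ⟨1, Subgroup.one_mem _, by simp⟩ ?_ hz
  rintro z b k hb ⟨z', hz', e⟩
  exact ⟨z' * of Γ K b _, Subgroup.mul_mem _ hz' (of_mem_genBy hb _), by
    rw [← mul_assoc, back_mul_of, e, mul_assoc]⟩

theorem cls_emb_eq {a : V} {x x' : GraphProduct Γ K} (h : cls a x = cls a x') :
    cls a (Q.emb x) = cls a (Q.emb x') := by
  obtain ⟨z', hz', e⟩ := Q.exists_emb_mul x (cls_eq_iff.1 h)
  rw [mul_inv_cancel_left] at e
  rw [e, cls_mul_of_mem _ hz']

theorem cls_back_eq {a : V} {y y' : GraphProduct Γ G} (h : cls a y = cls a y') :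
    cls a (Q.back y) = cls a (Q.back y') := by
  obtain ⟨z', hz', e⟩ := Q.exists_back_mul y (cls_eq_iff.1 h)
  rw [mul_inv_cancel_left] at e
  rw [e, cls_mul_of_mem _ hz']

/-- The map induced by `emb` on star classes. -/
noncomputable def embCls (a : V) (H : StarClass Γ K a) : StarClass Γ G a := cls a (Q.emb H.out)

theorem embCls_cls (a : V) (x : GraphProduct Γ K) : Q.embCls a (cls a x) = cls a (Q.emb x) :=
  Q.cls_emb_eq (QuotientGroup.out_eq' (cls a x))

theorem coord_std_of_ne (a : V) (k : K a) (y : GraphProduct Γ G) {b : V} {H : StarClass Γ G b}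
    (h : ¬ ∃ e : a = b, cls a y = e ▸ H) : coord (Q.std a k y) b H = coord y b H := by
  obtain ⟨x, hx⟩ := Q.exists_std_eq a k y
  rw [hx]
  by_cases e : a = b
  · subst e
    exact coord_mul_of_ne_cls _ _ fun e => h ⟨rfl, e⟩
  · exact coord_mul_of_ne _ e _ _

theorem coord_emb_mem (x : GraphProduct Γ K) : ∀ (a : V) (H : StarClass Γ G a),
    coord (Q.emb x) a H ∈ Set.range (Q.sec a H) := by
  refine induction_right (p := fun x => ∀ (a : V) (H : StarClass Γ G a),
    coord (Q.emb x) a H ∈ Set.range (Q.sec a H)) ?_ ?_ x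
  · intro a H
    rw [emb_one, coord_one]; exact ⟨1, Q.sec_one a H⟩
  · intro x b k ih a H
    rw [emb_mul_of]
    by_cases h : ∃ e : b = a, cls b (Q.emb x) = e ▸ H
    · obtain ⟨rfl, rfl⟩ := h
      have := tail_std (Q := Q) (ih b _ : Q.InRange b (Q.emb x)) k
      rw [tail, cls_std] at this
      exact ⟨_, this.symm⟩
    · rw [Q.coord_std_of_ne b k _ h]
      exact ih a H

theorem inRange_emb (a : V) (x : GraphProduct Γ K) : Q.InRange a (Q.emb x) :=
  Q.coord_emb_mem x a _

theorem back_emb (x : GraphProduct Γ K) : Q.back (Q.emb x) = x := by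
  refine induction_right (p := fun x => Q.back (Q.emb x) = x) (by simp) ?_ x
  intro x b k ih
  rw [emb_mul_of, Q.back_std (Q.inRange_emb b x), ih]

theorem cls_emb_eq_iff {a : V} {x x' : GraphProduct Γ K} :
    cls a (Q.emb x) = cls a (Q.emb x') ↔ cls a x = cls a x' :=
  ⟨fun h => by have := Q.cls_back_eq h; rwa [back_emb, back_emb] at this, Q.cls_emb_eq⟩

theorem embCls_injective (a : V) : Function.Injective (Q.embCls a) := by
  intro H H' h
  obtain ⟨x, rfl⟩ := QuotientGroup.mk_surjective H
  obtain ⟨x', rfl⟩ := QuotientGroup.mk_surjective H'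
  exact Q.cls_emb_eq_iff.1 ((Q.embCls_cls a x).symm.trans (h.trans (Q.embCls_cls a x')))

/-- The coordinates of `Q.emb x` are the images of those of `x` under the sections. -/
theorem coord_emb (x : GraphProduct Γ K) : ∀ (a : V) (H : StarClass Γ K a),
    coord (Q.emb x) a (Q.embCls a H) = Q.sec a (Q.embCls a H) (coord x a H) := by
  refine induction_right (p := fun x => ∀ (a : V) (H : StarClass Γ K a),
    coord (Q.emb x) a (Q.embCls a H) = Q.sec a (Q.embCls a H) (coord x a H)) ?_ ?_ x
  · intro a H
    rw [emb_one, coord_one, coord_one, Q.sec_one]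
  · intro x b k ih a H
    rw [emb_mul_of]
    by_cases h : ∃ e : b = a, cls b x = e ▸ H
    · obtain ⟨rfl, rfl⟩ := h
      have h1 := tail_std (Q := Q) (Q.inRange_emb b x) k
      rw [tail, tail, cls_std, ← embCls_cls, ih, Q.ret_sec] at h1
      rw [h1, coord_mul_of_self]
    · rw [Q.coord_std_of_ne b k, ih]
      · congr 1
        by_cases e : b = a
        · subst e
          exact (coord_mul_of_ne_cls _ _ fun e => h ⟨rfl, e⟩).symm
        · exact (coord_mul_of_ne _ e _ _).symm
      · rintro ⟨rfl, e⟩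
        refine h ⟨rfl, ?_⟩
        rw [← embCls_cls] at e
        exact Q.embCls_injective b e

/-- Points whose coordinates lie in the images of the sections propagate membership in the image of
`emb` along edges. -/
theorem emb_back_mul_of {y : GraphProduct Γ G} {a : V} {x : G a} (h : Q.emb (Q.back y) = y)
    (h1 : Q.InRange a y) (h2 : Q.InRange a (y * of Γ G a x)) :
    Q.emb (Q.back (y * of Γ G a x)) = y * of Γ G a x := by
  have e := h2.sec_ret
  rw [cls_mul_of_self, tail_mul_of_self] at e
  rw [back_mul_of, emb_mul_of, h, std_of_inRange h1, mul_inv_cancel_left, e, inv_mul_cancel_left]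

theorem emb_back_line (p : ℤ → GraphProduct Γ G) (h0 : p 0 = 1)
    (hstep : ∀ n, ∃ (a : V) (x : G a), p (n + 1) = p n * of Γ G a x)
    (hp : ∀ n a, Q.InRange a (p n)) (n : ℤ) : Q.emb (Q.back (p n)) = p n := by
  induction n using Int.induction_on with
  | zero => simp [h0]
  | succ n ih =>
    obtain ⟨a, x, e⟩ := hstep n
    have h2 := hp (n + 1) a
    rw [e] at h2 ⊢
    exact Q.emb_back_mul_of ih (hp n a) h2
  | pred n ih =>
    obtain ⟨a, x, e⟩ := hstep (-n - 1)
    rw [sub_add_cancel] at e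
    have e' : p (-n - 1) = p (-n) * of Γ G a x⁻¹ := by rw [e]; simp
    have h2 := hp (-n - 1) a
    rw [e'] at h2 ⊢
    exact Q.emb_back_mul_of ih (hp (-n) a) h2

section Lipschitz

variable {U : ∀ a, Set (K a)} {S : ∀ a, Set (G a)}

theorem emb_lipschitz (hU : ∀ a, Subgroup.closure (U a) = ⊤) (hS : ∀ a, Subgroup.closure (S a) = ⊤)
    (C : ℕ) (h : ∀ a H k, ∀ s ∈ U a, wordNorm (S a) ((Q.sec a H k)⁻¹ * Q.sec a H (k * s)) ≤ C)
    (x x' : GraphProduct Γ K) : wordNorm (gens Γ S) ((Q.emb x)⁻¹ * Q.emb x') ≤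
      C * wordNorm (gens Γ U) (x⁻¹ * x') := by
  refine lipschitz_of_gens hU (closure_gens hS) Q.emb C (fun y a s hs => ?_) x x'
  obtain ⟨k, hk⟩ := Q.inRange_emb a y
  rw [emb_mul_of, std_of_inRange (Q.inRange_emb a y), inv_mul_cancel_left, ← hk, Q.ret_sec,
    norm_of hS]
  exact h a _ k s hs

theorem back_lipschitz (hU : ∀ a, Subgroup.closure (U a) = ⊤) (hS : ∀ a, Subgroup.closure (S a) = ⊤)
    (C : ℕ) (h : ∀ a H c, ∀ s ∈ S a, wordNorm (U a) ((Q.ret a H c)⁻¹ * Q.ret a H (c * s)) ≤ C)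
    (x x' : GraphProduct Γ G) : wordNorm (gens Γ U) ((Q.back x)⁻¹ * Q.back x') ≤
      C * wordNorm (gens Γ S) (x⁻¹ * x') := by
  refine lipschitz_of_gens hS (closure_gens hU) Q.back C (fun y a s hs => ?_) x x'
  rw [back_mul_of, inv_mul_cancel_left, norm_of hU]
  exact h a _ _ s hs

end Lipschitz

end Sections

end GraphProduct

namespace GraphProduct

variable {V : Type u} {Γ : SimpleGraph V} {J : V → Type w} {K : V → Type v} [∀ a, Group (J a)]
  [∀ a, Group (K a)]

/-! ### Shearing along long chains -/

/-- The integer next to `i` in the direction of `0`. -/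
def towardZero (i : ℤ) : ℤ := i - i.sign

theorem towardZero_of_pos {i : ℤ} (h : 0 < i) : towardZero i = i - 1 := by
  rw [towardZero, Int.sign_eq_one_of_pos h]

theorem towardZero_of_neg {i : ℤ} (h : i < 0) : towardZero i = i + 1 := by
  rw [towardZero, Int.sign_eq_neg_one_of_neg h]; ring

variable (Γ J K) in
/-- Sections from the vertex groups `J a` to the vertex groups `K a`, together with a line of the
graph product of the groups `K a` whose coordinates at the vertices of a set `R` may leave the
images of the sections. At the other vertices the sections are isomorphisms. -/
structure Shear extends Sections Γ J K where
  /-- The vertices at which the coordinates of the line may be long. -/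
  R : V → Prop
  not_R_of_adj : ∀ {a b}, R a → Γ.Adj a b → ¬ R b
  /-- At the vertices outside `R`, the vertex groups are isomorphic. -/
  equiv : ∀ a, ¬ R a → (J a ≃* K a)
  sec_eq : ∀ a (h : ¬ R a) H k, sec a H k = equiv a h k
  /-- A vertex outside the star. -/
  wit : V → V
  wit_not_mem : ∀ {a}, R a → ¬ InStar Γ a (wit a)
  /-- The element of `J a` at which a long chain of `a` is attached. -/
  sh : ∀ a, J a
  /-- The element of `J a` by which a long chain of another vertex leaves its star class. -/
  tt : ∀ a, J a
  tt_ne_one : ∀ a, tt a ≠ 1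
  sh_ne_one : ∀ {a}, R a → sh a ≠ 1
  tt_ne_sh : ∀ {a}, R a → tt a ≠ sh a
  /-- The points of the line. -/
  line : ℤ → GraphProduct Γ K
  line_zero : line 0 = 1
  line_step : ∀ n, ∃ (a : V) (x : K a), line (n + 1) = line n * of Γ K a x
  /-- The position of the line along its coordinates at a star class. -/
  height : ∀ a, StarClass Γ K a → ℤ → ℤ
  /-- The coordinate of the line at a given position. -/
  val : ∀ a, StarClass Γ K a → ℤ → K a
  /-- A function on `K a` which recovers the position from the coordinate. -/
  pos : ∀ a, StarClass Γ K a → K a → ℤ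
  height_zero : ∀ {a}, R a → ∀ H, height a H 0 = 0
  height_step : ∀ {a}, R a → ∀ H n, height a H (n + 1) = height a H n ∨
    height a H (n + 1) = height a H n + 1
  coord_line : ∀ {a}, R a → ∀ H n, coord (line n) a H = val a H (height a H n)
  pos_val : ∀ {a}, R a → ∀ H n, pos a H (val a H (height a H n)) = height a H n
  exists_cls_line : ∀ {a}, R a → ∀ H n, height a H n ≠ 0 → ∃ m, cls a (line m) = H
  cls_line : ∀ {a}, R a → ∀ H n m n', height a H n < height a H m →
    height a H m < height a H n' → cls a (line m) = H
  val_mem : ∀ {a}, R a → ∀ H n, |height a H n| ≤ 1 →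
    val a H (height a H n) ∈ Set.range (sec a H)

namespace Shear

variable (T : Shear Γ J K)

theorem val_zero {a : V} (ha : T.R a) (H : StarClass Γ K a) : T.val a H 0 = 1 := by
  rw [← T.height_zero ha H, ← T.coord_line ha, T.line_zero, coord_one]

theorem pos_one {a : V} (ha : T.R a) (H : StarClass Γ K a) : T.pos a H 1 = 0 := by
  have := T.pos_val ha H 0
  rwa [T.height_zero ha H, T.val_zero ha] at this

theorem ret_eq {a : V} (ha : ¬ T.R a) (H : StarClass Γ K a) (x : K a) :
    T.ret a H x = (T.equiv a ha).symm x := by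
  have h := T.ret_sec a H ((T.equiv a ha).symm x)
  rwa [T.sec_eq a ha, MulEquiv.apply_symm_apply] at h

theorem std_eq {a : V} (ha : ¬ T.R a) (k : J a) (y : GraphProduct Γ K) :
    T.std a k y = y * of Γ K a (T.equiv a ha k) := by
  have h : T.InRange a y :=
    ⟨(T.equiv a ha).symm (tail a y), by rw [T.sec_eq a ha, MulEquiv.apply_symm_apply]⟩
  rw [Sections.std_of_inRange h, T.sec_eq a ha, T.ret_eq ha,
    (T.equiv a ha).map_mul, MulEquiv.apply_symm_apply,
    inv_mul_cancel_left]

/-- The tail of `z` at `a` is a coordinate of the line outside the image of the section. -/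
def Far (a : V) (z : GraphProduct Γ K) : Prop :=
  (∃ n, tail a z = T.val a (cls a z) (T.height a (cls a z) n)) ∧ ¬ T.InRange a z

/-- The position along the coordinates of the line of the neighbour of `z` in the direction of
position `0`. -/
noncomputable def prev (a : V) (z : GraphProduct Γ K) : ℤ := towardZero (T.pos a (cls a z) (tail a z))

/-- The link part of an element. -/
noncomputable abbrev lk (a : V) (z : GraphProduct Γ K) : GraphProduct Γ K := retract Γ K (Γ.Adj a) z

/-- The neighbour of `z` along the coordinates of the line. -/
noncomputable def nbr (a : V) (z : GraphProduct Γ K) : GraphProduct Γ K :=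
  z * of Γ K a ((tail a z)⁻¹ * T.val a (cls a z) (T.prev a z))

/-- The neighbour of `z` along the coordinates of the line, with the link part removed. -/
noncomputable def pre (a : V) (z : GraphProduct Γ K) : GraphProduct Γ K := T.nbr a z * (lk a z)⁻¹

/-- The point next to `T.pre a z` outside its star class. -/
noncomputable def mid (a : V) (z : GraphProduct Γ K) : GraphProduct Γ K :=
  T.pre a z * of Γ K (T.wit a)
    (T.sec (T.wit a) (cls (T.wit a) (T.pre a z)) (T.tt (T.wit a)))

/-- The point `T.mid a z` with the link part of `z` restored. -/
noncomputable def base (a : V) (z : GraphProduct Γ K) : GraphProduct Γ K := T.mid a z * lk a z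

/-- The point which takes the place of the far point `z`: it lies in a new star class of `a`, which
is attached to the neighbour of `z` through a letter of `T.wit a`. -/
noncomputable def jump (a : V) (z : GraphProduct Γ K) : GraphProduct Γ K :=
  T.std a (T.sh a) (T.base a z)

section Far

variable {T} {a : V} (ha : T.R a) {z : GraphProduct Γ K} (hz : T.Far a z)
include ha hz

/-- The position of a far point, and that of its neighbour. -/
theorem far_spec : ∃ n m, tail a z = T.val a (cls a z) (T.height a (cls a z) n) ∧
    T.height a (cls a z) n = T.pos a (cls a z) (tail a z) ∧
    T.height a (cls a z) m = T.prev a z ∧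
    ((0 < T.prev a z ∧ T.height a (cls a z) n = T.prev a z + 1) ∨
      (T.prev a z < 0 ∧ T.height a (cls a z) n = T.prev a z - 1)) := by
  obtain ⟨⟨n, hn⟩, hr⟩ := hz
  have h1 : T.pos a (cls a z) (tail a z) = T.height a (cls a z) n := by
    rw [hn, T.pos_val ha]
  have h2 : ¬ |T.height a (cls a z) n| ≤ 1 := fun h => hr (by
    have := T.val_mem ha _ n h
    rwa [← hn] at this)
  have h3 := T.height_zero ha (cls a z)
  rcases lt_trichotomy (T.height a (cls a z) n) 0 with h | h | h
  · rw [abs_of_neg h] at h2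
    have h4 : T.prev a z = T.height a (cls a z) n + 1 := by
      rw [prev, h1, towardZero_of_neg h]
    obtain ⟨m, hm⟩ := exists_height_eq (T.height_step ha (cls a z)) (n := n) (m := 0)
      (i := T.prev a z) (by omega) (by omega)
    exact ⟨n, m, hn, h1.symm, hm, Or.inr (by omega)⟩
  · rw [h] at h2; simp at h2
  · rw [abs_of_pos h] at h2
    have h4 : T.prev a z = T.height a (cls a z) n - 1 := by
      rw [prev, h1, towardZero_of_pos h]
    obtain ⟨m, hm⟩ := exists_height_eq (T.height_step ha (cls a z)) (n := 0) (m := n)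
      (i := T.prev a z) (by omega) (by omega)
    exact ⟨n, m, hn, h1.symm, hm, Or.inl (by omega)⟩

theorem pos_prev : T.pos a (cls a z) (T.val a (cls a z) (T.prev a z)) = T.prev a z := by
  obtain ⟨n, m, -, -, h3, -⟩ := far_spec ha hz
  rw [← h3, T.pos_val ha]

theorem val_prev_ne_one : T.val a (cls a z) (T.prev a z) ≠ 1 := by
  intro h
  have h1 := pos_prev ha hz
  rw [h, T.pos_one ha] at h1
  obtain ⟨n, m, -, -, -, h4⟩ := far_spec ha hz
  omega

theorem exists_cls_of_far : ∃ m, cls a (T.line m) = cls a z := by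
  obtain ⟨n, m, -, -, -, h4⟩ := far_spec ha hz
  exact T.exists_cls_line ha _ n (by omega)

/-- A point of the line with the coordinate of the neighbour of a far point lies in the star class
of this far point: the line has been in this class before and will be in it again. -/
theorem cls_line_of_coord {m : ℤ}
    (h : coord (T.line m) a (cls a z) = T.val a (cls a z) (T.prev a z)) :
    cls a (T.line m) = cls a z := by
  rw [T.coord_line ha] at h
  have h1 := T.pos_val ha (cls a z) m
  rw [h, pos_prev ha hz] at h1
  obtain ⟨n, -, -, -, -, h4⟩ := far_spec ha hz
  have h3 := T.height_zero ha (cls a z)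
  rcases h4 with ⟨h4, h5⟩ | ⟨h4, h5⟩
  · exact T.cls_line ha _ 0 m n (by omega) (by omega)
  · exact T.cls_line ha _ n m 0 (by omega) (by omega)

omit ha hz in
theorem lk_mem (a : V) (z : GraphProduct Γ K) : lk a z ∈ genBy Γ K (Γ.Adj a) := retract_mem _ _

omit ha hz in
variable (T a z) in
theorem cls_nbr : cls a (T.nbr a z) = cls a z := cls_mul_of_self _ _

omit ha hz in
variable (T a z) in
theorem tail_nbr : tail a (T.nbr a z) = T.val a (cls a z) (T.prev a z) := by
  rw [nbr, tail_mul_of_self, mul_inv_cancel_left]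

omit ha hz in
variable (T a z) in
theorem cls_pre : cls a (T.pre a z) = cls a z := by
  rw [pre, cls_mul_link _ (Subgroup.inv_mem _ (lk_mem a z)), cls_nbr]

omit ha hz in
variable (T a z) in
theorem tail_pre : tail a (T.pre a z) = T.val a (cls a z) (T.prev a z) := by
  rw [pre, tail_mul_link _ (Subgroup.inv_mem _ (lk_mem a z)), tail_nbr]

theorem tail_wit_pre : tail (T.wit a) (T.pre a z) = 1 := by
  refine (tail_eq_one_or (T.wit_not_mem ha) (T.pre a z)).resolve_left ?_
  rw [tail_pre]
  exact val_prev_ne_one ha hz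

omit ha hz in
variable (T) in
theorem sec_tt_ne_one (b : V) (H : StarClass Γ K b) : T.sec b H (T.tt b) ≠ 1 := by
  intro h
  rw [← T.sec_one b H] at h
  exact T.tt_ne_one b (T.sec_injective b H h)

theorem tail_wit_mid : tail (T.wit a) (T.mid a z) =
    T.sec (T.wit a) (cls (T.wit a) (T.pre a z)) (T.tt (T.wit a)) := by
  rw [mid, tail_mul_of_self, tail_wit_pre ha hz, one_mul]

theorem tail_mid : tail a (T.mid a z) = 1 := by
  refine (tail_eq_one_or (T.wit_not_mem ha) (T.mid a z)).resolve_right ?_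
  rw [tail_wit_mid ha hz]
  exact T.sec_tt_ne_one _ _

omit hz in
theorem cls_mid_ne : cls a (T.mid a z) ≠ cls a z := by
  intro h
  rw [← cls_pre T a z, mid, eq_comm, cls_eq_iff, inv_mul_cancel_left] at h
  exact T.sec_tt_ne_one _ _ (of_eq_one_of_mem (T.wit_not_mem ha) h)

omit ha hz in
variable (T a z) in
theorem cls_base : cls a (T.base a z) = cls a (T.mid a z) := cls_mul_link _ (lk_mem a z)

theorem tail_base : tail a (T.base a z) = 1 := by
  rw [base, tail_mul_link _ (lk_mem a z), tail_mid ha hz]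

theorem inRange_base : T.InRange a (T.base a z) := T.inRange_of_tail_eq_one (tail_base ha hz)

omit ha hz in
variable (T a z) in
theorem cls_jump : cls a (T.jump a z) = cls a (T.mid a z) := by
  rw [jump, Sections.cls_std, cls_base]

theorem tail_std_base (k : J a) : tail a (T.std a k (T.base a z)) =
    T.sec a (cls a (T.mid a z)) k := by
  rw [Sections.tail_std (inRange_base ha hz), tail_base ha hz, T.ret_one, one_mul, cls_base]

theorem inRange_jump : T.InRange a (T.jump a z) :=
  (T.inRange_std_iff _ _ _).2 (inRange_base ha hz)

theorem not_far_jump : ¬ T.Far a (T.jump a z) := fun h => h.2 (inRange_jump ha hz)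

end Far

theorem far_mul_link {a : V} {z l : GraphProduct Γ K} (hl : l ∈ genBy Γ K (Γ.Adj a)) :
    T.Far a (z * l) ↔ T.Far a z := by
  rw [Far, T.inRange_mul_link z hl, tail_mul_link z hl, cls_mul_link z hl, Far]

theorem jump_mul_link {a : V} {z l : GraphProduct Γ K} (hl : l ∈ genBy Γ K (Γ.Adj a)) :
    T.jump a (z * l) = T.jump a z * l := by
  have h1 : T.nbr a (z * l) = T.nbr a z * l := by
    rw [nbr, prev, tail_mul_link z hl, cls_mul_link z hl, mul_assoc, ← commute_of_mem_link _ hl,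
      ← mul_assoc, nbr, prev]
  have h2 : T.pre a (z * l) = T.pre a z := by
    rw [pre, h1, lk, map_mul, retract_eq_self hl, pre]; group
  have h3 : T.base a (z * l) = T.base a z * l := by
    rw [base, mid, h2, lk, map_mul, retract_eq_self hl, base, mid, ← mul_assoc]
  rw [jump, h3, Sections.std_mul_link _ _ _ hl, jump]

/-- `T.jump` is injective: `z` is recovered from the link part, the star class and the position of
the neighbour. -/
theorem jump_injective {a : V} (ha : T.R a) {z z' : GraphProduct Γ K} (hz : T.Far a z)
    (hz' : T.Far a z') (h : T.jump a z = T.jump a z') : z = z' := by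
  have h1 : T.base a z = T.base a z' := by
    have := congrArg (T.std a (T.sh a)⁻¹) h
    rwa [jump, jump, ← Sections.std_mul, ← Sections.std_mul, mul_inv_cancel, Sections.std_one,
      Sections.std_one] at this
  have hlk : ∀ y, lk a (T.base a y) = lk a y := by
    intro y
    have e1 : ¬ Γ.Adj a (T.wit a) := fun h => T.wit_not_mem ha (Or.inr h)
    have e2 : retract Γ K (Γ.Adj a) (lk a y) = lk a y := retract_eq_self (lk_mem a y)
    rw [lk, base, mid, pre, nbr]
    simp only [map_mul, map_inv, e2, retract_of_neg e1]
    have e3 : ∀ x, retract Γ K (Γ.Adj a) (of Γ K a x) = 1 :=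
      retract_of_neg (fun h => h.ne rfl)
    simp [e3]
  have h2 : lk a z = lk a z' := by rw [← hlk, h1, hlk]
  have h3 : T.mid a z = T.mid a z' := by
    rw [base, base, h2] at h1
    exact mul_right_cancel h1
  have h4 : T.pre a z = T.pre a z' := by
    have e1 : cls (T.wit a) (T.pre a z) = cls (T.wit a) (T.pre a z') := by
      have := congrArg (cls (T.wit a)) h3
      rwa [mid, mid, cls_mul_of_self, cls_mul_of_self] at this
    rw [mid, mid, e1] at h3
    exact mul_right_cancel h3
  have h5 : T.nbr a z = T.nbr a z' := by
    rw [pre, pre, h2] at h4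
    exact mul_right_cancel h4
  have hc : cls a z = cls a z' := by rw [← cls_nbr T a z, h5, cls_nbr]
  have hp : T.prev a z = T.prev a z' := by
    rw [← pos_prev ha hz, ← pos_prev ha hz', ← tail_nbr, ← tail_nbr, h5, hc]
  have ht : tail a z = tail a z' := by
    obtain ⟨n, -, g1, -, -, g4⟩ := far_spec ha hz
    obtain ⟨n', -, g1', -, -, g4'⟩ := far_spec ha hz'
    have : T.height a (cls a z) n = T.height a (cls a z') n' := by omega
    rw [g1, g1', this, hc]
  rw [nbr, nbr, ht, hc, hp] at h5
  exact mul_right_cancel h5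

/-- A star class is sheared if it contains the new position of some far point. -/
def Sheared (a : V) (H : StarClass Γ K a) : Prop := ∃ z, T.Far a z ∧ cls a (T.jump a z) = H

theorem coord_eq_of_cls_eq {a : V} {x y : GraphProduct Γ K} (h : cls a x = cls a y)
    {H : StarClass Γ K a} (hH : cls a x ≠ H) : coord x a H = coord y a H := by
  obtain ⟨l, hl, e⟩ := exists_link_of_cls_eq h
  have : y = x * of Γ K a ((tail a x)⁻¹ * tail a y) * l := by rw [mul_assoc, ← e]; group
  rw [this, coord_mul_of_mem _ (fun h => h.ne rfl) hl, coord_mul_of_ne_cls _ _ hH]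

/-- The line does not visit the sheared classes. -/
theorem not_sheared_line {a : V} (ha : T.R a) (m : ℤ) : ¬ T.Sheared a (cls a (T.line m)) := by
  rintro ⟨z, hz, h⟩
  rw [cls_jump] at h
  have h1 := cls_mid_ne (T := T) ha (z := z)
  have h2 : coord (T.line m) a (cls a z) = T.val a (cls a z) (T.prev a z) := by
    rw [← coord_eq_of_cls_eq h h1, mid, coord_mul_of_ne _
      (fun e => T.wit_not_mem ha (Or.inl e)), ← tail_pre, tail, cls_pre]
  rw [h, cls_line_of_coord ha hz h2] at h1
  exact h1 rfl

theorem not_sheared_of_far {a : V} (ha : T.R a) {z : GraphProduct Γ K} (hz : T.Far a z) :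
    ¬ T.Sheared a (cls a z) := by
  obtain ⟨m, hm⟩ := exists_cls_of_far ha hz
  rw [← hm]
  exact T.not_sheared_line ha m

/-- A point of a sheared class with tail `sh` is the new position of some far point. -/
theorem exists_jump_eq {a : V} (ha : T.R a) {y : GraphProduct Γ K} (h : T.Sheared a (cls a y))
    (ht : tail a y = T.sec a (cls a y) (T.sh a)) : ∃ z, T.Far a z ∧ T.jump a z = y := by
  obtain ⟨z, hz, e⟩ := h
  obtain ⟨l, hl, e'⟩ := exists_link_of_cls_eq e
  have e1 : tail a (T.jump a z) = tail a y := by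
    rw [ht, jump, tail_std_base ha hz, ← cls_jump, e]
  rw [e1, inv_mul_cancel, map_one, one_mul] at e'
  refine ⟨z * l, (T.far_mul_link hl).2 hz, ?_⟩
  rw [T.jump_mul_link hl, ← e']; group

theorem tail_jump {a : V} (ha : T.R a) {z : GraphProduct Γ K} (hz : T.Far a z) :
    tail a (T.jump a z) = T.sec a (cls a (T.jump a z)) (T.sh a) := by
  rw [cls_jump, ← tail_std_base ha hz, jump]

open Classical in
/-- The involution which exchanges the far points with their new positions. -/
noncomputable def swap (a : V) (y : GraphProduct Γ K) : GraphProduct Γ K :=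
  if T.Far a y then T.jump a y
  else if h : ∃ z, T.Far a z ∧ T.jump a z = y then h.choose else y

theorem swap_of_far {a : V} {z : GraphProduct Γ K} (hz : T.Far a z) : T.swap a z = T.jump a z :=
  if_pos hz

theorem swap_jump {a : V} (ha : T.R a) {z : GraphProduct Γ K} (hz : T.Far a z) :
    T.swap a (T.jump a z) = z := by
  have h : ∃ z', T.Far a z' ∧ T.jump a z' = T.jump a z := ⟨z, hz, rfl⟩
  rw [swap, if_neg (not_far_jump ha hz), dif_pos h]
  exact T.jump_injective ha h.choose_spec.1 hz h.choose_spec.2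

theorem swap_of_not {a : V} {y : GraphProduct Γ K} (h1 : ¬ T.Far a y)
    (h2 : ¬ ∃ z, T.Far a z ∧ T.jump a z = y) : T.swap a y = y := by
  rw [swap, if_neg h1, dif_neg h2]

theorem swap_cases {a : V} (ha : T.R a) {p : GraphProduct Γ K → GraphProduct Γ K → Prop}
    (far : ∀ z, T.Far a z → p z (T.jump a z)) (jump : ∀ z, T.Far a z → p (T.jump a z) z)
    (fixed : ∀ y, ¬ T.Far a y → (¬ ∃ z, T.Far a z ∧ T.jump a z = y) → p y y)
    (y : GraphProduct Γ K) : p y (T.swap a y) := by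
  by_cases h1 : T.Far a y
  · rw [T.swap_of_far h1]; exact far y h1
  · by_cases h2 : ∃ z, T.Far a z ∧ T.jump a z = y
    · obtain ⟨z, hz, rfl⟩ := h2
      rw [T.swap_jump ha hz]; exact jump z hz
    · rw [T.swap_of_not h1 h2]; exact fixed y h1 h2

theorem swap_swap {a : V} (ha : T.R a) (y : GraphProduct Γ K) : T.swap a (T.swap a y) = y :=
  T.swap_cases (p := fun y y' => T.swap a y' = y) ha (fun _ hz => T.swap_jump ha hz)
    (fun _ hz => T.swap_of_far hz) (fun _ h1 h2 => T.swap_of_not h1 h2) y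

theorem swap_mul_link {a : V} (ha : T.R a) {l : GraphProduct Γ K} (hl : l ∈ genBy Γ K (Γ.Adj a))
    (y : GraphProduct Γ K) : T.swap a (y * l) = T.swap a y * l := by
  refine T.swap_cases (p := fun y y' => T.swap a (y * l) = y' * l) ha ?_ ?_ ?_ y
  · intro z hz
    rw [T.swap_of_far ((T.far_mul_link hl).2 hz), T.jump_mul_link hl]
  · intro z hz
    rw [← T.jump_mul_link hl, T.swap_jump ha ((T.far_mul_link hl).2 hz)]
  · intro y h1 h2
    refine T.swap_of_not (fun h => h1 ((T.far_mul_link hl).1 h)) ?_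
    rintro ⟨z, hz, e⟩
    refine h2 ⟨z * l⁻¹, (T.far_mul_link (Subgroup.inv_mem _ hl)).2 hz, ?_⟩
    rw [T.jump_mul_link (Subgroup.inv_mem _ hl), e]; group

open Classical in
/-- The right action of `J a`: at the vertices of `R` it is conjugated by the involution. -/
noncomputable def op (a : V) (k : J a) (y : GraphProduct Γ K) : GraphProduct Γ K :=
  if T.R a then T.swap a (T.std a k (T.swap a y)) else T.std a k y

theorem op_of_R {a : V} (ha : T.R a) (k : J a) (y : GraphProduct Γ K) :
    T.op a k y = T.swap a (T.std a k (T.swap a y)) := if_pos ha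

theorem op_of_not_R {a : V} (ha : ¬ T.R a) (k : J a) (y : GraphProduct Γ K) :
    T.op a k y = y * of Γ K a (T.equiv a ha k) := by rw [op, if_neg ha, T.std_eq ha]

theorem op_one (a : V) (y : GraphProduct Γ K) : T.op a 1 y = y := by
  by_cases ha : T.R a
  · rw [T.op_of_R ha, Sections.std_one, T.swap_swap ha]
  · rw [T.op_of_not_R ha, map_one, map_one, mul_one]

theorem op_mul (a : V) (k k' : J a) (y : GraphProduct Γ K) :
    T.op a (k * k') y = T.op a k' (T.op a k y) := by
  by_cases ha : T.R a
  · rw [T.op_of_R ha, T.op_of_R ha, T.op_of_R ha, Sections.std_mul, T.swap_swap ha]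
  · rw [T.op_of_not_R ha, T.op_of_not_R ha, T.op_of_not_R ha, map_mul, map_mul, mul_assoc]

theorem op_mul_link {a : V} (k : J a) (y : GraphProduct Γ K) {b : V} (hab : Γ.Adj a b) (x : K b) :
    T.op a k (y * of Γ K b x) = T.op a k y * of Γ K b x := by
  have hl : of Γ K b x ∈ genBy Γ K (Γ.Adj a) := of_mem_genBy hab x
  by_cases ha : T.R a
  · rw [T.op_of_R ha, T.swap_mul_link ha hl, Sections.std_mul_link _ _ _ hl,
      T.swap_mul_link ha hl, T.op_of_R ha]
  · rw [T.op_of_not_R ha, T.op_of_not_R ha, mul_assoc, mul_assoc, of_commute hab]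

theorem op_comm {a b : V} (hab : Γ.Adj a b) (k : J a) (k' : J b) (y : GraphProduct Γ K) :
    T.op a k (T.op b k' y) = T.op b k' (T.op a k y) := by
  by_cases hb : T.R b
  · have ha := T.not_R_of_adj hb hab.symm
    rw [T.op_of_not_R ha, T.op_of_not_R ha, T.op_mul_link k' y hab.symm]
  · rw [T.op_of_not_R hb, T.op_of_not_R hb, T.op_mul_link k y hab]

theorem exists_orbitMap : ∃ F : GraphProduct Γ J → GraphProduct Γ K, F 1 = 1 ∧
    ∀ x a k, F (x * of Γ J a k) = T.op a k (F x) := by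
  obtain ⟨F, h1, h2⟩ := exists_action (Γ := Γ) (fun a k y => T.op a k y) T.op_one T.op_mul
    (fun a b hab k k' y => T.op_comm hab k k' y)
  exact ⟨fun x => F x 1, h1 1, fun x a k => h2 x a k 1⟩

/-- The orbit map `x ↦ 1 · x` of the right action. -/
noncomputable def shear : GraphProduct Γ J → GraphProduct Γ K := Classical.choose T.exists_orbitMap

@[simp] theorem shear_one : T.shear 1 = 1 := (Classical.choose_spec T.exists_orbitMap).1

theorem shear_mul_of (x : GraphProduct Γ J) (a : V) (k : J a) :
    T.shear (x * of Γ J a k) = T.op a k (T.shear x) :=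
  (Classical.choose_spec T.exists_orbitMap).2 x a k

end Shear

end GraphProduct

namespace GraphProduct

variable {V : Type u} {Γ : SimpleGraph V} {J : V → Type w} {K : V → Type v} [∀ a, Group (J a)]
  [∀ a, Group (K a)]

namespace Shear

variable (T : Shear Γ J K)

/-! ### The points which the sheared action reaches -/

/-- The coordinates which are allowed on the orbit of `1`: the elements of the image of the section
and the coordinates of the line, except for the element at which a chain is attached. -/
def GoodAt (a : V) (H : StarClass Γ K a) (c : K a) : Prop :=
  (c ∈ Set.range (T.sec a H) ∨ ∃ n, c = T.val a H (T.height a H n)) ∧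
    ¬ (c = T.sec a H (T.sh a) ∧ T.Sheared a H)

/-- All coordinates at the vertices of `R` are allowed ones. The orbit of `1` consists of such
points. -/
def Good (y : GraphProduct Γ K) : Prop := ∀ a, T.R a → ∀ H, T.GoodAt a H (coord y a H)

theorem goodAt_sec {a : V} (H : StarClass Γ K a) {k : J a} (hk : k ≠ T.sh a) :
    T.GoodAt a H (T.sec a H k) :=
  ⟨Or.inl ⟨k, rfl⟩, fun h => hk (T.sec_injective a H h.1)⟩

theorem goodAt_one {a : V} (ha : T.R a) (H : StarClass Γ K a) : T.GoodAt a H 1 := by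
  rw [← T.sec_one a H]
  exact T.goodAt_sec H (T.sh_ne_one ha).symm

theorem good_one : T.Good 1 := fun a ha H => by rw [coord_one]; exact T.goodAt_one ha H

theorem good_mul_of_iff {y : GraphProduct Γ K} {b : V} {x : K b}
    (h : T.R b → T.GoodAt b (cls b y) (tail b y) ∧ T.GoodAt b (cls b y) (tail b y * x)) :
    T.Good (y * of Γ K b x) ↔ T.Good y := by
  have key : ∀ a, T.R a → ∀ H, T.GoodAt a H (coord (y * of Γ K b x) a H) ↔
      T.GoodAt a H (coord y a H) := by
    intro a ha H
    by_cases e : b = a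
    · subst e
      by_cases e' : cls b y = H
      · subst e'
        obtain ⟨h1, h2⟩ := h ha
        rw [coord_mul_of_self]
        exact ⟨fun _ => h1, fun _ => h2⟩
      · rw [coord_mul_of_ne_cls _ _ e']
    · rw [coord_mul_of_ne _ e]
  exact ⟨fun g a ha H => (key a ha H).1 (g a ha H), fun g a ha H => (key a ha H).2 (g a ha H)⟩

theorem good_mul_link_iff {a : V} (ha : T.R a) (y : GraphProduct Γ K) {l : GraphProduct Γ K}
    (hl : l ∈ genBy Γ K (Γ.Adj a)) : T.Good (y * l) ↔ T.Good y := by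
  have key : ∀ b, T.R b → ∀ H, coord (y * l) b H = coord y b H := fun b hb H =>
    coord_mul_of_mem y (fun h => T.not_R_of_adj ha h hb) hl H
  constructor
  · intro g b hb H
    rw [← key b hb]; exact g b hb H
  · intro g b hb H
    rw [key b hb]; exact g b hb H

/-- Passing from a far point to the star class of its new position only changes coordinates at three
star classes. -/
theorem good_std_base_iff {a : V} (ha : T.R a) {z : GraphProduct Γ K} (hz : T.Far a z) {k : J a}
    (hk : k ≠ T.sh a) : T.Good (T.std a k (T.base a z)) ↔ T.Good z := by
  rw [Sections.std_of_inRange (inRange_base ha hz), tail_base ha hz, T.ret_one, inv_one, one_mul,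
    one_mul, T.good_mul_of_iff, base, T.good_mul_link_iff ha _ (lk_mem a z), mid, T.good_mul_of_iff,
    pre, T.good_mul_link_iff ha _ (Subgroup.inv_mem _ (lk_mem a z)), nbr, T.good_mul_of_iff]
  · intro _
    have hs : ¬ T.Sheared a (cls a z) := T.not_sheared_of_far ha hz
    obtain ⟨n, m, h1, -, h3, -⟩ := far_spec ha hz
    rw [mul_inv_cancel_left]
    exact ⟨⟨Or.inr ⟨n, h1⟩, fun h => hs h.2⟩, ⟨Or.inr ⟨m, by rw [h3]⟩, fun h => hs h.2⟩⟩
  · intro hw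
    rw [tail_wit_pre ha hz, one_mul]
    exact ⟨T.goodAt_one hw _, T.goodAt_sec _ (T.tt_ne_sh hw)⟩
  · intro _
    rw [tail_base ha hz, one_mul]
    exact ⟨T.goodAt_one ha _, T.goodAt_sec _ hk⟩

theorem good_tail_cases {a : V} (ha : T.R a) {y : GraphProduct Γ K} (hy : T.Good y) :
    (T.Far a y ∨ T.InRange a y) ∧ ¬ ∃ z, T.Far a z ∧ T.jump a z = y := by
  obtain ⟨h1, h2⟩ := hy a ha (cls a y)
  refine ⟨?_, ?_⟩
  · by_cases h : T.InRange a y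
    · exact Or.inr h
    · exact Or.inl ⟨h1.resolve_left h, h⟩
  · rintro ⟨z, hz, rfl⟩
    exact h2 ⟨T.tail_jump ha hz, z, hz, rfl⟩

theorem inRange_swap {a : V} (ha : T.R a) {y : GraphProduct Γ K} (hy : T.Good y) :
    T.InRange a (T.swap a y) := by
  obtain ⟨h1, h2⟩ := T.good_tail_cases ha hy
  by_cases h : T.Far a y
  · rw [T.swap_of_far h]; exact inRange_jump ha h
  · rw [T.swap_of_not h h2]; exact h1.resolve_left h

theorem good_op {a : V} (k : J a) {y : GraphProduct Γ K} (hy : T.Good y) : T.Good (T.op a k y) := by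
  by_cases ha : T.R a
  swap
  · rw [T.op_of_not_R ha]
    exact (T.good_mul_of_iff fun h => absurd h ha).2 hy
  rw [T.op_of_R ha]
  obtain ⟨h1, h2⟩ := T.good_tail_cases ha hy
  by_cases hf : T.Far a y
  · -- `y` is far: its new position is moved inside its star class.
    rw [T.swap_of_far hf, jump, ← Sections.std_mul]
    by_cases hk : T.sh a * k = T.sh a
    · rw [hk, ← jump, T.swap_jump ha hf]; exact hy
    · have hg := (T.good_std_base_iff ha hf hk).2 hy
      have hr : T.InRange a (T.std a (T.sh a * k) (T.base a y)) :=
        (T.inRange_std_iff _ _ _).2 (inRange_base ha hf)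
      rwa [T.swap_of_not (fun h => h.2 hr) (T.good_tail_cases ha hg).2]
  · have hr := h1.resolve_left hf
    rw [T.swap_of_not hf h2]
    have hr' : T.InRange a (T.std a k y) := (T.inRange_std_iff _ _ _).2 hr
    by_cases hj : ∃ z, T.Far a z ∧ T.jump a z = T.std a k y
    · -- The action reaches the new position of a far point `z`.
      obtain ⟨z, hz, e⟩ := hj
      rw [← e, T.swap_jump ha hz]
      have e' : T.std a (T.sh a * k⁻¹) (T.base a z) = y := by
        rw [Sections.std_mul, ← jump, e, ← Sections.std_mul, mul_inv_cancel, Sections.std_one]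
      have hk : T.sh a * k⁻¹ ≠ T.sh a := by
        intro h
        rw [h, ← jump] at e'
        exact h2 ⟨z, hz, e'⟩
      rw [← T.good_std_base_iff ha hz hk, e']
      exact hy
    · rw [T.swap_of_not (fun h => h.2 hr') hj, Sections.std_of_inRange hr]
      refine (T.good_mul_of_iff fun _ => ⟨hy a ha _, ?_⟩).2 hy
      rw [mul_inv_cancel_left]
      refine ⟨Or.inl ⟨_, rfl⟩, fun h => hj ?_⟩
      refine T.exists_jump_eq ha (by rw [Sections.cls_std]; exact h.2) ?_
      rw [Sections.tail_std hr, Sections.cls_std]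
      exact h.1

theorem good_shear (x : GraphProduct Γ J) : T.Good (T.shear x) := by
  refine induction_right (p := fun x => T.Good (T.shear x)) ?_ ?_ x
  · rw [shear_one]; exact T.good_one
  · intro x a k ih
    rw [shear_mul_of]; exact T.good_op k ih

/-! ### The inverse of the shear -/

open Classical in
/-- The homomorphism to the graph product of the groups `J b` which kills all vertex groups outside
the link of `a`. For `a` in `R`, the link contains no vertex of `R`; the condition `¬ T.R b` only
gives access to the isomorphism. -/
noncomputable def linkHom (a : V) : GraphProduct Γ K →* GraphProduct Γ J :=
  lift (fun b => if h : Γ.Adj a b ∧ ¬ T.R b then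
    (of Γ J b).comp (T.equiv b h.2).symm.toMonoidHom else 1) (by
    intro b c hbc x y
    by_cases hb : Γ.Adj a b ∧ ¬ T.R b
    · by_cases hc : Γ.Adj a c ∧ ¬ T.R c
      · simp only [dif_pos hb, dif_pos hc]; exact of_commute hbc _ _
      · simp only [dif_neg hc, MonoidHom.one_apply, mul_one, one_mul]
    · simp only [dif_neg hb, MonoidHom.one_apply, mul_one, one_mul])

theorem linkHom_of_adj {a b : V} (h : Γ.Adj a b) (hb : ¬ T.R b) (x : K b) :
    T.linkHom a (of Γ K b x) = of Γ J b ((T.equiv b hb).symm x) := by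
  rw [linkHom, lift_of, dif_pos ⟨h, hb⟩]; rfl

theorem linkHom_of_not_adj {a b : V} (h : ¬ Γ.Adj a b) (x : K b) :
    T.linkHom a (of Γ K b x) = 1 := by
  rw [linkHom, lift_of, dif_neg fun h' => h h'.1]; rfl

theorem linkHom_of_self (a : V) (x : K a) : T.linkHom a (of Γ K a x) = 1 :=
  T.linkHom_of_not_adj (fun h => h.ne rfl) x

theorem linkHom_mem (a : V) (y : GraphProduct Γ K) : T.linkHom a y ∈ genBy Γ J (Γ.Adj a) := by
  refine induction_right (p := fun y => T.linkHom a y ∈ genBy Γ J (Γ.Adj a)) ?_ ?_ y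
  · rw [map_one]; exact Subgroup.one_mem _
  · intro y b x ih
    rw [map_mul]
    refine Subgroup.mul_mem _ ih ?_
    by_cases h : Γ.Adj a b ∧ ¬ T.R b
    · rw [T.linkHom_of_adj h.1 h.2]; exact of_mem_genBy h.1 _
    · rw [linkHom, lift_of, dif_neg h]; exact Subgroup.one_mem _

theorem linkHom_lk (a : V) (y : GraphProduct Γ K) : T.linkHom a (lk a y) = T.linkHom a y := by
  refine induction_right (p := fun y => T.linkHom a (lk a y) = T.linkHom a y) (by simp) ?_ y
  intro y b x ih
  rw [lk, map_mul, map_mul, ih, map_mul]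
  by_cases h : Γ.Adj a b
  · rw [retract_of_pos h]
  · rw [retract_of_neg h, map_one, T.linkHom_of_not_adj h]

open Classical in
/-- The image of the coordinate at position `i` under the inverse of the shear: the far coordinates
are strung out along a path which alternates between letters of `T.wit a` and of `a`. -/
noncomputable def chain (a : V) (H : StarClass Γ K a) (i : ℤ) : GraphProduct Γ J :=
  if i = 0 ∨ (∃ n, T.height a H n = i) ∧ T.val a H i ∈ Set.range (T.sec a H) then
    of Γ J a (T.ret a H (T.val a H i))
  else chain a H (towardZero i) * of Γ J (T.wit a) (T.tt (T.wit a)) * of Γ J a (T.sh a)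
termination_by i.natAbs
decreasing_by
  rename_i h
  rcases lt_trichotomy i 0 with h' | h' | h'
  · rw [towardZero_of_neg h']; omega
  · exact absurd (Or.inl h') h
  · rw [towardZero_of_pos h']; omega

theorem chain_of_pos {a : V} {H : StarClass Γ K a} {i : ℤ}
    (h : i = 0 ∨ (∃ n, T.height a H n = i) ∧ T.val a H i ∈ Set.range (T.sec a H)) :
    T.chain a H i = of Γ J a (T.ret a H (T.val a H i)) := by rw [chain, if_pos h]

theorem chain_of_neg {a : V} {H : StarClass Γ K a} {i : ℤ}
    (h : ¬ (i = 0 ∨ (∃ n, T.height a H n = i) ∧ T.val a H i ∈ Set.range (T.sec a H))) :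
    T.chain a H i = T.chain a H (towardZero i) * of Γ J (T.wit a) (T.tt (T.wit a)) *
      of Γ J a (T.sh a) := by rw [chain, if_neg h]

open Classical in
/-- The image of a coordinate under the inverse of the shear. -/
noncomputable def unrollCoord (a : V) (H : StarClass Γ K a) (c : K a) : GraphProduct Γ J :=
  if c ∈ Set.range (T.sec a H) then of Γ J a (T.ret a H c) else T.chain a H (T.pos a H c)

theorem unrollCoord_sec (a : V) (H : StarClass Γ K a) (k : J a) :
    T.unrollCoord a H (T.sec a H k) = of Γ J a k := by
  rw [unrollCoord, if_pos ⟨k, rfl⟩, T.ret_sec]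

theorem unrollCoord_of_not_mem {a : V} {H : StarClass Γ K a} {c : K a}
    (h : c ∉ Set.range (T.sec a H)) : T.unrollCoord a H c = T.chain a H (T.pos a H c) := if_neg h

theorem unrollCoord_val {a : V} (ha : T.R a) (H : StarClass Γ K a) (n : ℤ) :
    T.unrollCoord a H (T.val a H (T.height a H n)) = T.chain a H (T.height a H n) := by
  by_cases h : T.val a H (T.height a H n) ∈ Set.range (T.sec a H)
  · rw [unrollCoord, if_pos h, T.chain_of_pos (Or.inr ⟨⟨n, rfl⟩, h⟩)]
  · rw [T.unrollCoord_of_not_mem h, T.pos_val ha]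

open Classical in
theorem exists_unroll : ∃ g : GraphProduct Γ K → GraphProduct Γ J, g 1 = 1 ∧
    ∀ y a x, g (y * of Γ K a x) = g y *
      if ha : T.R a then (T.linkHom a y)⁻¹ * (T.unrollCoord a (cls a y) (tail a y))⁻¹ *
        T.unrollCoord a (cls a y) (tail a y * x) * T.linkHom a y
      else of Γ J a ((T.equiv a ha).symm x) := by
  refine exists_of_cocycle _ ?_ ?_
  · intro a y x x'
    by_cases ha : T.R a
    · simp only [dif_pos ha]
      rw [cls_mul_of_self, tail_mul_of_self, map_mul, linkHom_of_self, ← mul_assoc (tail a y)]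
      group
    · simp only [dif_neg ha, map_mul]
  · have key : ∀ a b, Γ.Adj a b → ∀ (ha : T.R a) (hb : ¬ T.R b) (y : GraphProduct Γ K) (x : K a)
        (x' : K b), (T.linkHom a y)⁻¹ * (T.unrollCoord a (cls a y) (tail a y))⁻¹ *
        T.unrollCoord a (cls a y) (tail a y * x) * T.linkHom a y * of Γ J b ((T.equiv b hb).symm x')
        = of Γ J b ((T.equiv b hb).symm x') * ((T.linkHom a (y * of Γ K b x'))⁻¹ *
          (T.unrollCoord a (cls a (y * of Γ K b x')) (tail a (y * of Γ K b x')))⁻¹ *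
        T.unrollCoord a (cls a (y * of Γ K b x')) (tail a (y * of Γ K b x') * x) *
        T.linkHom a (y * of Γ K b x')) := by
      intro a b hab ha hb y x x'
      rw [cls_mul_of (Or.inr hab), tail_mul_of_adj hab, map_mul, T.linkHom_of_adj hab hb]
      group
    intro a b hab y x x'
    by_cases ha : T.R a
    · have hb := T.not_R_of_adj ha hab
      simp only [dif_pos ha, dif_neg hb]
      exact key a b hab ha hb y x x'
    · by_cases hb : T.R b
      · simp only [dif_neg ha, dif_pos hb]
        exact (key b a hab.symm hb ha y x' x).symm
      · simp only [dif_neg ha, dif_neg hb]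
        exact of_commute hab _ _

/-- The left inverse of the shear. Along a vertex group of `R` it moves as the unrolled coordinate
does, up to a conjugation by the link part, which the shear carries along. -/
noncomputable def unroll : GraphProduct Γ K → GraphProduct Γ J := Classical.choose T.exists_unroll

@[simp] theorem unroll_one : T.unroll 1 = 1 := (Classical.choose_spec T.exists_unroll).1

theorem unroll_mul_of_R {a : V} (ha : T.R a) (y : GraphProduct Γ K) (x : K a) :
    T.unroll (y * of Γ K a x) = T.unroll y * ((T.linkHom a y)⁻¹ *
      (T.unrollCoord a (cls a y) (tail a y))⁻¹ * T.unrollCoord a (cls a y) (tail a y * x) *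
      T.linkHom a y) := by
  rw [unroll, (Classical.choose_spec T.exists_unroll).2, dif_pos ha]

theorem unroll_mul_of_not_R {a : V} (ha : ¬ T.R a) (y : GraphProduct Γ K) (x : K a) :
    T.unroll (y * of Γ K a x) = T.unroll y * of Γ J a ((T.equiv a ha).symm x) := by
  rw [unroll, (Classical.choose_spec T.exists_unroll).2, dif_neg ha]

theorem unroll_mul_link {a : V} (ha : T.R a) (y : GraphProduct Γ K) {l : GraphProduct Γ K}
    (hl : l ∈ genBy Γ K (Γ.Adj a)) : T.unroll (y * l) = T.unroll y * T.linkHom a l := by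
  refine genBy_induction (p := fun l => T.unroll (y * l) = T.unroll y * T.linkHom a l) (by simp)
    ?_ hl
  intro l b x hb ih
  have h := T.not_R_of_adj ha hb
  rw [← mul_assoc, T.unroll_mul_of_not_R h, ih, map_mul, T.linkHom_of_adj hb h, mul_assoc]

/-- Moving by a letter inside the image of the section. -/
theorem unroll_std {a : V} {y : GraphProduct Γ K} (hy : T.InRange a y) (k : J a) :
    T.unroll (T.std a k y) = T.unroll y * of Γ J a k := by
  by_cases ha : T.R a
  · obtain ⟨s, hs⟩ := hy
    rw [Sections.std_of_inRange ⟨s, hs⟩, T.unroll_mul_of_R ha, mul_inv_cancel_left, ← hs, T.ret_sec,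
      unrollCoord_sec, unrollCoord_sec, map_mul]
    congr 1
    rw [mul_assoc, mul_assoc, mul_assoc (of Γ J a s), inv_mul_cancel_left,
      commute_of_mem_link k (T.linkHom_mem a y),
      inv_mul_cancel_left]
  · rw [T.std_eq ha, T.unroll_mul_of_not_R ha, MulEquiv.symm_apply_apply]

theorem unroll_jump {a : V} (ha : T.R a) {z : GraphProduct Γ K} (hz : T.Far a z) :
    T.unroll (T.jump a z) = T.unroll z := by
  obtain ⟨n, m, h1, h2, h3, h4⟩ := far_spec ha hz
  have hmid : T.mid a z = T.std (T.wit a) (T.tt (T.wit a)) (T.pre a z) := by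
    rw [Sections.std_of_inRange (T.inRange_of_tail_eq_one (tail_wit_pre ha hz)), tail_wit_pre ha hz,
      T.ret_one, inv_one, one_mul, one_mul, mid]
  have e1 : T.unroll (T.jump a z) = T.unroll (T.nbr a z) * (T.linkHom a z)⁻¹ *
      of Γ J (T.wit a) (T.tt (T.wit a)) * T.linkHom a z * of Γ J a (T.sh a) := by
    rw [jump, T.unroll_std (inRange_base ha hz), base, T.unroll_mul_link ha _ (lk_mem a z), hmid,
      T.unroll_std (T.inRange_of_tail_eq_one (tail_wit_pre ha hz)), pre,
      T.unroll_mul_link ha _ (Subgroup.inv_mem _ (lk_mem a z)), map_inv, linkHom_lk]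
  have e2 : z = T.nbr a z * of Γ K a ((T.val a (cls a z) (T.prev a z))⁻¹ * tail a z) := by
    rw [nbr, mul_assoc, ← map_mul]
    simp [mul_assoc]
  have e3 : T.unroll z = T.unroll (T.nbr a z) * ((T.linkHom a z)⁻¹ *
      (of Γ J (T.wit a) (T.tt (T.wit a)) * of Γ J a (T.sh a)) * T.linkHom a z) := by
    have hl : T.linkHom a (T.nbr a z) = T.linkHom a z := by
      rw [nbr, map_mul, linkHom_of_self, mul_one]
    conv_lhs => rw [e2]
    rw [T.unroll_mul_of_R ha, hl, tail_nbr, cls_nbr, mul_inv_cancel_left]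
    have hr : tail a z ∉ Set.range (T.sec a (cls a z)) := hz.2
    have h5 : ¬ (T.pos a (cls a z) (tail a z) = 0 ∨
        (∃ n, T.height a (cls a z) n = T.pos a (cls a z) (tail a z)) ∧
        T.val a (cls a z) (T.pos a (cls a z) (tail a z)) ∈ Set.range (T.sec a (cls a z))) := by
      rw [← h2, ← h1]
      rintro (h | h)
      · omega
      · exact hr h.2
    have h6 : T.unrollCoord a (cls a z) (T.val a (cls a z) (T.prev a z)) =
        T.chain a (cls a z) (T.prev a z) := by
      rw [← h3, T.unrollCoord_val ha]
    rw [T.unrollCoord_of_not_mem hr, T.chain_of_neg h5, h6]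
    change _ * (_ * (T.chain a (cls a z) (T.prev a z))⁻¹ *
      (T.chain a (cls a z) (T.prev a z) * _ * _) * _) = _
    group
  rw [e1, e3, mul_assoc _ (T.linkHom a z), ← commute_of_mem_link _ (T.linkHom_mem a z)]
  group

theorem unroll_swap {a : V} (ha : T.R a) (y : GraphProduct Γ K) :
    T.unroll (T.swap a y) = T.unroll y :=
  T.swap_cases (p := fun y y' => T.unroll y' = T.unroll y) ha (fun _ hz => T.unroll_jump ha hz)
    (fun _ hz => (T.unroll_jump ha hz).symm) (fun _ _ _ => rfl) y

theorem unroll_shear (x : GraphProduct Γ J) : T.unroll (T.shear x) = x := by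
  refine induction_right (p := fun x => T.unroll (T.shear x) = x) (by simp) ?_ x
  intro x a k ih
  rw [shear_mul_of]
  by_cases ha : T.R a
  · rw [T.op_of_R ha, T.unroll_swap ha, T.unroll_std (T.inRange_swap ha (T.good_shear x)),
      T.unroll_swap ha, ih]
  · rw [T.op_of_not_R ha, T.unroll_mul_of_not_R ha, MulEquiv.symm_apply_apply, ih]

/-! ### The line lies in the image of the shear -/

theorem op_mem_range_iff {a : V} (k : J a) {y : GraphProduct Γ K} :
    T.op a k y ∈ Set.range T.shear ↔ y ∈ Set.range T.shear := by
  constructor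
  · rintro ⟨x, hx⟩
    exact ⟨x * of Γ J a k⁻¹, by
      rw [shear_mul_of, hx, ← T.op_mul, mul_inv_cancel, T.op_one]⟩
  · rintro ⟨x, rfl⟩
    exact ⟨x * of Γ J a k, T.shear_mul_of x a k⟩

theorem mul_of_mem_range_iff {a : V} (ha : ¬ T.R a) (x : K a) {y : GraphProduct Γ K} :
    y * of Γ K a x ∈ Set.range T.shear ↔ y ∈ Set.range T.shear := by
  rw [← T.op_mem_range_iff ((T.equiv a ha).symm x) (y := y), T.op_of_not_R ha,
    MulEquiv.apply_symm_apply]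

theorem mul_link_mem_range_iff {a : V} (ha : T.R a) {l : GraphProduct Γ K}
    (hl : l ∈ genBy Γ K (Γ.Adj a)) (y : GraphProduct Γ K) :
    y * l ∈ Set.range T.shear ↔ y ∈ Set.range T.shear := by
  refine genBy_induction (p := fun l => y * l ∈ Set.range T.shear ↔ y ∈ Set.range T.shear)
    (by simp) ?_ hl
  intro l b x hb ih
  rw [← mul_assoc, T.mul_of_mem_range_iff (T.not_R_of_adj ha hb), ih]

theorem swap_eq_self {a : V} (ha : T.R a) {y : GraphProduct Γ K} (h1 : T.InRange a y)
    (h2 : tail a y ≠ T.sec a (cls a y) (T.sh a)) : T.swap a y = y := by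
  refine T.swap_of_not (fun h => h.2 h1) ?_
  rintro ⟨z, hz, rfl⟩
  exact h2 (T.tail_jump ha hz)

theorem swap_eq_self_of_not_sheared {a : V} {y : GraphProduct Γ K} (h1 : T.InRange a y)
    (h2 : ¬ T.Sheared a (cls a y)) : T.swap a y = y := by
  refine T.swap_of_not (fun h => h.2 h1) ?_
  rintro ⟨z, hz, rfl⟩
  exact h2 ⟨z, hz, rfl⟩

theorem swap_eq_self_of_tail {a : V} (ha : T.R a) {y : GraphProduct Γ K} (h : tail a y = 1) :
    T.swap a y = y := by
  refine T.swap_eq_self ha (T.inRange_of_tail_eq_one h) ?_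
  rw [h, ← T.sec_one a (cls a y)]
  exact fun h' => T.sh_ne_one ha (T.sec_injective a _ h').symm

/-- A far point lies in the image of the shear if and only if its neighbour does. -/
theorem far_mem_range_iff {a : V} (ha : T.R a) {z : GraphProduct Γ K} (hz : T.Far a z) :
    z ∈ Set.range T.shear ↔ T.nbr a z ∈ Set.range T.shear := by
  have h1 : T.op a (T.sh a)⁻¹ z = T.base a z := by
    rw [T.op_of_R ha, T.swap_of_far hz, jump, ← Sections.std_mul, mul_inv_cancel, Sections.std_one,
      T.swap_eq_self_of_tail ha (tail_base ha hz)]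
  have h2 : T.op (T.wit a) (T.tt (T.wit a)) (T.pre a z) = T.mid a z := by
    have ht := tail_wit_pre ha hz
    have hstd : T.std (T.wit a) (T.tt (T.wit a)) (T.pre a z) = T.mid a z := by
      rw [Sections.std_of_inRange (T.inRange_of_tail_eq_one ht), ht, T.ret_one, inv_one, one_mul,
        one_mul, mid]
    by_cases hw : T.R (T.wit a)
    · rw [T.op_of_R hw, T.swap_eq_self_of_tail hw ht, hstd]
      have e : cls (T.wit a) (T.mid a z) = cls (T.wit a) (T.pre a z) := by
        rw [mid, cls_mul_of_self]
      refine T.swap_eq_self hw ?_ ?_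
      · rw [Sections.InRange, tail_wit_mid ha hz, e]; exact ⟨_, rfl⟩
      · rw [tail_wit_mid ha hz, e]
        exact fun h => T.tt_ne_sh hw (T.sec_injective _ _ h)
    · rw [op, if_neg hw, hstd]
  rw [← T.op_mem_range_iff (T.sh a)⁻¹, h1, base, T.mul_link_mem_range_iff ha (lk_mem a z), ← h2,
    T.op_mem_range_iff, pre, T.mul_link_mem_range_iff ha (Subgroup.inv_mem _ (lk_mem a z))]

/-- Inside a star class which the line visits, one can move along the coordinates of the line
without leaving the image of the shear. -/
theorem mem_range_iff_of_tail {a : V} (ha : T.R a) {H : StarClass Γ K a} (hH : ¬ T.Sheared a H)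
    (N : ℕ) : ∀ n, (T.height a H n).natAbs ≤ N → ∀ z, cls a z = H →
      tail a z = T.val a H (T.height a H n) →
      (z ∈ Set.range T.shear ↔ z * of Γ K a (tail a z)⁻¹ ∈ Set.range T.shear) := by
  induction N with
  | zero =>
    intro n hn z _ hz
    have h0 : T.height a H n = 0 := by omega
    rw [hz, h0, T.val_zero ha, inv_one, map_one, mul_one]
  | succ N ih =>
    rintro n hn z rfl hz
    by_cases hr : T.InRange a z
    · have e : T.op a (T.ret a (cls a z) (tail a z))⁻¹ z = z * of Γ K a (tail a z)⁻¹ := by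
        have ht : tail a (z * of Γ K a (tail a z)⁻¹) = 1 := by
          rw [tail_mul_of_self, mul_inv_cancel]
        rw [T.op_of_R ha, T.swap_eq_self_of_not_sheared hr hH,
          Sections.std_of_inRange hr, mul_inv_cancel,
          T.sec_one, mul_one, T.swap_eq_self_of_tail ha ht]
      rw [← e, T.op_mem_range_iff]
    · have hf : T.Far a z := ⟨⟨n, hz⟩, hr⟩
      obtain ⟨n', m, -, h2, h3, h4⟩ := far_spec ha hf
      have h5 : T.pos a (cls a z) (tail a z) = T.height a (cls a z) n := by
        rw [hz, T.pos_val ha]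
      have h6 := ih m (by omega) (T.nbr a z) (cls_nbr T a z) (by rw [tail_nbr, h3])
      rw [T.far_mem_range_iff ha hf, h6, tail_nbr, nbr, mul_assoc, ← map_mul, mul_inv_cancel_right]

theorem line_mem_range_step (n : ℤ) :
    T.line (n + 1) ∈ Set.range T.shear ↔ T.line n ∈ Set.range T.shear := by
  obtain ⟨a, x, e⟩ := T.line_step n
  by_cases ha : T.R a
  · have key : ∀ m, T.line m ∈ Set.range T.shear ↔
        T.line m * of Γ K a (tail a (T.line m))⁻¹ ∈ Set.range T.shear := fun m =>
      T.mem_range_iff_of_tail ha (T.not_sheared_line ha m) _ m le_rfl _ rfl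
        (by rw [tail, T.coord_line ha])
    rw [key (n + 1), key n, e, tail_mul_of_self, mul_assoc, ← map_mul]
    simp
  · rw [e, T.mul_of_mem_range_iff ha]

theorem line_mem_range (n : ℤ) : T.line n ∈ Set.range T.shear := by
  induction n using Int.induction_on with
  | zero => exact ⟨1, by rw [shear_one, line_zero]⟩
  | succ n ih => exact (T.line_mem_range_step _).2 ih
  | pred n ih =>
    have := T.line_mem_range_step (-n - 1)
    rw [sub_add_cancel] at this
    exact this.1 ih

end Shear

end GraphProduct

namespace GraphProduct

variable {V : Type u} {Γ : SimpleGraph V} {J : V → Type w} {K : V → Type v} [∀ a, Group (J a)]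
  [∀ a, Group (K a)]

namespace Shear

variable (T : Shear Γ J K)

/-! ### The shear and its inverse are Lipschitz -/

/-- Bounds on the data of a shear, with respect to generating sets of the vertex groups. -/
structure Bounded (W : ∀ a, Set (J a)) (U : ∀ a, Set (K a)) (C N : ℕ) : Prop where
  closure_W : ∀ a, Subgroup.closure (W a) = ⊤
  closure_U : ∀ a, Subgroup.closure (U a) = ⊤
  norm_J : ∀ a k, wordNorm (W a) k ≤ N
  norm_tt : ∀ a, wordNorm (W a) (T.tt a) ≤ 1
  norm_sh : ∀ a, wordNorm (W a) (T.sh a) ≤ 1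
  norm_equiv : ∀ a (h : ¬ T.R a) k, wordNorm (U a) (T.equiv a h k) = wordNorm (W a) k
  norm_sec : ∀ a H k, wordNorm (U a) (T.sec a H k) ≤ N
  norm_link : ∀ {a}, T.R a → ∀ l ∈ genBy Γ K (Γ.Adj a), wordNorm (gens Γ U) l ≤ C
  norm_val : ∀ {a}, T.R a → ∀ H n m, (wordNorm (U a) ((T.val a H (T.height a H n))⁻¹ *
    T.val a H (T.height a H m)) : ℤ) ≤ |T.height a H n - T.height a H m|
  pos_lipschitz : ∀ {a}, T.R a → ∀ H c c',
    |T.pos a H c - T.pos a H c'| ≤ wordNorm (U a) (c⁻¹ * c')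

variable {T} {W : ∀ a, Set (J a)} {U : ∀ a, Set (K a)} {C N : ℕ} (hT : T.Bounded W U C N)
include hT

theorem Bounded.jump_le {a : V} (ha : T.R a) {z : GraphProduct Γ K} (hz : T.Far a z) :
    wordNorm (gens Γ U) (z⁻¹ * T.jump a z) ≤ 1 + 2 * C + 2 * N := by
  have hcl := closure_gens (Γ := Γ) hT.closure_U
  obtain ⟨n, m, h1, h2, h3, h4⟩ := far_spec ha hz
  have a1 : wordNorm (gens Γ U) (z⁻¹ * T.nbr a z) ≤ 1 := by
    rw [nbr, inv_mul_cancel_left, norm_of hT.closure_U, ← h3]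
    have h5 := hT.norm_val ha (cls a z) n m
    rw [← h1] at h5
    have : |T.height a (cls a z) n - T.height a (cls a z) m| ≤ 1 := by
      rw [abs_le]; omega
    omega
  have a2 : wordNorm (gens Γ U) ((T.nbr a z)⁻¹ * T.pre a z) ≤ C := by
    rw [pre, inv_mul_cancel_left]
    exact hT.norm_link ha _ (Subgroup.inv_mem _ (lk_mem a z))
  have a3 : wordNorm (gens Γ U) ((T.pre a z)⁻¹ * T.mid a z) ≤ N := by
    rw [mid, inv_mul_cancel_left, norm_of hT.closure_U]
    exact hT.norm_sec _ _ _
  have a4 : wordNorm (gens Γ U) ((T.mid a z)⁻¹ * T.base a z) ≤ C := by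
    rw [base, inv_mul_cancel_left]
    exact hT.norm_link ha _ (lk_mem a z)
  have a5 : wordNorm (gens Γ U) ((T.base a z)⁻¹ * T.jump a z) ≤ N := by
    rw [jump, Sections.std_of_inRange (inRange_base ha hz), tail_base ha hz, inv_one, one_mul,
      inv_mul_cancel_left, norm_of hT.closure_U]
    exact hT.norm_sec _ _ _
  have b1 := wordNorm_triangle hcl z (T.nbr a z) (T.jump a z)
  have b2 := wordNorm_triangle hcl (T.nbr a z) (T.pre a z) (T.jump a z)
  have b3 := wordNorm_triangle hcl (T.pre a z) (T.mid a z) (T.jump a z)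
  have b4 := wordNorm_triangle hcl (T.mid a z) (T.base a z) (T.jump a z)
  omega

theorem Bounded.swap_le {a : V} (ha : T.R a) (y : GraphProduct Γ K) :
    wordNorm (gens Γ U) (y⁻¹ * T.swap a y) ≤ 1 + 2 * C + 2 * N := by
  refine T.swap_cases (p := fun y y' => wordNorm (gens Γ U) (y⁻¹ * y') ≤ 1 + 2 * C + 2 * N) ha
    (fun z hz => hT.jump_le ha hz) (fun z hz => ?_) (fun y _ _ => ?_) y
  · rw [wordNorm_symm]; exact hT.jump_le ha hz
  · rw [inv_mul_cancel, wordNorm_one]; omega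

theorem Bounded.shear_lipschitz (x x' : GraphProduct Γ J) :
    wordNorm (gens Γ U) ((T.shear x)⁻¹ * T.shear x') ≤
      (3 + 4 * C + 6 * N) * wordNorm (gens Γ W) (x⁻¹ * x') := by
  have hcl := closure_gens (Γ := Γ) hT.closure_U
  refine lipschitz_of_gens hT.closure_W hcl _ _ (fun x a s hs => ?_) x x'
  rw [shear_mul_of]
  generalize T.shear x = y
  by_cases ha : T.R a
  · rw [T.op_of_R ha]
    have h1 := hT.swap_le ha y
    have h2 : wordNorm (gens Γ U) ((T.swap a y)⁻¹ * T.std a s (T.swap a y)) ≤ 2 * N := by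
      by_cases hr : T.InRange a (T.swap a y)
      · rw [Sections.std_of_inRange hr, inv_mul_cancel_left, norm_of hT.closure_U]
        obtain ⟨k, hk⟩ := hr
        rw [← hk]
        have h3 := wordNorm_mul_le (hT.closure_U a) (T.sec a (cls a (T.swap a y)) k)⁻¹
          (T.sec a (cls a (T.swap a y)) (T.ret a (cls a (T.swap a y))
            (T.sec a (cls a (T.swap a y)) k) * s))
        rw [wordNorm_inv] at h3
        have h4 := hT.norm_sec a (cls a (T.swap a y)) k
        have h5 := hT.norm_sec a (cls a (T.swap a y)) (T.ret a (cls a (T.swap a y))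
            (T.sec a (cls a (T.swap a y)) k) * s)
        omega
      · rw [Sections.std_of_not_inRange hr, inv_mul_cancel, wordNorm_one]; omega
    have h3 := hT.swap_le ha (T.std a s (T.swap a y))
    have b1 := wordNorm_triangle hcl y (T.swap a y) (T.swap a (T.std a s (T.swap a y)))
    have b2 := wordNorm_triangle hcl (T.swap a y) (T.std a s (T.swap a y))
      (T.swap a (T.std a s (T.swap a y)))
    omega
  · rw [T.op_of_not_R ha, inv_mul_cancel_left, norm_of hT.closure_U, hT.norm_equiv]
    have := wordNorm_le_one (Or.inl hs : s ∈ W a ∨ s⁻¹ ∈ W a)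
    omega

theorem Bounded.norm_linkHom_le {a : V} (ha : T.R a) (y : GraphProduct Γ K) :
    wordNorm (gens Γ W) (T.linkHom a y) ≤ C := by
  have h := wordNorm_map_le (closure_gens (Γ := Γ) hT.closure_U) (closure_gens (Γ := Γ) hT.closure_W)
    (T.linkHom a) (by
      intro x hx
      obtain ⟨b, s, hs, rfl⟩ := Set.mem_iUnion.1 hx
      by_cases h : Γ.Adj a b
      · have hb := T.not_R_of_adj ha h
        rw [T.linkHom_of_adj h hb, norm_of hT.closure_W, ← hT.norm_equiv b hb,
          MulEquiv.apply_symm_apply]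
        exact wordNorm_le_one (Or.inl hs)
      · rw [T.linkHom_of_not_adj h, wordNorm_one]; omega) (lk a y)
  rw [linkHom_lk] at h
  exact h.trans (hT.norm_link ha _ (lk_mem a y))

theorem Bounded.norm_chain_step {a : V} (x : GraphProduct Γ J) :
    wordNorm (gens Γ W) (x⁻¹ * (x * of Γ J (T.wit a) (T.tt (T.wit a)) * of Γ J a (T.sh a))) ≤ 2 := by
  have hcl := closure_gens (Γ := Γ) hT.closure_W
  have h := wordNorm_mul_le hcl (of Γ J (T.wit a) (T.tt (T.wit a))) (of Γ J a (T.sh a))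
  rw [norm_of hT.closure_W, norm_of hT.closure_W] at h
  have h1 := hT.norm_tt (T.wit a)
  have h2 := hT.norm_sh a
  rw [mul_assoc, inv_mul_cancel_left]
  omega

theorem Bounded.norm_chain_le (a : V) (H : StarClass Γ K a) (n : ℕ) :
    ∀ i : ℤ, i.natAbs ≤ n → wordNorm (gens Γ W) (T.chain a H i) ≤ N + 2 * i.natAbs := by
  have hcl := closure_gens (Γ := Γ) hT.closure_W
  have base : ∀ i : ℤ, (i = 0 ∨ (∃ n, T.height a H n = i) ∧
      T.val a H i ∈ Set.range (T.sec a H)) →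
      wordNorm (gens Γ W) (T.chain a H i) ≤ N + 2 * i.natAbs := by
    intro i hi
    rw [T.chain_of_pos hi, norm_of hT.closure_W]
    exact (hT.norm_J a _).trans (by omega)
  induction n with
  | zero => exact fun i hi => base i (Or.inl (by omega))
  | succ n ih =>
    intro i hi
    by_cases h : i = 0 ∨ (∃ n, T.height a H n = i) ∧ T.val a H i ∈ Set.range (T.sec a H)
    · exact base i h
    · have hne : i ≠ 0 := fun h' => h (Or.inl h')
      have h1 : (towardZero i).natAbs + 1 = i.natAbs := by
        rcases lt_or_gt_of_ne hne with h' | h'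
        · rw [towardZero_of_neg h']; omega
        · rw [towardZero_of_pos h']; omega
      have h2 := ih (towardZero i) (by omega)
      have h3 := hT.norm_chain_step (a := a) (T.chain a H (towardZero i))
      rw [T.chain_of_neg h]
      have h4 := wordNorm_triangle hcl 1 (T.chain a H (towardZero i)) (T.chain a H (towardZero i) *
        of Γ J (T.wit a) (T.tt (T.wit a)) * of Γ J a (T.sh a))
      rw [inv_one, one_mul, one_mul] at h4
      omega

theorem Bounded.abs_pos_le {a : V} (ha : T.R a) (H : StarClass Γ K a) (k : J a) :
    |T.pos a H (T.sec a H k)| ≤ N := by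
  have h1 := hT.pos_lipschitz ha H 1 (T.sec a H k)
  rw [T.pos_one ha, zero_sub, abs_neg, inv_one, one_mul] at h1
  have h2 := hT.norm_sec a H k
  omega

/-- Neighbouring positions have close images: either the chain is prolonged by two letters there, or
the coordinate lies in the image of the section, which only contains small positions. -/
theorem Bounded.norm_chain_adj {a : V} (ha : T.R a) (H : StarClass Γ K a) {i : ℤ} (hi : i ≠ 0) :
    wordNorm (gens Γ W) ((T.chain a H (towardZero i))⁻¹ * T.chain a H i) ≤ 6 * N + 2 := by
  have hcl := closure_gens (Γ := Γ) hT.closure_W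
  by_cases h : i = 0 ∨ (∃ n, T.height a H n = i) ∧ T.val a H i ∈ Set.range (T.sec a H)
  · obtain ⟨⟨n, rfl⟩, k, hk⟩ := h.resolve_left hi
    have h0 := hT.abs_pos_le ha H k
    rw [hk, T.pos_val ha] at h0
    have h1 : (towardZero (T.height a H n)).natAbs ≤ (T.height a H n).natAbs := by
      rcases lt_or_gt_of_ne hi with h' | h'
      · rw [towardZero_of_neg h']; omega
      · rw [towardZero_of_pos h']; omega
    have h2 := hT.norm_chain_le a H _ _ (le_refl (towardZero (T.height a H n)).natAbs)
    have h3 := hT.norm_chain_le a H _ _ (le_refl (T.height a H n).natAbs)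
    have h4 := wordNorm_mul_le hcl (T.chain a H (towardZero (T.height a H n)))⁻¹
      (T.chain a H (T.height a H n))
    rw [wordNorm_inv] at h4
    rw [abs_le] at h0
    omega
  · rw [T.chain_of_neg h]
    exact (hT.norm_chain_step _).trans (by omega)

theorem Bounded.norm_unrollCoord {a : V} (ha : T.R a) (H : StarClass Γ K a) {c c' : K a}
    (hc : wordNorm (U a) (c⁻¹ * c') ≤ 1) :
    wordNorm (gens Γ W) ((T.unrollCoord a H c)⁻¹ * T.unrollCoord a H c') ≤ 6 * N + 2 := by
  have hcl := closure_gens (Γ := Γ) hT.closure_W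
  have hpos := hT.pos_lipschitz ha H c c'
  have hin : ∀ d, d ∈ Set.range (T.sec a H) → wordNorm (gens Γ W) (T.unrollCoord a H d) ≤ N := by
    rintro _ ⟨k, rfl⟩
    rw [T.unrollCoord_sec, norm_of hT.closure_W]
    exact hT.norm_J a k
  have hout : ∀ d, d ∉ Set.range (T.sec a H) → |T.pos a H d| ≤ N + 1 →
      wordNorm (gens Γ W) (T.unrollCoord a H d) ≤ 3 * N + 2 := by
    intro d hd hb
    rw [T.unrollCoord_of_not_mem hd]
    have := hT.norm_chain_le a H _ _ (le_refl (T.pos a H d).natAbs)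
    rw [abs_le] at hb
    omega
  have h4 := wordNorm_mul_le hcl (T.unrollCoord a H c)⁻¹ (T.unrollCoord a H c')
  rw [wordNorm_inv] at h4
  by_cases h : c ∈ Set.range (T.sec a H)
  · have h1 := hin c h
    by_cases h' : c' ∈ Set.range (T.sec a H)
    · have h2 := hin c' h'
      omega
    · obtain ⟨k, rfl⟩ := h
      have h0 := hT.abs_pos_le ha H k
      have h2 := hout c' h' (by rw [abs_le] at *; omega)
      omega
  · by_cases h' : c' ∈ Set.range (T.sec a H)
    · have h1 := hin c' h'
      obtain ⟨k, rfl⟩ := h'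
      have h0 := hT.abs_pos_le ha H k
      have h2 := hout c h (by rw [abs_le] at *; omega)
      omega
    · rw [T.unrollCoord_of_not_mem h, T.unrollCoord_of_not_mem h']
      generalize T.pos a H c = i at *
      generalize T.pos a H c' = j at *
      have hij : i = j ∨ (j ≠ 0 ∧ i = towardZero j) ∨ (i ≠ 0 ∧ j = towardZero i) := by
        rw [abs_le] at hpos
        rcases lt_trichotomy i 0 with g | g | g <;> rcases lt_trichotomy j 0 with g' | g' | g' <;>
          first
          | omega
          | (rw [towardZero_of_pos g]; omega)
          | (rw [towardZero_of_neg g]; omega)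
          | (rw [towardZero_of_pos g']; omega)
          | (rw [towardZero_of_neg g']; omega)
          | (rw [towardZero_of_pos g, towardZero_of_pos g']; omega)
          | (rw [towardZero_of_neg g, towardZero_of_neg g']; omega)
      rcases hij with rfl | ⟨h0, rfl⟩ | ⟨h0, rfl⟩
      · rw [inv_mul_cancel, wordNorm_one]; omega
      · exact hT.norm_chain_adj ha H h0
      · rw [wordNorm_symm]; exact hT.norm_chain_adj ha H h0

theorem Bounded.unroll_lipschitz (y y' : GraphProduct Γ K) :
    wordNorm (gens Γ W) ((T.unroll y)⁻¹ * T.unroll y') ≤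
      (2 * C + 6 * N + 2) * wordNorm (gens Γ U) (y⁻¹ * y') := by
  have hcl := closure_gens (Γ := Γ) hT.closure_W
  refine lipschitz_of_gens hT.closure_U hcl _ _ (fun y a s hs => ?_) y y'
  have hs1 := wordNorm_le_one (Or.inl hs : s ∈ U a ∨ s⁻¹ ∈ U a)
  by_cases ha : T.R a
  · rw [T.unroll_mul_of_R ha, inv_mul_cancel_left]
    have h1 := hT.norm_linkHom_le ha y
    have h2 := hT.norm_unrollCoord ha (cls a y) (c := tail a y) (c' := tail a y * s)
      (by rwa [inv_mul_cancel_left])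
    generalize T.linkHom a y = l at *
    generalize T.unrollCoord a (cls a y) (tail a y) = c at *
    generalize T.unrollCoord a (cls a y) (tail a y * s) = c' at *
    have h3 := wordNorm_mul_le hcl (l⁻¹ * c⁻¹ * c') l
    have h4 := wordNorm_mul_le hcl l⁻¹ (c⁻¹ * c')
    rw [← mul_assoc, wordNorm_inv] at h4
    omega
  · rw [T.unroll_mul_of_not_R ha, inv_mul_cancel_left, norm_of hT.closure_W,
      ← hT.norm_equiv a ha, MulEquiv.apply_symm_apply]
    omega

end Shear

end GraphProduct

namespace GraphProduct

variable {V : Type u} {Γ : SimpleGraph V} {J : V → Type w} {G : V → Type v} [∀ a, Group (J a)]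
  [∀ a, Group (G a)]

/-! ### Combining the two steps -/

/-- The vertex groups of the intermediate graph product: `Y` at the vertices of `R` and `X` at the
others. -/
theorem exists_intermediate_group (R : Prop) (X : Type w) (Y : Type v) [Group X] [Group Y] :
    ∃ (K : Type (max v w)) (_ : Group K), (R → Nonempty (Y ≃* K)) ∧ (¬ R → Nonempty (X ≃* K)) := by
  by_cases h : R
  · exact ⟨ULift.{w} Y, inferInstance, fun _ => ⟨MulEquiv.ulift.symm⟩, fun h' => absurd h h'⟩
  · exact ⟨ULift.{v} X, inferInstance, fun h' => absurd h' h, fun _ => ⟨MulEquiv.ulift.symm⟩⟩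

theorem wordNorm_inv_mul_le {M : Type*} [Group M] {A : Set M} (hA : Subgroup.closure A = ⊤) {N : ℕ}
    {x y : M} (hx : wordNorm A x ≤ N) (hy : wordNorm A y ≤ N) : wordNorm A (x⁻¹ * y) ≤ 2 * N := by
  have := wordNorm_mul_le hA x⁻¹ y
  rw [wordNorm_inv] at this
  omega

/-- A geodesic line lies in the image of a map from the graph product of the groups `J a` which is
bi-Lipschitz with controlled constants. At the vertices outside `R`, the coordinates of the line lie
in the images of the sections, while the coordinates at the vertices of `R` leave them; the latter
are straightened by a shear in an intermediate graph product. -/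
theorem exists_biLipschitz_of_line {S : ∀ a, Set (G a)} (hS : ∀ a, Subgroup.closure (S a) = ⊤)
    {W : ∀ a, Set (J a)} (hW : ∀ a, Subgroup.closure (W a) = ⊤) (L : GeodesicLine Γ S)
    (P : Sections Γ J G) {R : V → Prop} {D N : ℕ} (hD : 1 ≤ D) (hN : 1 ≤ N)
    (hR : ∀ a, R a → ∀ z ∈ genBy Γ G (Γ.Adj a), wordNorm (gens Γ S) z ≤ D)
    (hRadj : ∀ {a b}, R a → Γ.Adj a b → ¬ R b)
    (hnotR : ∀ a, ¬ R a → ∀ H n, |L.height a H n| ≤ D)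
    (hrange : ∀ a H n, |L.height a H n| ≤ D → coord (L.pt n) a H ∈ Set.range (P.sec a H))
    (wit : V → V) (hwit : ∀ {a}, R a → ¬ InStar Γ a (wit a))
    (sh tt : ∀ a, J a) (htt : ∀ a, tt a ≠ 1) (hsh : ∀ {a}, R a → sh a ≠ 1)
    (htsh : ∀ {a}, R a → tt a ≠ sh a) (hntt : ∀ a, wordNorm (W a) (tt a) ≤ 1)
    (hnsh : ∀ a, wordNorm (W a) (sh a) ≤ 1) (hnJ : ∀ a k, wordNorm (W a) k ≤ N)
    (hnsec : ∀ a H k, wordNorm (S a) (P.sec a H k) ≤ N) :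
    ∃ (f : GraphProduct Γ J → GraphProduct Γ G) (g : GraphProduct Γ G → GraphProduct Γ J),
      (∀ x, g (f x) = x) ∧
      (∀ x x', wordNorm (gens Γ S) ((f x)⁻¹ * f x') ≤
        (2 * N) * ((3 + 4 * (2 * N * D) + 6 * N) * wordNorm (gens Γ W) (x⁻¹ * x'))) ∧
      (∀ y y', wordNorm (gens Γ W) ((g y)⁻¹ * g y') ≤
        (2 * (2 * N * D) + 6 * N + 2) * ((2 * N) * wordNorm (gens Γ S) (y⁻¹ * y'))) ∧
      ∀ n, L.pt n ∈ Set.range f := by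
  classical
  choose K instK hK1 hK2 using fun a => exists_intermediate_group (R a) (J a) (G a)
  let eR : ∀ a, R a → (G a ≃* K a) := fun a h => (hK1 a h).some
  let eN : ∀ a, ¬ R a → (J a ≃* K a) := fun a h => (hK2 a h).some
  let U : ∀ a, Set (K a) := fun a => if h : R a then eR a h '' S a else eN a h '' W a
  have hUR : ∀ a (h : R a), U a = eR a h '' S a := fun a h => dif_pos h
  have hUN : ∀ a (h : ¬ R a), U a = eN a h '' W a := fun a h => dif_neg h
  have hU : ∀ a, Subgroup.closure (U a) = ⊤ := by
    intro a
    by_cases h : R a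
    · rw [hUR a h]; exact closure_image_equiv (hS a) _
    · rw [hUN a h]; exact closure_image_equiv (hW a) _
  have normR : ∀ a (h : R a) x, wordNorm (U a) (eR a h x) = wordNorm (S a) x := by
    intro a h x
    rw [hUR a h]; exact wordNorm_equiv (hS a) _ x
  have normN : ∀ a (h : ¬ R a) x, wordNorm (U a) (eN a h x) = wordNorm (W a) x := by
    intro a h x
    rw [hUN a h]; exact wordNorm_equiv (hW a) _ x
  -- The sections from the intermediate groups to the groups `G a`.
  let Q : Sections Γ K G :=
    { sec := fun a H k => if h : R a then (eR a h).symm k else P.sec a H ((eN a h).symm k)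
      ret := fun a H x => if h : R a then eR a h x else eN a h (P.ret a H x)
      ret_sec := by
        intro a H k
        by_cases h : R a
        · simp only [dif_pos h, MulEquiv.apply_symm_apply]
        · simp only [dif_neg h, P.ret_sec, MulEquiv.apply_symm_apply]
      sec_one := by
        intro a H
        by_cases h : R a
        · simp only [dif_pos h, map_one]
        · simp only [dif_neg h, map_one, P.sec_one] }
  have QsR : ∀ a (h : R a) H k, Q.sec a H k = (eR a h).symm k := fun a h H k => dif_pos h
  have QsN : ∀ a (h : ¬ R a) H k, Q.sec a H k = P.sec a H ((eN a h).symm k) :=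
    fun a h H k => dif_neg h
  have QrR : ∀ a (h : R a) H x, Q.ret a H x = eR a h x := fun a h H k => dif_pos h
  have QrN : ∀ a (h : ¬ R a) H x, Q.ret a H x = eN a h (P.ret a H x) :=
    fun a h H k => dif_neg h
  have hemb : ∀ x x', wordNorm (gens Γ S) ((Q.emb x)⁻¹ * Q.emb x') ≤
      (2 * N) * wordNorm (gens Γ U) (x⁻¹ * x') := by
    refine Q.emb_lipschitz hU hS _ fun a H k s hs => ?_
    by_cases h : R a
    · rw [QsR a h, QsR a h, map_mul, inv_mul_cancel_left, ← normR a h, MulEquiv.apply_symm_apply]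
      exact (wordNorm_le_one (Or.inl hs)).trans (by omega)
    · rw [QsN a h, QsN a h]
      exact wordNorm_inv_mul_le (hS a) (hnsec a H _) (hnsec a H _)
  have hback : ∀ x x', wordNorm (gens Γ U) ((Q.back x)⁻¹ * Q.back x') ≤
      (2 * N) * wordNorm (gens Γ S) (x⁻¹ * x') := by
    refine Q.back_lipschitz hU hS _ fun a H c s hs => ?_
    by_cases h : R a
    · rw [QrR a h, QrR a h, map_mul, inv_mul_cancel_left, normR a h]
      exact (wordNorm_le_one (Or.inl hs)).trans (by omega)
    · rw [QrN a h, QrN a h, ← map_inv, ← map_mul, normN a h]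
      exact wordNorm_inv_mul_le (hW a) (hnJ a _) (hnJ a _)
  -- The line lifts to the intermediate graph product.
  have hline : ∀ n, Q.emb (Q.back (L.pt n)) = L.pt n := by
    refine Q.emb_back_line L.pt L.pt_zero (fun n => ⟨_, _, L.step n⟩) fun n a => ?_
    by_cases h : R a
    · exact ⟨eR a h (tail a (L.pt n)), by rw [QsR a h, MulEquiv.symm_apply_apply]⟩
    · obtain ⟨k, hk⟩ := hrange a (cls a (L.pt n)) n (hnotR a h _ _)
      exact ⟨eN a h k, by rw [QsN a h, MulEquiv.symm_apply_apply, hk]; rfl⟩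
  have hcoord : ∀ a (h : R a) H n, coord (Q.back (L.pt n)) a H =
      eR a h (coord (L.pt n) a (Q.embCls a H)) := by
    intro a h H n
    have := Q.coord_emb (Q.back (L.pt n)) a H
    rw [hline, QsR a h] at this
    rw [this, MulEquiv.apply_symm_apply]
  have hcls : ∀ a H m, cls a (L.pt m) = Q.embCls a H → cls a (Q.back (L.pt m)) = H := by
    intro a H m e
    apply Q.embCls_injective a
    rw [Q.embCls_cls, hline, e]
  choose r hr1 hr2 using fun (a : V) (H : StarClass Γ G a) => L.exists_lipschitz_height a H hS
  let T : Shear Γ J K :=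
    { sec := fun a H k => if h : R a then eR a h (P.sec a (Q.embCls a H) k) else eN a h k
      ret := fun a H x => if h : R a then P.ret a (Q.embCls a H) ((eR a h).symm x)
        else (eN a h).symm x
      ret_sec := by
        intro a H k
        by_cases h : R a
        · simp only [dif_pos h, MulEquiv.symm_apply_apply, P.ret_sec]
        · simp only [dif_neg h, MulEquiv.symm_apply_apply]
      sec_one := by
        intro a H
        by_cases h : R a
        · simp only [dif_pos h, map_one, P.sec_one]
        · simp only [dif_neg h, map_one]
      R := R
      not_R_of_adj := hRadj
      equiv := eN
      sec_eq := fun a h H k => dif_neg h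
      wit := wit
      wit_not_mem := hwit
      sh := sh
      tt := tt
      tt_ne_one := htt
      sh_ne_one := hsh
      tt_ne_sh := htsh
      line := fun n => Q.back (L.pt n)
      line_zero := by rw [L.pt_zero, Sections.back_one]
      line_step := fun n => ⟨_, _, by rw [L.step, Sections.back_mul_of]⟩
      height := fun a H => L.height a (Q.embCls a H)
      val := fun a H i => if h : R a then eR a h (L.val a (Q.embCls a H) i) else 1
      pos := fun a H c => if h : R a then r a (Q.embCls a H) ((eR a h).symm c) else 0
      height_zero := fun {a} _ H => L.height_zero a _
      height_step := fun {a} _ H => L.height_step a _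
      coord_line := by
        intro a h H n
        rw [dif_pos h, L.val_height, hcoord a h]
      pos_val := by
        intro a h H n
        rw [dif_pos h, dif_pos h, L.val_height, MulEquiv.symm_apply_apply, hr1]
      exists_cls_line := by
        intro a h H n hn
        obtain ⟨m, hm⟩ := L.exists_cls_eq a _ hn
        exact ⟨m, hcls a H m hm⟩
      cls_line := fun {a} h H n m n' h1 h2 => hcls a H m (L.cls_of_height_between a _ hS h1 h2)
      val_mem := by
        intro a h H n hn
        obtain ⟨k, hk⟩ := hrange a (Q.embCls a H) n (by omega)
        rw [dif_pos h, L.val_height, ← hk]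
        exact ⟨k, dif_pos h⟩ }
  have TsR : ∀ a (h : R a) H k, T.sec a H k = eR a h (P.sec a (Q.embCls a H) k) :=
    fun a h H k => dif_pos h
  have hT : T.Bounded W U (2 * N * D) N :=
    { closure_W := hW
      closure_U := hU
      norm_J := hnJ
      norm_tt := hntt
      norm_sh := hnsh
      norm_equiv := normN
      norm_sec := by
        intro a H k
        by_cases h : R a
        · rw [TsR a h, normR a h]; exact hnsec a _ k
        · rw [T.sec_eq a h]; exact (normN a h k).trans_le (hnJ a k)
      norm_link := by
        intro a h l hl
        obtain ⟨z, hz, e⟩ := Q.exists_emb_mul 1 hl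
        rw [one_mul, Sections.emb_one, one_mul] at e
        have h1 := hback 1 z
        rw [← e, Sections.back_one, Q.back_emb] at h1
        simp only [inv_one, one_mul, e] at h1
        exact h1.trans (Nat.mul_le_mul_left _ (hR a h z hz))
      norm_val := by
        intro a h H n m
        have e : ∀ i, T.val a H i = eR a h (L.val a (Q.embCls a H) i) := fun i => dif_pos h
        have e' : ∀ n, T.height a H n = L.height a (Q.embCls a H) n := fun n => rfl
        rw [e, e, e', e', ← map_inv, ← map_mul, normR a h, L.val_height, L.val_height,
          ← norm_of (Γ := Γ) hS, L.norm_coord_abs a _ hS, abs_sub_comm]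
      pos_lipschitz := by
        intro a h H c c'
        have e : ∀ c, T.pos a H c = r a (Q.embCls a H) ((eR a h).symm c) := fun i => dif_pos h
        have h1 := hr2 a (Q.embCls a H) ((eR a h).symm c) ((eR a h).symm c')
        rw [norm_of hS, ← map_inv, ← map_mul, ← normR a h, MulEquiv.apply_symm_apply] at h1
        rw [e, e]
        exact h1 }
  refine ⟨fun x => Q.emb (T.shear x), fun y => T.unroll (Q.back y), fun x => ?_, fun x x' => ?_,
    fun y y' => ?_, fun n => ?_⟩
  · beta_reduce
    rw [Q.back_emb, T.unroll_shear]
  · exact (hemb _ _).trans (Nat.mul_le_mul_left _ (hT.shear_lipschitz x x'))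
  · exact (hT.unroll_lipschitz _ _).trans (Nat.mul_le_mul_left _ (hback y y'))
  · obtain ⟨x, hx⟩ := T.line_mem_range n
    exact ⟨x, by beta_reduce; rw [hx]; exact hline n⟩

end GraphProduct

/-! ### Balls, and sections of finite sets -/

section Balls

variable {M : Type*} [Group M] {A : Set M}

theorem exists_wordNorm_eq (hA : Subgroup.closure A = ⊤) {x : M} {n : ℕ} (hn : n ≤ wordNorm A x) :
    ∃ y, wordNorm A y = n := by
  obtain ⟨l, hl, rfl, hlen⟩ := exists_geodesic_word hA x
  refine ⟨(l.take n).prod, ?_⟩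
  have h1 := wordNorm_prod_le hA (l.take n) fun a ha => hl a (List.mem_of_mem_take ha)
  have h2 := wordNorm_prod_le hA (l.drop n) fun a ha => hl a (List.mem_of_mem_drop ha)
  have h3 := wordNorm_mul_le hA (l.take n).prod (l.drop n).prod
  rw [List.prod_take_mul_prod_drop] at h3
  rw [List.length_take] at h1
  rw [List.length_drop] at h2
  omega

theorem succ_le_encard_ball (hA : Subgroup.closure A = ⊤) {x : M} {n : ℕ}
    (hn : n ≤ wordNorm A x) : ((n + 1 : ℕ) : ℕ∞) ≤ {y | wordNorm A y ≤ n}.encard := by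
  have h : ∀ i : Fin (n + 1), ∃ y, wordNorm A y = i := fun i =>
    exists_wordNorm_eq hA (x := x) (by have := i.2; omega)
  choose y hy using h
  have hinj : Function.Injective y := fun i j e => by
    have := hy i
    rw [e, hy j] at this
    exact Fin.ext this.symm
  calc ((n + 1 : ℕ) : ℕ∞) = ENat.card (Fin (n + 1)) := by simp
    _ = (Set.range y).encard := by rw [← Set.image_univ, hinj.encard_image, Set.encard_univ]
    _ ≤ _ := Set.encard_le_encard (by
      rintro _ ⟨i, rfl⟩
      have := i.2
      have := hy i
      simp only [Set.mem_ofPred_eq]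
      omega)

theorem min_card_le_encard_ball (hA : Subgroup.closure A = ⊤) (n : ℕ) :
    min (ENat.card M) ((n + 1 : ℕ) : ℕ∞) ≤ {y | wordNorm A y ≤ n}.encard := by
  by_cases h : ∃ x, n ≤ wordNorm A x
  · obtain ⟨x, hx⟩ := h
    exact (min_le_right _ _).trans (succ_le_encard_ball hA hx)
  · push Not at h
    have : {y | wordNorm A y ≤ n} = Set.univ := by
      ext y; simpa using (h y).le
    rw [this, Set.encard_univ]
    exact min_le_left _ _

theorem finite_ball (hA : Subgroup.closure A = ⊤) (hfin : A.Finite) (n : ℕ) :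
    {y | wordNorm A y ≤ n}.Finite := by
  have key : ∀ n, {y | ∃ l : List M, (∀ a ∈ l, a ∈ A ∨ a⁻¹ ∈ A) ∧ l.prod = y ∧
      l.length = n}.Finite := by
    intro n
    induction n with
    | zero =>
      refine (Set.finite_singleton (1 : M)).subset ?_
      rintro y ⟨l, -, rfl, h⟩
      rw [List.length_eq_zero_iff.1 h]; simp
    | succ n ih =>
      refine (Set.Finite.image2 (fun a y => a * y)
        (hfin.union (hfin.preimage inv_injective.injOn)) ih).subset ?_
      rintro y ⟨l, hl, rfl, h⟩
      cases l with
      | nil => simp at h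
      | cons a l =>
        exact ⟨a, hl a (by simp), l.prod, ⟨l, fun b hb => hl b (by simp [hb]), rfl, by simpa using h⟩,
          by simp⟩
  refine ((Set.finite_Iic n).biUnion fun m _ => key m).subset ?_
  intro y hy
  obtain ⟨l, h1, h2, h3⟩ := exists_geodesic_word hA y
  exact Set.mem_biUnion (show wordNorm A y ∈ Set.Iic n from hy) ⟨l, h1, h2, h3⟩

end Balls

theorem exists_section_onto {J G : Type*} [Group J] [Group G] [Finite J] {T : Set G}
    (h1 : (1 : G) ∈ T) (hT : T.encard = Nat.card J) :
    ∃ (sec : J → G) (ret : G → J), (∀ k, ret (sec k) = k) ∧ sec 1 = 1 ∧ Set.range sec = T := by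
  classical
  have hfin : Finite T := Set.finite_of_encard_eq_coe hT
  have hc : Nat.card J = Nat.card T := by
    rw [← ENat.card_coe_set_eq, ENat.card_eq_coe_natCard] at hT
    exact_mod_cast hT.symm
  obtain ⟨e₀⟩ : Nonempty (J ≃ T) := Finite.card_eq.1 hc
  let e : J ≃ T := e₀.trans (Equiv.swap (e₀ 1) ⟨1, h1⟩)
  have he : e 1 = ⟨1, h1⟩ := by simp [e]
  refine ⟨fun k => e k, fun x => if h : x ∈ T then e.symm ⟨x, h⟩ else 1, fun k => ?_, ?_, ?_⟩
  · simp
  · simp [he]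
  · ext x
    constructor
    · rintro ⟨k, rfl⟩; exact (e k).2
    · intro hx; exact ⟨e.symm ⟨x, hx⟩, by simp⟩

theorem ofAdd_one_pow_val (n : ℕ) [NeZero n] (k : Multiplicative (ZMod n)) :
    Multiplicative.ofAdd (1 : ZMod n) ^ (k.toAdd).val = k := by
  rw [← ofAdd_nsmul, nsmul_eq_mul, mul_one, ZMod.natCast_zmod_val, ofAdd_toAdd]

theorem closure_ofAdd_one (n : ℕ) [NeZero n] :
    Subgroup.closure {Multiplicative.ofAdd (1 : ZMod n)} = ⊤ := by
  rw [eq_top_iff]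
  rintro k -
  rw [← ofAdd_one_pow_val n k]
  exact Subgroup.pow_mem _ (Subgroup.subset_closure (Set.mem_singleton _)) _

theorem wordNorm_ofAdd_one_le (n : ℕ) [NeZero n] (k : Multiplicative (ZMod n)) :
    wordNorm {Multiplicative.ofAdd (1 : ZMod n)} k ≤ n := by
  have h := wordNorm_prod_le (closure_ofAdd_one n)
    (List.replicate (k.toAdd).val (Multiplicative.ofAdd (1 : ZMod n)))
    (fun a ha => Or.inl (List.eq_of_mem_replicate ha))
  rw [List.prod_replicate, ofAdd_one_pow_val, List.length_replicate] at h
  exact h.trans (ZMod.val_lt _).le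

namespace GraphProduct

/-! ### The vertices with long coordinates -/

variable {V : Type u} {Γ : SimpleGraph V} {G : V → Type v} [∀ a, Group (G a)]
  {S : ∀ a, Set (G a)}

theorem finite_link_of_bounded [Finite V] (hfin : ∀ a, (S a).Finite)
    (hS : ∀ a, Subgroup.closure (S a) = ⊤) {a : V} {D : ℕ}
    (hD : ∀ z ∈ genBy Γ G (Γ.Adj a), wordNorm (gens Γ S) z ≤ D) : Finite (genBy Γ G (Γ.Adj a)) :=
  (finite_ball (closure_gens hS)
    (Set.finite_iUnion fun a => (hfin a).image _) D).subset hD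

/-- If `G a` and `⟨link(a)⟩` are finite and the graph product is infinite, then some vertex lies
outside the star of `a`. -/
theorem exists_not_inStar [Infinite (GraphProduct Γ G)] (a : V) [Finite (G a)]
    [Finite (genBy Γ G (Γ.Adj a))] : ∃ b, ¬ InStar Γ a b := by
  by_contra! hstar
  have hsurj : Function.Surjective
      (fun p : G a × genBy Γ G (Γ.Adj a) => of Γ G a p.1 * (p.2 : GraphProduct Γ G)) := by
    intro y
    have hy : y ∈ genBy Γ G (InStar Γ a) :=
      genBy_mono (P := fun _ => True) (fun b _ => hstar b) (by rw [genBy_true]; trivial)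
    obtain ⟨g, l, hl, rfl⟩ := star_decomp hy
    exact ⟨⟨g, l, hl⟩, rfl⟩
  exact not_finite_iff_infinite.2 inferInstance (Finite.of_surjective _ hsurj)

namespace GeodesicLine

theorem infinite (L : GeodesicLine Γ S) : Infinite (GraphProduct Γ G) := by
  refine Infinite.of_injective L.pt fun i j h => ?_
  have := L.geo i j
  rw [h, inv_mul_cancel, wordNorm_one, eq_comm, Nat.cast_zero, abs_eq_zero] at this
  omega

variable (L : GeodesicLine Γ S)

/-- The coordinates at small heights. -/
def smallCoords (a : V) (H : StarClass Γ G a) (D : ℕ) : Set (G a) :=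
  {c | ∃ n, |L.height a H n| ≤ D ∧ coord (L.pt n) a H = c}

theorem one_mem_smallCoords (a : V) (H : StarClass Γ G a) (D : ℕ) :
    1 ∈ L.smallCoords a H D := ⟨0, by rw [L.height_zero]; simp, by rw [L.pt_zero, coord_one]⟩

theorem encard_smallCoords_le (a : V) (H : StarClass Γ G a) (D : ℕ) :
    (L.smallCoords a H D).encard ≤ ((2 * D + 1 : ℕ) : ℕ∞) := by
  have h : L.smallCoords a H D ⊆ L.val a H '' (Finset.Icc (-(D : ℤ)) D : Finset ℤ) := by
    rintro _ ⟨n, hn, rfl⟩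
    exact ⟨L.height a H n, by simpa using abs_le.1 hn, L.val_height a H n⟩
  refine (Set.encard_le_encard h).trans ((Set.encard_image_le _ _).trans ?_)
  rw [Set.encard_coe_eq_coe_finsetCard, Int.card_Icc]
  exact_mod_cast (by omega : ((D : ℤ) + 1 - -D).toNat ≤ 2 * D + 1)

/-- A finite set of prescribed size in a bounded ball which contains the small coordinates. -/
theorem exists_superset_smallCoords (hS : ∀ a, Subgroup.closure (S a) = ⊤) (a : V)
    (H : StarClass Γ G a) {D N : ℕ} (hN : 2 * D + 1 ≤ N) :
    ∃ T : Set (G a), L.smallCoords a H D ⊆ T ∧ (∀ c ∈ T, wordNorm (S a) c ≤ D + N) ∧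
      T.encard = min (ENat.card (G a)) N := by
  have h1 : L.smallCoords a H D ⊆ {c | wordNorm (S a) c ≤ D + N} := by
    rintro _ ⟨n, hn, rfl⟩
    have := L.norm_coord_le a H hS n
    rw [norm_of hS] at this
    simp only [Set.mem_ofPred_eq]
    omega
  have h2 : (L.smallCoords a H D).encard ≤ min (ENat.card (G a)) N := by
    refine le_min ?_ ((L.encard_smallCoords_le a H D).trans (by exact_mod_cast hN))
    rw [← Set.encard_univ]
    exact Set.encard_le_encard (Set.subset_univ _)
  have h3 : min (ENat.card (G a)) N ≤ {c | wordNorm (S a) c ≤ D + N}.encard :=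
    (min_le_min_left _ (by exact_mod_cast (by omega : N ≤ D + N + 1))).trans
      (min_card_le_encard_ball (hS a) (D + N))
  obtain ⟨T, hT1, hT2, hT3⟩ := Set.exists_superset_subset_encard_eq h1 h2 h3
  exact ⟨T, hT1, hT2, hT3⟩

end GeodesicLine

/-- The bi-Lipschitz map for a geodesic line through `1`, with constants depending on the Morse
gauge and on `k₀` only. -/
theorem exists_cyclic_biLipschitz [Finite V] [∀ a, Nontrivial (G a)] (hfin : ∀ a, (S a).Finite)
    (hS : ∀ a, Subgroup.closure (S a) = ⊤)
    (hinf : ∀ a, Infinite (G a) → Infinite (linkSubgroup Γ G a)) {k₀ : ℕ}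
    (hk : ∀ a, (k₀ : ℕ∞) ≤ ENat.card (G a)) {M : ℝ≥0 → ℝ≥0 → ℝ≥0} (L : GeodesicLine Γ S)
    (hM : (cayleyGraph Γ G S).IsMorse M (Set.range L.pt)) {D N : ℕ} (hD : D = morseBound M)
    (hN : N = D + (k₀ + (2 * D + 1))) :
    ∃ ν : V → ℕ, (∀ a, 2 ≤ ν a ∧ k₀ ≤ ν a) ∧
    ∃ (f : CyclicGraphProduct Γ ν → GraphProduct Γ G) (g : GraphProduct Γ G → CyclicGraphProduct Γ ν),
      (∀ x, g (f x) = x) ∧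
      (∀ x x', wordNorm (gens Γ S) ((f x)⁻¹ * f x') ≤
        (2 * N) * ((3 + 4 * (2 * N * D) + 6 * N) * (cyclicCayleyGraph Γ ν).dist x x')) ∧
      (∀ y y', (cyclicCayleyGraph Γ ν).dist (g y) (g y') ≤
        (2 * (2 * N * D) + 6 * N + 2) * ((2 * N) * wordNorm (gens Γ S) (y⁻¹ * y'))) ∧
      ∀ n, L.pt n ∈ Set.range f := by
  have hD20 : 20 ≤ D := by rw [hD, morseBound]; omega
  set N₀ := k₀ + (2 * D + 1) with hN₀
  have hfinite : ∀ a, min (ENat.card (G a)) (N₀ : ℕ∞) ≠ ⊤ := fun a =>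
    ne_top_of_le_ne_top (ENat.natCast_ne_top N₀) (min_le_right _ _)
  let ν : V → ℕ := fun a => (min (ENat.card (G a)) (N₀ : ℕ∞)).toNat
  have hν : ∀ a, (ν a : ℕ∞) = min (ENat.card (G a)) (N₀ : ℕ∞) := fun a =>
    ENat.natCast_toNat (hfinite a)
  have hν_le : ∀ a, ν a ≤ N₀ := fun a => by
    have : (ν a : ℕ∞) ≤ N₀ := by rw [hν]; exact min_le_right _ _
    exact_mod_cast this
  have le_hν : ∀ a (m : ℕ), (m : ℕ∞) ≤ ENat.card (G a) → m ≤ N₀ → m ≤ ν a := by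
    intro a m h1 h2
    have : (m : ℕ∞) ≤ ν a := by rw [hν]; exact le_min h1 (by exact_mod_cast h2)
    exact_mod_cast this
  have hν2 : ∀ a, 2 ≤ ν a := fun a => le_hν a 2 (by
    have := Order.add_one_le_of_lt (ENat.one_lt_card (α := G a))
    exact_mod_cast this) (by omega)
  have : ∀ a, NeZero (ν a) := fun a => ⟨by have := hν2 a; omega⟩
  -- The vertices at which some coordinate of the line is long.
  let R : V → Prop := fun a => ∃ H n, (D : ℤ) < |L.height a H n|
  have hRlong : ∀ a, R a → ∃ H n, D < wordNorm (gens Γ S) (of Γ G a (coord (L.pt n) a H)) := by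
    rintro a ⟨H, n, h⟩
    have := L.norm_coord_le a H hS n
    exact ⟨H, n, by omega⟩
  have hRlink : ∀ a, R a → ∀ z ∈ genBy Γ G (Γ.Adj a), wordNorm (gens Γ S) z ≤ D := by
    rintro a ⟨H, n, h⟩
    subst hD
    exact L.link_bounded a H hS hM h
  have hwit : ∀ a, ∃ w, R a → ¬ InStar Γ a w := by
    intro a
    by_cases ha : R a
    · have h1 := finite_link_of_bounded hfin hS (hRlink a ha)
      have h2 : Finite (G a) := by
        by_contra hnf
        have := hinf a (not_finite_iff_infinite.1 hnf)
        rw [linkSubgroup_eq_genBy] at this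
        exact not_finite_iff_infinite.2 this h1
      have := L.infinite
      obtain ⟨w, hw⟩ := exists_not_inStar (Γ := Γ) (G := G) a
      exact ⟨w, fun _ => hw⟩
    · exact ⟨a, fun h => absurd h ha⟩
  choose wit hwit using hwit
  have hν3 : ∀ a, R a → 3 ≤ ν a := by
    intro a ha
    refine le_hν a 3 ?_ (by omega)
    obtain ⟨H, n, h⟩ := hRlong a ha
    rw [norm_of hS] at h
    refine (succ_le_encard_ball (hS a) (n := 2) 
      (by omega : 2 ≤ wordNorm (S a) (coord (L.pt n) a H))).trans ?_
    rw [← Set.encard_univ]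
    exact Set.encard_le_encard (Set.subset_univ _)
  have hsec : ∀ a (H : StarClass Γ G a), ∃ (sec : Multiplicative (ZMod (ν a)) → G a)
      (ret : G a → Multiplicative (ZMod (ν a))), (∀ k, ret (sec k) = k) ∧ sec 1 = 1 ∧
      (∀ k, wordNorm (S a) (sec k) ≤ N) ∧ L.smallCoords a H D ⊆ Set.range sec := by
    intro a H
    obtain ⟨T, hT1, hT2, hT3⟩ := L.exists_superset_smallCoords hS a H (D := D) (N := N₀) (by omega)
    have hc : T.encard = Nat.card (Multiplicative (ZMod (ν a))) := by
      rw [hT3, ← hν]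
      congr 1
      exact (Nat.card_zmod _).symm
    have : Finite (Multiplicative (ZMod (ν a))) := inferInstanceAs (Finite (ZMod (ν a)))
    obtain ⟨sec, ret, h1, h2, h3⟩ := exists_section_onto (hT1 (L.one_mem_smallCoords a H D)) hc
    exact ⟨sec, ret, h1, h2, fun k => by rw [hN]; exact hT2 _ (by rw [← h3]; exact ⟨k, rfl⟩),
      by rw [h3]; exact hT1⟩
  choose sec ret h1 h2 h3 h4 using hsec
  let P : Sections Γ (fun a => Multiplicative (ZMod (ν a))) G := ⟨sec, ret, h1, h2⟩
  have hW : ∀ a, Subgroup.closure {Multiplicative.ofAdd (1 : ZMod (ν a))} = ⊤ := fun a =>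
    closure_ofAdd_one (ν a)
  have hF : ∀ a, Fact (1 < ν a) := fun a => ⟨hν2 a⟩
  refine ⟨ν, fun a => ⟨hν2 a, le_hν a k₀ (hk a) (by omega)⟩, ?_⟩
  have hRadj : ∀ {a b}, R a → Γ.Adj a b → ¬ R b := by
    intro a b ha hab hb
    obtain ⟨H, n, h⟩ := hRlong b hb
    have := hRlink a ha _ (of_mem_genBy hab (coord (L.pt n) b H))
    omega
  have hnotR : ∀ a, ¬ R a → ∀ H n, |L.height a H n| ≤ D := by
    intro a ha H n
    by_contra! h
    exact ha ⟨H, n, h⟩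
  have htt : ∀ a, Multiplicative.ofAdd (-1 : ZMod (ν a)) ≠ 1 := by
    intro a h
    have : (-1 : ZMod (ν a)) = 0 := h
    exact neg_ne_zero.2 one_ne_zero this
  have hsh : ∀ {a}, R a → Multiplicative.ofAdd (1 : ZMod (ν a)) ≠ 1 := by
    intro a _ h
    have : (1 : ZMod (ν a)) = 0 := h
    exact one_ne_zero this
  have htsh : ∀ {a}, R a →
      Multiplicative.ofAdd (-1 : ZMod (ν a)) ≠ Multiplicative.ofAdd (1 : ZMod (ν a)) := by
    intro a ha h
    have h' : (-1 : ZMod (ν a)) = 1 := h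
    have : Fact (2 < ν a) := ⟨hν3 a ha⟩
    exact ZMod.neg_one_ne_one h'
  obtain ⟨f, g, hf1, hf2, hf3, hf4⟩ := exists_biLipschitz_of_line hS hW L P (R := R) (D := D) (N := N)
    (by omega) (by omega) hRlink hRadj hnotR (fun a H n hn => h4 a H ⟨n, hn, rfl⟩) wit
    (fun {a} ha => hwit a ha) (fun a => Multiplicative.ofAdd 1) (fun a => Multiplicative.ofAdd (-1))
    htt hsh htsh (fun a => wordNorm_le_one (Or.inr (by rw [ofAdd_neg, inv_inv]; rfl)))
    (fun a => wordNorm_le_one (Or.inl rfl))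
    (fun a k => (wordNorm_ofAdd_one_le (ν a) k).trans ((hν_le a).trans (by omega))) h3
  refine ⟨f, g, hf1, fun x x' => ?_, fun y y' => ?_, hf4⟩
  · rw [cyclicCayleyGraph, cayleyGraph_eq, dist_eq_wordNorm]; exact hf2 x x'
  · rw [cyclicCayleyGraph, cayleyGraph_eq, dist_eq_wordNorm]; exact hf3 y y'

end GraphProduct

theorem mainTheorem5 (M : ℝ≥0 → ℝ≥0 → ℝ≥0) (k₀ : ℕ) :
    ∃ A B : ℝ, 0 < A ∧ 0 ≤ B ∧
      ∀ (V : Type u) [Finite V] (Γ : SimpleGraph V)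
        (G : V → Type v) [∀ a, Group (G a)] [∀ a, Nontrivial (G a)]
        (S : ∀ a, Set (G a)),
        (∀ a, (S a).Finite) →
        (∀ a, Subgroup.closure (S a) = ⊤) →
        (∀ a, Infinite (G a) → Infinite (GraphProduct.linkSubgroup Γ G a)) →
        (∀ a, (k₀ : ℕ∞) ≤ ENat.card (G a)) →
        ∀ γ : ℤ → GraphProduct Γ G,
          (GraphProduct.cayleyGraph Γ G S).IsBiinfiniteGeodesic γ →
          (GraphProduct.cayleyGraph Γ G S).IsMorse M (Set.range γ) →
          ∃ ν : V → ℕ, (∀ a, 2 ≤ ν a ∧ k₀ ≤ ν a) ∧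
            ∃ f : CyclicGraphProduct Γ ν → GraphProduct Γ G,
              (cyclicCayleyGraph Γ ν).IsQIEmbedding (GraphProduct.cayleyGraph Γ G S) A B f ∧
                Set.range γ ⊆ Set.range f := by
  obtain ⟨D, hD⟩ : ∃ D, D = GraphProduct.morseBound M := ⟨_, rfl⟩
  obtain ⟨N, hN⟩ : ∃ N, N = D + (k₀ + (2 * D + 1)) := ⟨_, rfl⟩
  obtain ⟨X, hX⟩ : ∃ X, X = (2 * N) * (3 + 4 * (2 * N * D) + 6 * N) := ⟨_, rfl⟩
  obtain ⟨Y, hY⟩ : ∃ Y, Y = (2 * (2 * N * D) + 6 * N + 2) * (2 * N) := ⟨_, rfl⟩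
  have hpos : (0 : ℝ) < ((X + Y + 1 : ℕ) : ℝ) := by positivity
  refine ⟨(X + Y + 1 : ℕ), 0, hpos, le_rfl, ?_⟩
  intro V _ Γ G _ _ S hfin hS hinf hk γ hγ hM
  obtain ⟨L, hL⟩ := GraphProduct.exists_geodesicLine hS hγ
  have hM' : (GraphProduct.cayleyGraph Γ G S).IsMorse M (Set.range L.pt) := by
    have e : L.pt = fun n => (γ 0)⁻¹ * γ n := funext hL
    rw [e]
    exact GraphProduct.isMorse_translate hM _
  obtain ⟨ν, hν, f, g, h1, h2, h3, h4⟩ :=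
    GraphProduct.exists_cyclic_biLipschitz hfin hS hinf hk L hM' hD hN
  have hd : ∀ x x', (GraphProduct.cayleyGraph Γ G S).dist (γ 0 * f x) (γ 0 * f x') =
      wordNorm (GraphProduct.gens Γ S) ((f x)⁻¹ * f x') := by
    intro x x'
    rw [GraphProduct.cayleyGraph_eq, mulCayley_dist_mul_left, dist_eq_wordNorm]
  refine ⟨ν, hν, fun x => γ 0 * f x, fun x x' => ?_, ?_⟩
  · have e1 := h2 x x'
    have e2 := h3 (f x) (f x')
    rw [h1, h1, ← mul_assoc, ← hY] at e2
    rw [← mul_assoc, ← hX] at e1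
    rw [hd, one_div, sub_zero, add_zero, inv_mul_le_iff₀ hpos]
    constructor
    · exact_mod_cast e2.trans (Nat.mul_le_mul_right _ (by omega))
    · exact_mod_cast e1.trans (Nat.mul_le_mul_right _ (by omega))
  · rintro _ ⟨n, rfl⟩
    obtain ⟨x, hx⟩ := h4 n
    exact ⟨x, by beta_reduce; rw [hx, hL, mul_inv_cancel_left]⟩
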